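/- Let $\mathbb{K}$ be an algebraically closed field of arbitrary characteristic and let $f\in\mathbb{K}[[x,y]]$ be irreducible. Then the minimal tree $\mathcal{T}$ of $f$ described below exists (in particular the algorithm stops), and the semigroup (with $0$) generated by its sequence $(v_0,\dots,v_r)$ is the value semigroup of $f$: $$\langle v_0,v_1,\dots,v_r\rangle=\Gamma(f):=\{\,i(f,g) : g\in\mathbb{K}[[x,y]],\ f\nmid g\,\},\qquad i(f,g)=\operatorname{ord}_t g(\varphi(t),\psi(t)),$$ where $t\mapsto(\varphi(t),\psi(t))$ is a primitive parametrization of $f=0$, i.e. $\varphi,\psi\in t\,\mathbb{K}[[t]]$, $f(\varphi,\psi)=0$, and $(\varphi,\psi)$ is not of the form $(\varphi_1(s(t)),\psi_1(s(t)))$ with $s(0)=0$ and $\operatorname{ord}s\neq1$. *The Newton tree of $f$.* Start with $F=f$ and $c=0$. If the Newton polygon of $f$ has no compact edge ($f$ is $x$ or $y$ up to a unit), the tree has no vertex. Otherwise, at each stage the Newton polygon of $F$ has exactly one compact edge, on a line $pX+qY=N$ with $p,q\ge1$ coprime, and its face polynomial is, up to a constant and a monomial factor, $(x^q-\mu y^p)^\nu$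 with $\mu\ne0$, $\nu\ge1$. The stage gives a vertex of multiplicity $N$, with the decoration $b=q+cp$ near it on the edge to its left (leading to the preceding vertex or, for the first vertex, to an arrow decorated by $(0)$) and the decoration $a=p$ near it on an edge to an arrow decorated by $(0)$ below it. If $\nu=1$, the arrow representing $f$ is attached to the vertex and the algorithm stops. If $\nu>1$, replace $F$ by its Hamburger–Noether transform $$F\big((Y+\bar\mu)^{q'}X^{p},\,(Y+\bar\mu)^{p'}X^{q}\big),\qquad p',q'\in\mathbb{Z}_{\ge0},\quad pp'-qq'=\pm1,\quad \bar\mu=\mu^{-1}\text{ resp. }\bar\mu=\mu,$$ replace $c$ by $ab$, and continue; the new vertex is joined to the previous one. *The minimal tree* $\mathcal{T}$ arises by repeating the following operations as long as possible: erase an edge that joins a vertex to an arrow decorated by $(0)$ and has decoration $1$, together with this arrow; erase a vertex of valency two, keeping the decorations of the remaining vertices (a dead end that remains at the first vertex after its left one has been erased is then regarded as its left one; if both have decoration $1$, only one of them is erased before the vertex, which then has valency two, is erased). Thus $\mathcal{T}$ is a chain of vertices $w_1,\dots,w_r$ with multiplicities $N_i$, decorations $b_1$ (on the arrow $(0)$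 to the left of $w_1$) and $a_i$ (on the arrow $(0)$ below $w_i$), and one puts $$v_0=\frac{N_1}{b_1},\qquad v_i=\frac{N_i}{a_i}\quad(1\le i\le r).$$ If $r=0$ (which happens exactly when $f$ is smooth) one puts $v_0=1$. -/

import Mathlib

noncomputable section

namespace NewtonTree

variable {K : Type*} [Field K]

/-! ### Newton polygon and face polynomials

A series `F ∈ K[[x, y]]` is a `MvPowerSeries (Fin 2) K`, with `x = X 0` and `y = X 1`. -/

/-- The face polynomial of `F` on the supporting line `p i + q j = N` of its Newton polygon:
the sum of the terms `c x ^ i y ^ j` of `F` with `p i + q j = N`. -/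
def facePoly (F : MvPowerSeries (Fin 2) K) (p q N : ℕ) : MvPowerSeries (Fin 2) K :=
  MvPowerSeries.weightedHomogeneousComponent ![p, q] N F

/-- `x ^ q - μ y ^ p`. -/
def rootFactor (p q : ℕ) (μ : K) : MvPowerSeries (Fin 2) K :=
  MvPowerSeries.X 0 ^ q - MvPowerSeries.C μ * MvPowerSeries.X 1 ^ p

/-- The Newton polygon of `F` has a compact edge on the line `p i + q j = N` (`p`, `q` positive and
coprime, `N` the least value of `p i + q j` on the support of `F`), and `x ^ q - μ y ^ p`, `μ ≠ 0`,
is a factor of its face polynomial, of multiplicity exactly `ν ≥ 1`.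
(A face polynomial with such a factor has at least two terms, so that the face is an edge. Over an
algebraically closed field the face polynomial of every compact edge has such a factor.) -/
structure IsEdgeRoot (F : MvPowerSeries (Fin 2) K) (p q N : ℕ) (μ : K) (ν : ℕ) : Prop where
  p_pos : 0 < p
  q_pos : 0 < q
  coprime : Nat.Coprime p q
  order_eq : MvPowerSeries.weightedOrder ![p, q] F = (N : ℕ∞)
  root_ne_zero : μ ≠ 0
  mult_pos : 0 < ν
  dvd : rootFactor p q μ ^ ν ∣ facePoly F p q N
  not_dvd : ¬ rootFactor p q μ ^ (ν + 1) ∣ facePoly F p q N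

/-- The Newton polygon of `F` has exactly one compact edge and the face polynomial of this edge
has exactly one factor `x ^ q - μ y ^ p` with `μ ≠ 0`; `ν` is its multiplicity. -/
structure IsOnlyEdgeRoot (F : MvPowerSeries (Fin 2) K) (p q N : ℕ) (μ : K) (ν : ℕ) : Prop where
  isEdgeRoot : IsEdgeRoot F p q N μ ν
  only : ∀ (p₁ q₁ N₁ : ℕ) (μ₁ : K) (ν₁ : ℕ), IsEdgeRoot F p₁ q₁ N₁ μ₁ ν₁ → p₁ = p ∧ q₁ = q ∧ μ₁ = μ

/-! ### The Hamburger-Noether transform -/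

/-- `F ((Y + m) ^ q' * X ^ p, (Y + m) ^ p' * X ^ q)`. The total transform of `F`; it is a multiple
of `X ^ N`, where `N` is the weighted order of `F`. -/
def hnTransform (p q p' q' : ℕ) (m : K) (F : MvPowerSeries (Fin 2) K) :
    MvPowerSeries (Fin 2) K :=
  MvPowerSeries.subst
    (![(MvPowerSeries.X 1 + MvPowerSeries.C m) ^ q' * MvPowerSeries.X 0 ^ p,
       (MvPowerSeries.X 1 + MvPowerSeries.C m) ^ p' * MvPowerSeries.X 0 ^ q] :
      Fin 2 → MvPowerSeries (Fin 2) K) F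

/-- The admissible data of a Hamburger-Noether transform at the root `μ` of the `(p, q)`-edge:
the matrix with rows `(p, q')` and `(q, p')` has determinant `1` or `-1`, and the new origin
is put at the point `m = μ⁻¹` or `m = μ`, respectively, of the exceptional divisor, the one where
the total transform of `x ^ q - μ y ^ p` has its further zero. -/
def IsHNData (p q p' q' : ℕ) (μ m : K) : Prop :=
  (p * p' = q * q' + 1 ∧ m = μ⁻¹) ∨ (q * q' = p * p' + 1 ∧ m = μ)

/-! ### Newton trees with exactly one arrow that is not decorated by `(0)` -/

/-- A vertex of a linear decorated tree
`(0) <--- w₁ --- w₂ --- ⋯ --- wₛ --->`, drawn from left to right, in which every vertex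
carries at most one further arrow decorated by `(0)`, below it.
* `N` is the multiplicity of the vertex;
* `b` is the decoration near the vertex of the edge on its left (which leads to the preceding
  vertex or, for the first vertex, to the arrow `(0)` on the left: a dead end);
* `a` is the decoration near the vertex of the dead end below it, `none` if there is none. -/
structure Vertex where
  N : ℕ
  b : ℕ
  a : Option ℕ

/-- A linear decorated tree `(0) <--- w₁ --- w₂ --- ⋯ --- wₛ --->`, given by its vertices from
left to right. For `s = 0` it is the edge between the arrow `(0)` and the other arrow. -/
abbrev LinTree := List Vertex

/-- `IsGlued F c T`: the Newton tree of the total transform `F` is the linear tree `T`, its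
decorations being those after gluing to a preceding vertex for which the product of its two
decorations is `c` (`c = 0`: no preceding vertex). The `(p, q)`-edge on `p i + q j = N` gives a
vertex with multiplicity `N`, decoration `q + c * p` on the edge above it (drawn on the left) and
`p` on the edge below it. If the root of the face polynomial is simple, the arrow of the series
is attached to it; otherwise the Newton tree of the Hamburger-Noether transform is glued to it. -/
inductive IsGlued : MvPowerSeries (Fin 2) K → ℕ → LinTree → Prop
  | last (F : MvPowerSeries (Fin 2) K) (c p q N : ℕ) (μ : K)
      (h : IsOnlyEdgeRoot F p q N μ 1) :
      IsGlued F c [⟨N, q + c * p, some p⟩]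
  | step (F : MvPowerSeries (Fin 2) K) (c p q N : ℕ) (μ : K) (ν : ℕ)
      (h : IsOnlyEdgeRoot F p q N μ ν) (hν : 1 < ν)
      (p' q' : ℕ) (m : K) (hm : IsHNData p q p' q' μ m)
      (T : LinTree) (hT : IsGlued (hnTransform p q p' q' m F) ((q + c * p) * p) T) :
      IsGlued F c (⟨N, q + c * p, some p⟩ :: T)

/-- The Newton tree of the irreducible series `f` is the linear tree `T`. If the Newton polygon
of `f` has no compact edge (`f` is `x` or `y` up to a unit), the tree has no vertex. -/
def IsNewtonTree (f : MvPowerSeries (Fin 2) K) (T : LinTree) : Prop :=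
  ((∀ (p q N : ℕ) (μ : K) (ν : ℕ), ¬ IsEdgeRoot f p q N μ ν) ∧ T = []) ∨ IsGlued f 0 T

/-- The erasing operations. A dead end decorated by `1` is erased together with its arrow; a vertex
of valency two is erased, and the decorations of the remaining vertices are kept.
* `deadEnd`: a dead end below a vertex;
* `leftEnd`: the dead end on the left of the first vertex; the remaining dead end of this vertex
  is then drawn on the left;
* `vertex`: a vertex without dead end below it has valency two. -/
inductive Erase : LinTree → LinTree → Prop
  | deadEnd (L R : LinTree) (N b : ℕ) :
      Erase (L ++ ⟨N, b, some 1⟩ :: R) (L ++ ⟨N, b, none⟩ :: R)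
  | leftEnd (R : LinTree) (N a : ℕ) :
      Erase (⟨N, 1, some a⟩ :: R) (⟨N, a, none⟩ :: R)
  | vertex (L R : LinTree) (N b : ℕ) :
      Erase (L ++ ⟨N, b, none⟩ :: R) (L ++ R)

/-- `T` is the minimal tree of `f`: it arises from the Newton tree of `f` by erasing operations,
and no further one is possible. -/
def IsMinimalTree (f : MvPowerSeries (Fin 2) K) (T : LinTree) : Prop :=
  ∃ T₀, IsNewtonTree f T₀ ∧ Relation.ReflTransGen Erase T₀ T ∧ ∀ T₁, ¬ Erase T T₁

/-- The sequence `v₀ = N₁ / b₁, v₁ = N₁ / a₁, …, vᵣ = Nᵣ / aᵣ` of a minimal tree; these are the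
multiplicities of its arrows `(0)` (the divisions are exact). For a tree without vertex the
sequence is `v₀ = 1` (`v₀ = a₁ ⋯ aᵣ`, the empty product). -/
def treeSequence : LinTree → List ℕ
  | [] => [1]
  | w :: T => w.N / w.b :: (w :: T).filterMap fun u => u.a.map fun a => u.N / a

/-! ### The semigroup of an irreducible series -/

/-- `g (φ(t), ψ(t)) ∈ K[[t]]`, for `φ`, `ψ` without constant term. -/
def evalAt (φ ψ : PowerSeries K) (g : MvPowerSeries (Fin 2) K) : PowerSeries K :=
  MvPowerSeries.subst (![φ, ψ] : Fin 2 → MvPowerSeries Unit K) g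

/-- `t ↦ (φ(t), ψ(t))` is a primitive parametrization of `f = 0` at the origin: `φ` and `ψ` have no
constant term, `f (φ, ψ) = 0`, and `(φ, ψ)` is not of the form `(φ₁(s(t)), ψ₁(s(t)))` with
`s(0) = 0` except for `s` of order one. (In particular `(φ, ψ) ≠ (0, 0)`.) -/
structure IsPrimitiveParam (f : MvPowerSeries (Fin 2) K) (φ ψ : PowerSeries K) : Prop where
  fst_zero : PowerSeries.constantCoeff φ = 0
  snd_zero : PowerSeries.constantCoeff ψ = 0
  eval_eq_zero : evalAt φ ψ f = 0
  primitive : ∀ s φ₁ ψ₁ : PowerSeries K, PowerSeries.constantCoeff s = 0 →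
    φ = PowerSeries.subst s φ₁ → ψ = PowerSeries.subst s ψ₁ → PowerSeries.order s = 1

/-- The semigroup `Γ(f)` of the irreducible series `f`: the set of the numbers
`v_f(g) = i(f, g) = ord_t g (φ(t), ψ(t))` for `g` not a multiple of `f`, where `(φ, ψ)` is a
primitive parametrization of `f = 0` (it is unique up to a change of the parameter). -/
def valueSemigroup (f : MvPowerSeries (Fin 2) K) : Set ℕ :=
  {n | ∃ φ ψ : PowerSeries K, IsPrimitiveParam f φ ψ ∧
    ∃ g : MvPowerSeries (Fin 2) K, ¬ f ∣ g ∧ PowerSeries.order (evalAt φ ψ g) = (n : ℕ∞)}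

end NewtonTree

end

noncomputable section

namespace NewtonTree

open PowerSeries (coeff X C constantCoeff mk order)

variable {K : Type*} [Field K]

/-! The branch is studied through a primitive parametrization `(φ, ψ)`, which is followed through
the Hamburger–Noether transforms. If the orders of `φ` and `ψ` are `pν` and `qν` with `p`, `q`
coprime, the pair is the image of a pair `(χ, υ)` with `ord χ = ν`, because the exponent matrix is
unimodular (`exists_hn_preimage`). Primitivity is inherited, and the first order drops if `p > 1`.
An endless run of steps with `p = 1` would make `ψ` a series in `φ`, so that `ord φ = 1` already;
hence a smooth pair is reached (`IsPrimPair.resolves`). The same process, run on the equation with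
roots of face polynomials, produces a parametrization (`hasZero_of_order_eq`). No roots of `t` are
extracted, so the characteristic is irrelevant.

The algorithm sees only the equation. The link is the notion of a minimal series: one that vanishes
on the pair and has the least possible order on `x = 0`, namely `ord φ`. Its face polynomial must be
a constant times `(x ^ q - μ y ^ p) ^ ν` and its strict transform is again minimal
(`IsMinimalFor.face`). This rests on a count: a polynomial with a `k`-fold nonzero root spans at
least `k` degrees, so the face spans at least `p k` in the `y`-direction
(`exists_support_of_X_pow_dvd`). Minimal series exist and generate the kernel of the evaluation, so
an irreducible `f` vanishing on the pair is minimal (`IsMinimalFor.of_irreducible`).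

For the semigroup, let `A` be the algebra of total transforms of all series, and `E` the exponents
`e` for which `A` contains `x ^ e` times a unit. One stage replaces `E` by `p E + b ℕ` with `b = q +
c p`, and `c` by `b p`, which bounds the conductor (`IsStage.step`). On a smooth pair the values of
`A` are exactly `E` (`IsStage.valueSet_eq`), so the last `E` is the value semigroup.

At a stage with `n = ord φ = p ν` the multiplicity is `N = p b ν`; thus `N / a = b ν` and `N / b =
n`, and `ν (p E + b ℕ)` is generated by `n E` and `N / a`. Unrolling from `E = ℕ` gives the
generators. Vertices with a decoration `1` contribute nothing new, and these are the ones that the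
erasing operations remove; the others (`core`) are an invariant of the erasing. -/

/-- The exponent of the monomial `x ^ i * y ^ j`. -/
def bexp (i j : ℕ) : Fin 2 →₀ ℕ := Finsupp.single 0 i + Finsupp.single 1 j

@[simp] lemma bexp_zero (i j : ℕ) : bexp i j 0 = i := by simp [bexp]

@[simp] lemma bexp_one (i j : ℕ) : bexp i j 1 = j := by simp [bexp]

lemma bexp_eta (d : Fin 2 →₀ ℕ) : bexp (d 0) (d 1) = d := by
  ext k; fin_cases k <;> simp

/-- Pairs of natural numbers as exponents of monomials in two variables. -/
def bexpEquiv : ℕ × ℕ ≃ (Fin 2 →₀ ℕ) where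
  toFun a := bexp a.1 a.2
  invFun d := (d 0, d 1)
  left_inv a := by simp
  right_inv d := bexp_eta d

lemma weight_bexp (p q i j : ℕ) : Finsupp.weight ![p, q] (bexp i j) = p * i + q * j := by
  simp [bexp, Finsupp.weight_single, mul_comm]

/-- The coefficient of `x ^ i * y ^ j`. -/
def bcoeff (i j : ℕ) : MvPowerSeries (Fin 2) K →ₗ[K] K := MvPowerSeries.coeff (bexp i j)

lemma bcoeff_ext {F G : MvPowerSeries (Fin 2) K} (h : ∀ i j, bcoeff i j F = bcoeff i j G) :
    F = G := by
  ext d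
  rw [← bexp_eta d]
  exact h _ _

/-! ### Series in `x` over `K[[y]]` and the restriction to `x = 0`. -/

/-- A series in `x, y` as a series in `x` with coefficients in `K[[y]]`. -/
def rows : MvPowerSeries (Fin 2) K →+* PowerSeries (PowerSeries K) :=
  (PowerSeries.map (MvPowerSeries.renameEquiv K
    (Equiv.ofUnique (Fin 1) Unit)).toRingEquiv.toRingHom).comp
    (MvPowerSeries.finSuccEquiv K 1).toRingEquiv.toRingHom

@[simp] lemma coeff_rows (F : MvPowerSeries (Fin 2) K) (i j : ℕ) :
    coeff j (coeff i (rows F)) = bcoeff i j F := by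
  have h1 : (Finsupp.single () j : Unit →₀ ℕ) =
      (Finsupp.single (0 : Fin 1) j).embDomain (Equiv.ofUnique (Fin 1) Unit).toEmbedding := by
    ext; simp [Finsupp.embDomain_single]
  have h2 : (Finsupp.single (0 : Fin 1) j).cons i = bexp i j := by
    ext k; fin_cases k
    · simp
    · simpa using Finsupp.cons_succ (0 : Fin 1) i (Finsupp.single (0 : Fin 1) j)
  have := MvPowerSeries.coeff_coeff_finSuccEquiv (R := K) (n := 1) F (k := i)
    (x := Finsupp.single 0 j)
  rw [h2] at this
  simp only [rows, RingHom.comp_apply, PowerSeries.coeff_map]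
  rw [bcoeff, ← this, PowerSeries.coeff, h1]
  exact MvPowerSeries.coeff_embDomain_rename (Equiv.ofUnique (Fin 1) Unit).toEmbedding _ _

/-- The series in `x, y` with given rows. -/
def ofRows (P : PowerSeries (PowerSeries K)) : MvPowerSeries (Fin 2) K :=
  fun d => coeff (d 1) (coeff (d 0) P)

@[simp] lemma bcoeff_ofRows (P : PowerSeries (PowerSeries K)) (i j : ℕ) :
    bcoeff i j (ofRows P) = coeff j (coeff i P) := by
  change coeff (bexp i j 1) (coeff (bexp i j 0) P) = _
  simp

@[simp] lemma rows_ofRows (P : PowerSeries (PowerSeries K)) : rows (ofRows P) = P := by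
  ext i j; simp

lemma rows_injective : Function.Injective (rows (K := K)) := fun F G h =>
  bcoeff_ext fun i j => by rw [← coeff_rows, h, coeff_rows]

@[simp] lemma rows_X_zero : rows (MvPowerSeries.X 0 : MvPowerSeries (Fin 2) K) = X := by
  simp [rows]

@[simp] lemma rows_X_one : rows (MvPowerSeries.X 1 : MvPowerSeries (Fin 2) K) = C X := by
  have := MvPowerSeries.finSuccEquiv_X_succ (R := K) (n := 1) 0
  simp only [Fin.succ_zero_eq_one] at this
  simp [rows, this]
  rfl

@[simp] lemma rows_C (a : K) : rows (MvPowerSeries.C a : MvPowerSeries (Fin 2) K) = C (C a) := by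
  simp [rows]
  rfl

/-- `F(0, y)`. -/
def restr : MvPowerSeries (Fin 2) K →+* PowerSeries K :=
  (constantCoeff (R := PowerSeries K)).comp rows

lemma restr_apply (F : MvPowerSeries (Fin 2) K) : restr F = coeff 0 (rows F) := by
  simp [restr]

@[simp] lemma coeff_restr (F : MvPowerSeries (Fin 2) K) (j : ℕ) :
    coeff j (restr F) = bcoeff 0 j F := by
  rw [restr_apply, coeff_rows]

@[simp] lemma restr_X_zero : restr (MvPowerSeries.X 0 : MvPowerSeries (Fin 2) K) = 0 := by
  simp [restr]

@[simp] lemma restr_X_one : restr (MvPowerSeries.X 1 : MvPowerSeries (Fin 2) K) = X := by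
  simp [restr]

@[simp] lemma restr_C (a : K) : restr (MvPowerSeries.C a : MvPowerSeries (Fin 2) K) = C a := by
  simp [restr]

lemma X_pow_dvd_iff_rows {F : MvPowerSeries (Fin 2) K} {a : ℕ} :
    MvPowerSeries.X 0 ^ a ∣ F ↔ ∀ i < a, coeff i (rows F) = 0 := by
  rw [← PowerSeries.X_pow_dvd_iff]
  constructor
  · rintro ⟨G, rfl⟩
    simp
  · rintro ⟨P, hP⟩
    exact ⟨ofRows P, rows_injective (by simp [hP])⟩

lemma bcoeff_X_pow_mul (a i j : ℕ) (F : MvPowerSeries (Fin 2) K) :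
    bcoeff (a + i) j (MvPowerSeries.X 0 ^ a * F) = bcoeff i j F := by
  rw [← coeff_rows, map_mul, map_pow, rows_X_zero, add_comm, PowerSeries.coeff_X_pow_mul,
    coeff_rows]

lemma bcoeff_X_pow_mul_of_lt {a i : ℕ} (h : i < a) (j : ℕ) (F : MvPowerSeries (Fin 2) K) :
    bcoeff i j (MvPowerSeries.X 0 ^ a * F) = 0 := by
  rw [← coeff_rows, X_pow_dvd_iff_rows.1 (dvd_mul_right _ F) i h, map_zero]

lemma exists_eq_X_pow_mul {F : MvPowerSeries (Fin 2) K} (hF : F ≠ 0) :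
    ∃ a G, F = MvPowerSeries.X 0 ^ a * G ∧ restr G ≠ 0 := by
  have h0 : rows F ≠ 0 := fun h => hF (rows_injective (by simpa using h))
  refine ⟨(rows F).order.toNat, ofRows (rows F).divXPowOrder, rows_injective ?_, ?_⟩
  · simp [PowerSeries.X_pow_order_mul_divXPowOrder]
  · simp [restr, PowerSeries.constantCoeff_divXPowOrder_eq_zero_iff, h0]

lemma isUnit_iff_bcoeff {F : MvPowerSeries (Fin 2) K} : IsUnit F ↔ bcoeff 0 0 F ≠ 0 := by
  rw [MvPowerSeries.isUnit_iff_constantCoeff, isUnit_iff_ne_zero]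
  have : bexp 0 0 = 0 := by simp [bexp]
  simp [bcoeff, this]

lemma X_pow_mul_cancel {F G : MvPowerSeries (Fin 2) K} {a : ℕ}
    (h : MvPowerSeries.X 0 ^ a * F = MvPowerSeries.X 0 ^ a * G) : F = G :=
  bcoeff_ext fun i j => by rw [← bcoeff_X_pow_mul a i j, h, bcoeff_X_pow_mul]

/-! ### Weights -/

lemma bcoeff_facePoly (F : MvPowerSeries (Fin 2) K) (p q N i j : ℕ) :
    bcoeff i j (facePoly F p q N) = if p * i + q * j = N then bcoeff i j F else 0 := by
  rw [bcoeff, facePoly, MvPowerSeries.coeff_weightedHomogeneousComponent, weight_bexp]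

lemma weightedOrder_eq_iff {F : MvPowerSeries (Fin 2) K} {p q N : ℕ} :
    MvPowerSeries.weightedOrder ![p, q] F = (N : ℕ∞) ↔
      (∃ i j, bcoeff i j F ≠ 0 ∧ p * i + q * j = N) ∧
      ∀ i j, p * i + q * j < N → bcoeff i j F = 0 := by
  rw [MvPowerSeries.weightedOrder_eq_nat]
  constructor
  · rintro ⟨⟨d, hd, hN⟩, h⟩
    rw [← bexp_eta d] at hd hN
    exact ⟨⟨_, _, hd, by rwa [weight_bexp] at hN⟩, fun i j hij => h _ (by rwa [weight_bexp])⟩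
  · rintro ⟨⟨i, j, hd, hN⟩, h⟩
    refine ⟨⟨bexp i j, hd, by rwa [weight_bexp]⟩, fun d hd => ?_⟩
    rw [← bexp_eta d] at hd ⊢
    exact h _ _ (by rwa [weight_bexp] at hd)

/-! ### Evaluation at a parametrization -/

lemma hasSubst_pair {τ : Type*} {a b : MvPowerSeries τ K}
    (ha : MvPowerSeries.constantCoeff a = 0) (hb : MvPowerSeries.constantCoeff b = 0) :
    MvPowerSeries.HasSubst (![a, b] : Fin 2 → MvPowerSeries τ K) :=
  MvPowerSeries.hasSubst_of_constantCoeff_zero fun i => by fin_cases i <;> simpa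

lemma hasSubst_param {φ ψ : PowerSeries K} (hφ : constantCoeff φ = 0) (hψ : constantCoeff ψ = 0) :
    MvPowerSeries.HasSubst (![φ, ψ] : Fin 2 → MvPowerSeries Unit K) :=
  hasSubst_pair (τ := Unit) hφ hψ

/-- Evaluation at a parametrization as an algebra homomorphism. -/
def evalHom {φ ψ : PowerSeries K} (hφ : constantCoeff φ = 0) (hψ : constantCoeff ψ = 0) :
    MvPowerSeries (Fin 2) K →ₐ[K] PowerSeries K :=
  MvPowerSeries.substAlgHom (hasSubst_param hφ hψ)

section Eval

variable {φ ψ : PowerSeries K} (hφ : constantCoeff φ = 0) (hψ : constantCoeff ψ = 0)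

lemma evalHom_apply (g : MvPowerSeries (Fin 2) K) : evalHom hφ hψ g = evalAt φ ψ g :=
  MvPowerSeries.substAlgHom_apply _ _

@[simp] lemma evalHom_X_zero : evalHom hφ hψ (MvPowerSeries.X 0) = φ := by
  rw [evalHom, MvPowerSeries.substAlgHom_X]
  rfl

@[simp] lemma evalHom_X_one : evalHom hφ hψ (MvPowerSeries.X 1) = ψ := by
  rw [evalHom, MvPowerSeries.substAlgHom_X]
  rfl

@[simp] lemma evalHom_C (a : K) : evalHom hφ hψ (MvPowerSeries.C a) = C a := by
  rw [MvPowerSeries.c_eq_algebraMap, AlgHom.commutes]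
  rfl

include hφ hψ in
lemma evalAt_mul (F G : MvPowerSeries (Fin 2) K) :
    evalAt φ ψ (F * G) = evalAt φ ψ F * evalAt φ ψ G := by
  simp only [← evalHom_apply hφ hψ, map_mul]

include hφ hψ in
lemma constantCoeff_evalAt (G : MvPowerSeries (Fin 2) K) :
    constantCoeff (evalAt φ ψ G) = bcoeff 0 0 G := by
  have h : MvPowerSeries.constantCoeff (evalAt φ ψ (G - MvPowerSeries.C (bcoeff 0 0 G))) = 0 := by
    refine MvPowerSeries.constantCoeff_subst_eq_zero (hasSubst_param hφ hψ) ?_ ?_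
    · intro i
      fin_cases i
      · exact hφ
      · exact hψ
    · have : bexp 0 0 = 0 := by simp [bexp]
      simp [bcoeff, this]
  rw [← evalHom_apply hφ hψ, map_sub, evalHom_C] at h
  have h' : constantCoeff (evalHom hφ hψ G - C (bcoeff 0 0 G)) = 0 := h
  rw [map_sub, sub_eq_zero] at h'
  rw [← evalHom_apply hφ hψ, h']
  simp

include hφ hψ in
lemma subst_evalAt {s : PowerSeries K} (hs : constantCoeff s = 0)
    (G : MvPowerSeries (Fin 2) K) :
    evalAt (PowerSeries.subst s φ) (PowerSeries.subst s ψ) G =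
      PowerSeries.subst s (evalAt φ ψ G) := by
  have hs' : PowerSeries.HasSubst s := PowerSeries.HasSubst.of_constantCoeff_zero' hs
  change _ = MvPowerSeries.subst (fun _ => s) (MvPowerSeries.subst ![φ, ψ] G)
  rw [evalAt, MvPowerSeries.subst_comp_subst_apply (hasSubst_param hφ hψ)
    (PowerSeries.HasSubst.const hs')]
  congr 1
  ext i
  fin_cases i <;> rfl

include hφ hψ in
lemma evalAt_toMvPowerSeries_zero (g : PowerSeries K) :
    evalAt φ ψ (PowerSeries.toMvPowerSeries (0 : Fin 2) g) = PowerSeries.subst φ g := by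
  rw [evalAt]
  exact PowerSeries.subst_toMvPowerSeries (hasSubst_param hφ hψ)

include hφ hψ in
lemma evalAt_toMvPowerSeries_one (g : PowerSeries K) :
    evalAt φ ψ (PowerSeries.toMvPowerSeries (1 : Fin 2) g) = PowerSeries.subst ψ g := by
  rw [evalAt]
  exact PowerSeries.subst_toMvPowerSeries (hasSubst_param hφ hψ)

end Eval

/-! ### The Hamburger-Noether transform as a homomorphism -/

section HN

variable {p q : ℕ} (p' q' : ℕ) (m : K)

lemma hasSubst_hn (hp : 0 < p) (hq : 0 < q) : MvPowerSeries.HasSubst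
    (![(MvPowerSeries.X 1 + MvPowerSeries.C m) ^ q' * MvPowerSeries.X 0 ^ p,
       (MvPowerSeries.X 1 + MvPowerSeries.C m) ^ p' * MvPowerSeries.X 0 ^ q] :
      Fin 2 → MvPowerSeries (Fin 2) K) :=
  hasSubst_pair (by simp [hp.ne']) (by simp [hq.ne'])

/-- The Hamburger-Noether transform as an algebra homomorphism. -/
def hnHom (hp : 0 < p) (hq : 0 < q) : MvPowerSeries (Fin 2) K →ₐ[K] MvPowerSeries (Fin 2) K :=
  MvPowerSeries.substAlgHom (hasSubst_hn p' q' m hp hq)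

variable (hp : 0 < p) (hq : 0 < q)

lemma hnHom_apply (F : MvPowerSeries (Fin 2) K) :
    hnHom p' q' m hp hq F = hnTransform p q p' q' m F :=
  MvPowerSeries.substAlgHom_apply _ _

@[simp] lemma hnHom_X_zero : hnHom p' q' m hp hq (MvPowerSeries.X 0) =
    (MvPowerSeries.X 1 + MvPowerSeries.C m) ^ q' * MvPowerSeries.X 0 ^ p := by
  rw [hnHom, MvPowerSeries.substAlgHom_X]
  rfl

@[simp] lemma hnHom_X_one : hnHom p' q' m hp hq (MvPowerSeries.X 1) =
    (MvPowerSeries.X 1 + MvPowerSeries.C m) ^ p' * MvPowerSeries.X 0 ^ q := by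
  rw [hnHom, MvPowerSeries.substAlgHom_X]
  rfl

@[simp] lemma hnHom_C (a : K) : hnHom p' q' m hp hq (MvPowerSeries.C a) = MvPowerSeries.C a := by
  rw [MvPowerSeries.c_eq_algebraMap, AlgHom.commutes]

include hp hq in
lemma evalAt_hnTransform {φ ψ : PowerSeries K} (hφ : constantCoeff φ = 0)
    (hψ : constantCoeff ψ = 0) (F : MvPowerSeries (Fin 2) K) :
    evalAt φ ψ (hnTransform p q p' q' m F) =
      evalAt ((ψ + C m) ^ q' * φ ^ p) ((ψ + C m) ^ p' * φ ^ q) F := by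
  rw [hnTransform, evalAt, MvPowerSeries.subst_comp_subst_apply (hasSubst_hn p' q' m hp hq)
    (hasSubst_param hφ hψ), evalAt]
  congr 1
  ext1 i
  have h0 := evalHom_apply hφ hψ
  unfold evalAt at h0
  fin_cases i
  · simp [← h0]
  · simp [← h0]

/-- The polynomial `∑ c_{i j} Z ^ (q' i + p' j)`, the sum over the terms `c_{i j} x ^ i y ^ j` of `F`
with `p i + q j = N`. -/
def slice (p q p' q' N : ℕ) (F : MvPowerSeries (Fin 2) K) : Polynomial K :=
  ∑ a ∈ (Finset.range (N + 1) ×ˢ Finset.range (N + 1)).filter (fun a => p * a.1 + q * a.2 = N),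
    Polynomial.monomial (q' * a.1 + p' * a.2) (bcoeff a.1 a.2 F)

include hp hq in
-- The monomial `x ^ i y ^ j` goes to `X ^ (p i + q j) (Y + m) ^ (q' i + p' j)`, so only the line of
-- weight `N` contributes to the row of `X ^ N`.
lemma coeff_rows_hnTransform (F : MvPowerSeries (Fin 2) K) (N : ℕ) :
    coeff N (rows (hnTransform p q p' q' m F)) =
      (((slice p q p' q' N F).comp (Polynomial.X + Polynomial.C m) : Polynomial K) :
        PowerSeries K) := by
  ext b
  rw [coeff_rows, bcoeff, hnTransform, MvPowerSeries.coeff_subst (hasSubst_hn p' q' m hp hq),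
    ← finsum_comp_equiv bexpEquiv]
  have hterm (a : ℕ × ℕ) : MvPowerSeries.coeff (bexpEquiv a) F •
      MvPowerSeries.coeff (bexp N b) ((bexpEquiv a).prod fun s e =>
        ((![(MvPowerSeries.X 1 + MvPowerSeries.C m) ^ q' * MvPowerSeries.X 0 ^ p,
       (MvPowerSeries.X 1 + MvPowerSeries.C m) ^ p' * MvPowerSeries.X 0 ^ q] :
        Fin 2 → MvPowerSeries (Fin 2) K) s) ^ e) = bcoeff a.1 a.2 F *
      if p * a.1 + q * a.2 = N then
        ((Polynomial.X + Polynomial.C m : Polynomial K) ^ (q' * a.1 + p' * a.2)).coeff b else 0 := by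
    change bcoeff a.1 a.2 F • bcoeff N b _ = _
    rw [smul_eq_mul, Finsupp.prod_fintype _ _ (by simp), Fin.prod_univ_two]
    have : rows (((MvPowerSeries.X 1 + MvPowerSeries.C m : MvPowerSeries (Fin 2) K) ^ q' *
        MvPowerSeries.X 0 ^ p) ^ a.1 * ((MvPowerSeries.X 1 + MvPowerSeries.C m) ^ p' *
        MvPowerSeries.X 0 ^ q) ^ a.2) =
        C ((X + C m) ^ (q' * a.1 + p' * a.2)) * X ^ (p * a.1 + q * a.2) := by
      simp only [map_mul, map_pow, map_add, rows_X_zero, rows_X_one, rows_C]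
      ring
    have h2 : (X + C m : PowerSeries K) = ((Polynomial.X + Polynomial.C m : Polynomial K) :
        PowerSeries K) := by simp
    change _ * bcoeff N b (((MvPowerSeries.X 1 + MvPowerSeries.C m) ^ q' *
        MvPowerSeries.X 0 ^ p) ^ (bexp a.1 a.2 0) * ((MvPowerSeries.X 1 + MvPowerSeries.C m) ^ p' *
        MvPowerSeries.X 0 ^ q) ^ (bexp a.1 a.2 1)) = _
    rw [bexp_zero, bexp_one, ← coeff_rows _ N b, this, PowerSeries.coeff_C_mul, PowerSeries.coeff_X_pow, h2,
      ← Polynomial.coe_pow]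
    congr 1
    by_cases h : p * a.1 + q * a.2 = N
    · rw [if_pos h, if_pos h.symm, mul_one, Polynomial.coeff_coe]
    · simp [h, Ne.symm h]
  -- Since `p` and `q` are positive, both exponents of a monomial of weight `N` are at most `N`.
  rw [finsum_eq_sum_of_support_subset (s :=
      (Finset.range (N + 1) ×ˢ Finset.range (N + 1)).filter (fun a => p * a.1 + q * a.2 = N))]
  · rw [slice, Polynomial.sum_comp, Polynomial.coeff_coe, Polynomial.finsetSum_coeff]
    refine Finset.sum_congr rfl fun a ha => ?_
    rw [hterm, if_pos (Finset.mem_filter.1 ha).2, Polynomial.monomial_comp, Polynomial.coeff_C_mul]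
  · intro a ha
    rw [Function.mem_support, hterm] at ha
    have hN : p * a.1 + q * a.2 = N := by
      by_contra h
      simp [h] at ha
    have h1 := Nat.le_mul_of_pos_left a.1 hp
    have h2 := Nat.le_mul_of_pos_left a.2 hq
    simp only [Finset.coe_filter, Finset.mem_product, Finset.mem_range, Set.mem_ofPred_eq]
    omega

end HN

/-! ### Slices and multiplicities -/

/-- For `m ≠ 0` the powers of `X` and of `X - m` are coprime, so their product divides `P`. This
count holds in every characteristic and underlies all estimates on faces. -/
lemma natTrailingDegree_add_le_of_pow_dvd {P : Polynomial K} (hP : P ≠ 0) {m : K} (hm : m ≠ 0)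
    {k : ℕ} (h : (Polynomial.X - Polynomial.C m) ^ k ∣ P) :
    P.natTrailingDegree + k ≤ P.natDegree := by
  have hX : (Polynomial.X : Polynomial K) ^ P.natTrailingDegree ∣ P :=
    Polynomial.X_pow_dvd_iff.2 fun d hd => Polynomial.coeff_eq_zero_of_lt_natTrailingDegree hd
  have hco : IsCoprime (Polynomial.X - Polynomial.C 0) (Polynomial.X - Polynomial.C m) :=
    Polynomial.isCoprime_X_sub_C_of_isUnit_sub (by simpa using hm)
  rw [Polynomial.C_0, sub_zero] at hco
  have := Polynomial.natDegree_le_of_dvd ((hco.pow (m := P.natTrailingDegree)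
    (n := k)).mul_dvd hX h) hP
  rwa [Polynomial.natDegree_mul (pow_ne_zero _ Polynomial.X_ne_zero)
    (pow_ne_zero _ (Polynomial.X_sub_C_ne_zero m)), Polynomial.natDegree_X_pow,
    Polynomial.natDegree_pow, Polynomial.natDegree_X_sub_C, mul_one] at this

lemma X_pow_dvd_coe_comp_iff {P : Polynomial K} {m : K} {k : ℕ} :
    (X : PowerSeries K) ^ k ∣ ((P.comp (Polynomial.X + Polynomial.C m) : Polynomial K) :
      PowerSeries K) ↔ (Polynomial.X - Polynomial.C m) ^ k ∣ P := by
  rw [PowerSeries.X_pow_dvd_iff]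
  simp only [Polynomial.coeff_coe]
  rw [← Polynomial.X_pow_dvd_iff]
  constructor
  · rintro ⟨Q, hQ⟩
    refine ⟨Q.comp (Polynomial.X - Polynomial.C m), ?_⟩
    have := congrArg (fun R => R.comp (Polynomial.X - Polynomial.C m)) hQ
    simpa [Polynomial.comp_assoc] using this
  · rintro ⟨Q, rfl⟩
    exact ⟨Q.comp (Polynomial.X + Polynomial.C m), by simp⟩

/-- The matrix with rows `(p, q')` and `(q, p')` has determinant `1` or `-1`. -/
def IsUnimodular (p q p' q' : ℕ) : Prop := p * p' = q * q' + 1 ∨ q * q' = p * p' + 1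

lemma IsHNData.isUnimodular {p q p' q' : ℕ} {μ m : K} (h : IsHNData p q p' q' μ m) :
    IsUnimodular p q p' q' := h.imp And.left And.left

lemma IsHNData.ne_zero {p q p' q' : ℕ} {μ m : K} (h : IsHNData p q p' q' μ m) (hμ : μ ≠ 0) :
    m ≠ 0 := by
  rcases h with ⟨-, rfl⟩ | ⟨-, rfl⟩
  · exact inv_ne_zero hμ
  · exact hμ

/-- `p'` is an inverse of `p` modulo `q`; the case `q = 1`, where no remainder equals `1`, is done
by hand. Determinant `1` can always be attained. -/
lemma exists_isHNData {p q : ℕ} (hp : 0 < p) (hq : 0 < q) (hpq : Nat.Coprime p q) (μ : K) :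
    ∃ p' q' : ℕ, IsHNData p q p' q' μ μ⁻¹ := by
  obtain rfl | hq1 := (Nat.succ_le_of_lt hq).eq_or_lt
  · exact ⟨1, p - 1, Or.inl ⟨by simp; omega, rfl⟩⟩
  · obtain ⟨p', hp'⟩ := Nat.exists_mul_mod_eq_one_of_coprime hpq hq1
    refine ⟨p', p * p' / q, Or.inl ⟨?_, rfl⟩⟩
    have := Nat.div_add_mod (p * p') q
    omega

section

variable {p q p' q' N : ℕ} (hp : 0 < p) (hq : 0 < q) (hdet : IsUnimodular p q p' q')
  {F : MvPowerSeries (Fin 2) K}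

lemma exists_of_coeff_slice_ne_zero {e : ℕ} (h : (slice p q p' q' N F).coeff e ≠ 0) :
    ∃ i j, bcoeff i j F ≠ 0 ∧ p * i + q * j = N ∧ q' * i + p' * j = e := by
  rw [slice, Polynomial.finsetSum_coeff] at h
  obtain ⟨a, ha, h'⟩ := Finset.exists_ne_zero_of_sum_ne_zero h
  rw [Polynomial.coeff_monomial] at h'
  split_ifs at h' with he
  · exact ⟨a.1, a.2, h', (Finset.mem_filter.1 ha).2, he⟩
  · exact absurd rfl h'

include hp hdet in
-- The weight and the exponent in `slice` form a unimodular pair of linear forms, so no two terms of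
-- a face collide.
lemma eq_of_slice_exponent_eq {i j i₁ j₁ : ℕ} (h : p * i + q * j = N) (h₁ : p * i₁ + q * j₁ = N)
    (he : q' * i + p' * j = q' * i₁ + p' * j₁) : i = i₁ ∧ j = j₁ := by
  have key : j = j₁ := by
    zify at *
    have hd : (p : ℤ) * (q' * i + p' * j) = p * (q' * i₁ + p' * j₁) := by rw [he]
    unfold IsUnimodular at hdet
    zify at hdet
    rcases hdet with hd' | hd'
    · linear_combination hd - q' * (h - h₁) - (j - j₁) * hd'
    · linear_combination -hd + q' * (h - h₁) - (j - j₁) * hd'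
  subst key
  exact ⟨Nat.eq_of_mul_eq_mul_left hp (by omega), rfl⟩

include hp hq hdet in
lemma coeff_slice {i j : ℕ} (h : p * i + q * j = N) :
    (slice p q p' q' N F).coeff (q' * i + p' * j) = bcoeff i j F := by
  rw [slice, Polynomial.finsetSum_coeff, Finset.sum_eq_single (i, j)]
  · simp
  · intro a ha hne
    rw [Polynomial.coeff_monomial, if_neg]
    intro he
    have := eq_of_slice_exponent_eq hp hdet (Finset.mem_filter.1 ha).2 h he
    exact hne (Prod.ext this.1 this.2)
  · intro hn
    have h1 := Nat.le_mul_of_pos_left i hp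
    have h2 := Nat.le_mul_of_pos_left j hq
    simp only [Finset.mem_filter, Finset.mem_product, Finset.mem_range] at hn
    omega

include hp hq hdet in
/-- If the row of a Hamburger-Noether transform on the line `p i + q j = N` vanishes to order `k`,
then the part of the support on this line is long. -/
lemma exists_support_of_X_pow_dvd {m : K} (hm : m ≠ 0) {k : ℕ}
    (hk : X ^ k ∣ coeff N (rows (hnTransform p q p' q' m F)))
    {i j : ℕ} (hij : p * i + q * j = N) (hne : bcoeff i j F ≠ 0) :
    ∃ i₀ j₀ i₁ j₁, bcoeff i₀ j₀ F ≠ 0 ∧ p * i₀ + q * j₀ = N ∧ bcoeff i₁ j₁ F ≠ 0 ∧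
      p * i₁ + q * j₁ = N ∧ j₁ + p * k ≤ j₀ := by
  rw [coeff_rows_hnTransform p' q' m hp hq, X_pow_dvd_coe_comp_iff] at hk
  have h0 : slice p q p' q' N F ≠ 0 := by
    intro h
    rw [← coeff_slice hp hq hdet hij, h] at hne
    simp at hne
  have hle := natTrailingDegree_add_le_of_pow_dvd h0 hm hk
  obtain ⟨i₀, j₀, hn₀, hw₀, he₀⟩ := exists_of_coeff_slice_ne_zero
    (e := (slice p q p' q' N F).natDegree) (F := F) (Polynomial.leadingCoeff_ne_zero.2 h0)
  obtain ⟨i₁, j₁, hn₁, hw₁, he₁⟩ := exists_of_coeff_slice_ne_zero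
    (e := (slice p q p' q' N F).natTrailingDegree) (F := F)
    (Polynomial.trailingCoeff_nonzero_iff_nonzero.2 h0)
  rw [← he₀, ← he₁] at hle
  -- On the line, `p (q' i + p' j) = q' N ± j`, the sign being that of the determinant. So a length
  -- in the exponent becomes `p` times that length in `j`, and the sign decides which end of the
  -- slice is the upper one.
  have hle' := Nat.mul_le_mul_left p hle
  unfold IsUnimodular at hdet
  rcases hdet with hd | hd
  · refine ⟨i₀, j₀, i₁, j₁, hn₀, hw₀, hn₁, hw₁, ?_⟩
    zify at *
    linear_combination hle' + q' * (hw₀ - hw₁) + (j₀ - j₁) * hd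
  · refine ⟨i₁, j₁, i₀, j₀, hn₁, hw₁, hn₀, hw₀, ?_⟩
    zify at *
    linear_combination hle' + q' * (hw₀ - hw₁) - (j₀ - j₁) * hd

include hp hq in
/-- The strict transform. -/
lemma exists_hnTransform_eq (m : K) (hF : ∀ i j, p * i + q * j < N → bcoeff i j F = 0) :
    ∃ G, hnTransform p q p' q' m F = MvPowerSeries.X 0 ^ N * G ∧
      restr G = coeff N (rows (hnTransform p q p' q' m F)) := by
  have : MvPowerSeries.X 0 ^ N ∣ hnTransform p q p' q' m F := by
    rw [X_pow_dvd_iff_rows]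
    intro a ha
    rw [coeff_rows_hnTransform p' q' m hp hq]
    have : slice p q p' q' a F = 0 := by
      rw [slice]
      refine Finset.sum_eq_zero fun b hb => ?_
      rw [hF _ _ ((Finset.mem_filter.1 hb).2.trans_lt ha), map_zero]
    simp [this]
  obtain ⟨G, hG⟩ := this
  refine ⟨G, hG, ?_⟩
  ext j
  rw [coeff_restr, coeff_rows, hG]
  simpa using (bcoeff_X_pow_mul N 0 j G).symm

end

/-! ### The transform of `x ^ q - μ y ^ p`. -/

/-- The factor of a row by which the transform of `x ^ q - μ y ^ p` at another point is a unit. -/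
lemma hnTransform_rootFactor {p q p' q' : ℕ} (hp : 0 < p) (hq : 0 < q) (μ m : K) :
    hnTransform p q p' q' m (rootFactor p q μ) = MvPowerSeries.X 0 ^ (p * q) *
      ((MvPowerSeries.X 1 + MvPowerSeries.C m) ^ (q * q') -
        MvPowerSeries.C μ * (MvPowerSeries.X 1 + MvPowerSeries.C m) ^ (p * p')) := by
  rw [← hnHom_apply p' q' m hp hq, rootFactor]
  simp only [map_sub, map_mul, map_pow, hnHom_X_zero, hnHom_X_one, hnHom_C]
  ring

lemma isUnit_X_add_C {m : K} (hm : m ≠ 0) :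
    IsUnit (MvPowerSeries.X 1 + MvPowerSeries.C m : MvPowerSeries (Fin 2) K) := by
  rw [MvPowerSeries.isUnit_iff_constantCoeff, isUnit_iff_ne_zero]
  simpa using hm

/-- The exponents `q q'` and `p p'` differ by one, so up to a power of `Y + m` there remains `1 - μ
(Y + m)` or `Y + m - μ`. With `m = μ⁻¹`, respectively `m = μ`, this is a constant times `Y`. -/
lemma IsHNData.hnTransform_rootFactor {p q p' q' : ℕ} (hp : 0 < p) (hq : 0 < q) {μ m : K}
    (hμ : μ ≠ 0) (h : IsHNData p q p' q' μ m) :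
    ∃ u, IsUnit u ∧ hnTransform p q p' q' m (rootFactor p q μ) =
      MvPowerSeries.X 0 ^ (p * q) * (MvPowerSeries.X 1 * u) := by
  have hu := isUnit_X_add_C (h.ne_zero hμ)
  rw [NewtonTree.hnTransform_rootFactor hp hq]
  rcases h with ⟨h, rfl⟩ | ⟨h, rfl⟩
  · refine ⟨-MvPowerSeries.C μ * (MvPowerSeries.X 1 + MvPowerSeries.C μ⁻¹) ^ (q * q'),
      ((hμ.isUnit.map MvPowerSeries.C).neg).mul (hu.pow _), ?_⟩
    have : (MvPowerSeries.C μ * MvPowerSeries.C μ⁻¹ : MvPowerSeries (Fin 2) K) = 1 := by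
      rw [← map_mul, mul_inv_cancel₀ hμ, map_one]
    rw [h, pow_succ]
    linear_combination -(MvPowerSeries.X 0 ^ (p * q) *
      (MvPowerSeries.X 1 + MvPowerSeries.C μ⁻¹) ^ (q * q')) * this
  · refine ⟨(MvPowerSeries.X 1 + MvPowerSeries.C m) ^ (p * p'), hu.pow _, ?_⟩
    rw [h, pow_succ]
    ring

/-! ### Primitive pairs -/

/-- A pair of series without constant term which is primitive. -/
structure IsPrimPair (φ ψ : PowerSeries K) : Prop where
  fst_zero : constantCoeff φ = 0
  snd_zero : constantCoeff ψ = 0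
  primitive : ∀ s φ₁ ψ₁ : PowerSeries K, constantCoeff s = 0 →
    φ = PowerSeries.subst s φ₁ → ψ = PowerSeries.subst s ψ₁ → order s = 1

lemma order_X_pow_mul {φ u : PowerSeries K} {n : ℕ} (hu : constantCoeff u ≠ 0)
    (h : φ = X ^ n * u) : order φ = n := by
  rw [h, PowerSeries.order_mul, PowerSeries.order_X_pow,
    PowerSeries.order_zero_of_unit (PowerSeries.isUnit_iff_constantCoeff.2 hu.isUnit), add_zero]

lemma exists_eq_X_pow_mul_unit {φ : PowerSeries K} (h : φ ≠ 0) :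
    ∃ u, constantCoeff u ≠ 0 ∧ φ = X ^ φ.order.toNat * u :=
  ⟨φ.divXPowOrder, by simpa [PowerSeries.constantCoeff_divXPowOrder_eq_zero_iff] using h,
    PowerSeries.X_pow_order_mul_divXPowOrder.symm⟩

lemma one_le_order {φ : PowerSeries K} (h : constantCoeff φ = 0) : 1 ≤ order φ :=
  PowerSeries.one_le_order_iff_constCoeff_eq_zero.2 h

lemma exists_leading_terms {φ ψ : PowerSeries K} (h0 : constantCoeff φ = 0)
    (h0' : constantCoeff ψ = 0) (hφ : φ ≠ 0) (hψ : ψ ≠ 0) :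
    ∃ p q ν u v, 0 < p ∧ 0 < q ∧ 0 < ν ∧ Nat.Coprime p q ∧ constantCoeff u ≠ 0 ∧
      constantCoeff v ≠ 0 ∧ φ = X ^ (p * ν) * u ∧ ψ = X ^ (q * ν) * v := by
  obtain ⟨u, hu, hφu⟩ := exists_eq_X_pow_mul_unit hφ
  obtain ⟨v, hv, hψv⟩ := exists_eq_X_pow_mul_unit hψ
  have ha : 0 < φ.order.toNat := by
    have := one_le_order h0
    rw [← PowerSeries.coe_toNat_order hφ] at this
    exact_mod_cast this
  have hb : 0 < ψ.order.toNat := by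
    have := one_le_order h0'
    rw [← PowerSeries.coe_toNat_order hψ] at this
    exact_mod_cast this
  obtain ⟨p, q, hpq, hp, hq⟩ := Nat.exists_coprime φ.order.toNat ψ.order.toNat
  refine ⟨p, q, Nat.gcd φ.order.toNat ψ.order.toNat, u, v, ?_, ?_,
    Nat.gcd_pos_of_pos_left _ ha, hpq, hu, hv, ?_, ?_⟩
  · exact Nat.pos_of_mul_pos_right (hp ▸ ha)
  · exact Nat.pos_of_mul_pos_right (hq ▸ hb)
  · rwa [← hp]
  · rwa [← hq]

/-- The inverse of a monomial map of determinant `1`, on units. Exchanging the roles of `a` and `b`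
covers determinant `-1`. -/
lemma unimodular_pow_aux {A : Type*} [CommRing A] {a a' b b' : A} (ha : a * a' = 1)
    (hb : b * b' = 1) {p q p' q' : ℕ} (h : p * p' = q * q' + 1) :
    (b ^ p * a' ^ q) ^ q' * (a ^ p' * b' ^ q') ^ p = a ∧
    (b ^ p * a' ^ q) ^ p' * (a ^ p' * b' ^ q') ^ q = b := by
  constructor
  · calc _ = (b * b') ^ (p * q') * (a ^ (p * p') * a' ^ (q * q')) := by ring
      _ = (b * b') ^ (p * q') * ((a * a') ^ (q * q') * a) := by rw [h]; ring
      _ = a := by rw [ha, hb]; simp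
  · calc _ = (a * a') ^ (q * p') * (b ^ (p * p') * b' ^ (q * q')) := by ring
      _ = (a * a') ^ (q * p') * ((b * b') ^ (q * q') * b) := by rw [h]; ring
      _ = b := by rw [ha, hb]; simp

/-- Every pair with leading terms on the `(p, q)`-line comes from a pair in the new coordinates. -/
lemma exists_hn_preimage {p q ν p' q' : ℕ} {u v : PowerSeries K} (hu : constantCoeff u ≠ 0)
    (hv : constantCoeff v ≠ 0) {m : K}
    (h : IsHNData p q p' q' (constantCoeff u ^ q / constantCoeff v ^ p) m) :
    ∃ χ υ : PowerSeries K, order χ = ν ∧ constantCoeff υ = 0 ∧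
      X ^ (p * ν) * u = (υ + C m) ^ q' * χ ^ p ∧ X ^ (q * ν) * v = (υ + C m) ^ p' * χ ^ q := by
  have hu1 : u * u⁻¹ = 1 := PowerSeries.mul_inv_cancel _ hu
  have hv1 : v * v⁻¹ = 1 := PowerSeries.mul_inv_cancel _ hv
  have hu' : constantCoeff u⁻¹ ≠ 0 := by simpa using hu
  have hv' : constantCoeff v⁻¹ ≠ 0 := by simpa using hv
  rcases h with ⟨h, hm⟩ | ⟨h, hm⟩
  · obtain ⟨h1, h2⟩ := unimodular_pow_aux hu1 hv1 h
    -- The inverse matrix gives `υ + m = v ^ p u ^ (-q)`, whose constant term is the inverse of the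
    -- root; hence `m = μ⁻¹` for this sign.
    refine ⟨X ^ ν * (u ^ p' * v⁻¹ ^ q'), v ^ p * u⁻¹ ^ q - C m, order_X_pow_mul ?_ rfl, ?_, ?_, ?_⟩
    · rw [map_mul, map_pow, map_pow]
      exact mul_ne_zero (pow_ne_zero _ hu) (pow_ne_zero _ hv')
    · simp [hm]
      field_simp
      simp
    · rw [sub_add_cancel, mul_pow]
      linear_combination -(X ^ (p * ν)) * h1
    · rw [sub_add_cancel, mul_pow]
      linear_combination -(X ^ (q * ν)) * h2
  · obtain ⟨h1, h2⟩ := unimodular_pow_aux hv1 hu1 h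
    refine ⟨X ^ ν * (v ^ q' * u⁻¹ ^ p'), u ^ q * v⁻¹ ^ p - C m, order_X_pow_mul ?_ rfl, ?_, ?_, ?_⟩
    · rw [map_mul, map_pow, map_pow]
      exact mul_ne_zero (pow_ne_zero _ hv) (pow_ne_zero _ hu')
    · simp [hm]
      field_simp
      simp
    · rw [sub_add_cancel, mul_pow]
      linear_combination -(X ^ (p * ν)) * h2
    · rw [sub_add_cancel, mul_pow]
      linear_combination -(X ^ (q * ν)) * h1

/-- Substitution commutes with the transform, so a common inner series of the new pair is one of the
old pair. -/
lemma IsPrimPair.of_hn {χ υ : PowerSeries K} (hχ : constantCoeff χ = 0)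
    (hυ : constantCoeff υ = 0) {p q p' q' : ℕ} {m : K}
    (h : IsPrimPair ((υ + C m) ^ q' * χ ^ p) ((υ + C m) ^ p' * χ ^ q)) : IsPrimPair χ υ := by
  refine ⟨hχ, hυ, fun s φ₁ ψ₁ hs h1 h2 => h.primitive s ((ψ₁ + C m) ^ q' * φ₁ ^ p)
    ((ψ₁ + C m) ^ p' * φ₁ ^ q) hs ?_ ?_⟩ <;>
  · have hs' : PowerSeries.HasSubst s := PowerSeries.HasSubst.of_constantCoeff_zero' hs
    have hC : PowerSeries.subst s (C m) = C m := PowerSeries.subst_C m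
    rw [PowerSeries.subst_mul hs', PowerSeries.subst_pow hs', PowerSeries.subst_pow hs',
      PowerSeries.subst_add hs', ← h1, ← h2, hC]

/-- Here `(φ, ψ)` is `(t, s(t))` composed with `φ`, so primitivity applies to the inner series `φ`.
-/
lemma IsPrimPair.order_eq_one_of_eq_subst {φ ψ s : PowerSeries K} (h : IsPrimPair φ ψ)
    (hs : ψ = PowerSeries.subst φ s) : order φ = 1 :=
  h.primitive φ X s h.fst_zero
    (PowerSeries.subst_X (PowerSeries.HasSubst.of_constantCoeff_zero' h.fst_zero)).symm hs

lemma IsPrimPair.order_eq_one_of_snd_eq_zero {φ : PowerSeries K} (h : IsPrimPair φ 0) :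
    order φ = 1 :=
  h.order_eq_one_of_eq_subst (s := 0) <| by
    rw [← PowerSeries.coe_substAlgHom (PowerSeries.HasSubst.of_constantCoeff_zero' h.fst_zero),
      map_zero]

lemma IsPrimPair.order_eq_one_of_fst_eq_zero {ψ : PowerSeries K} (h : IsPrimPair 0 ψ) :
    order ψ = 1 := by
  have hs := PowerSeries.HasSubst.of_constantCoeff_zero' h.snd_zero
  refine h.primitive ψ 0 X h.snd_zero ?_ (PowerSeries.subst_X hs).symm
  rw [← PowerSeries.coe_substAlgHom hs, map_zero]

/-! ### Infinite chains of transforms with `p = 1` -/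

/-- The coefficients of the series `∑ m_l x ^ (q_i + ⋯ + q_l)`, the sum over `l ≥ i`. -/
def chainCoeff (q : ℕ → ℕ) (m : ℕ → K) : ℕ → ℕ → K
  | N, i => if N < q i then 0 else if N = q i then m i else
      -- The test only serves termination; the exponents are positive in all uses.
      if 0 < q i then chainCoeff q m (N - q i) (i + 1) else 0
  termination_by N => N

/-- An endless run of transforms with `p = 1` has a limit: the series `s 0` is the expansion of the
second coordinate in terms of the first. -/
lemma exists_chain (q : ℕ → ℕ) (hq : ∀ i, 0 < q i) (m : ℕ → K) :
    ∃ s : ℕ → PowerSeries K, ∀ i, s i = X ^ q i * (C (m i) + s (i + 1)) := by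
  refine ⟨fun i => mk fun N => chainCoeff q m N i, fun i => ?_⟩
  ext N
  rw [PowerSeries.coeff_mk, PowerSeries.coeff_X_pow_mul', chainCoeff]
  rcases lt_trichotomy N (q i) with h | h | h
  · simp [h]
  · have h0 : chainCoeff q m 0 (i + 1) = 0 := by
      rw [chainCoeff, if_pos (hq _)]
    simp [h, h0]
  · have h1 : N - q i ≠ 0 := by omega
    rw [if_neg h.not_gt, if_neg h.ne', if_pos (hq i), if_pos h.le, map_add, PowerSeries.coeff_C,
      if_neg h1, zero_add, PowerSeries.coeff_mk]

/-! ### Resolution of primitive pairs -/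

/-- A pair that becomes smooth after finitely many Hamburger-Noether transforms. -/
inductive Resolves : PowerSeries K → PowerSeries K → Prop
  | base (φ ψ : PowerSeries K) (hφ : order φ = 1) (hψ : constantCoeff ψ = 0) : Resolves φ ψ
  | step (p q p' q' : ℕ) (m : K) (χ υ : PowerSeries K) (hp : 0 < p) (hq : 0 < q)
      (hdet : IsUnimodular p q p' q') (hm : m ≠ 0) (h : Resolves χ υ) :
      Resolves ((υ + C m) ^ q' * χ ^ p) ((υ + C m) ^ p' * χ ^ q)

lemma add_C_ne_zero {υ : PowerSeries K} (hυ : constantCoeff υ = 0) {m : K} (hm : m ≠ 0) :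
    constantCoeff (υ + C m) ≠ 0 := by simpa [hυ]

lemma order_hn {χ υ : PowerSeries K} (hυ : constantCoeff υ = 0) {m : K} (hm : m ≠ 0) (a b : ℕ) :
    order ((υ + C m) ^ a * χ ^ b) = b * order χ := by
  have hu : IsUnit (υ + C m) := PowerSeries.isUnit_iff_constantCoeff.2 (add_C_ne_zero hυ hm).isUnit
  rw [PowerSeries.order_mul, PowerSeries.order_zero_of_unit (hu.pow a), zero_add,
    PowerSeries.order_pow, nsmul_eq_mul]

lemma Resolves.zero_ne {φ ψ : PowerSeries K} (h : Resolves φ ψ) :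
    constantCoeff φ = 0 ∧ constantCoeff ψ = 0 ∧ φ ≠ 0 ∧ (order φ = 1 ∨ ψ ≠ 0) := by
  induction h with
  | base φ ψ hφ hψ =>
    refine ⟨PowerSeries.one_le_order_iff_constCoeff_eq_zero.1 hφ.ge, hψ, ?_, Or.inl hφ⟩
    rintro rfl
    simp at hφ
  | step p q p' q' m χ υ hp hq hdet hm h ih =>
    obtain ⟨h1, h2, h3, -⟩ := ih
    have h4 : υ + C m ≠ 0 := fun h => add_C_ne_zero h2 hm (by rw [h, map_zero])
    refine ⟨by simp [h1, hp.ne'], by simp [h1, hq.ne'], ?_, Or.inr ?_⟩ <;>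
    exact mul_ne_zero (pow_ne_zero _ h4) (pow_ne_zero _ h3)

lemma eq_of_forall_pow_dvd_sub {φ a b : PowerSeries K} (hφ : constantCoeff φ = 0)
    (h : ∀ k, φ ^ k ∣ a - b) : a = b := by
  rw [← sub_eq_zero]
  ext n
  rw [map_zero]
  exact PowerSeries.X_pow_dvd_iff.1 ((pow_dvd_pow_of_dvd (PowerSeries.X_dvd_iff.2 hφ) _).trans
    (h (n + 1))) n n.lt_succ_self

/-- Induction on `ord φ`. From an unresolved pair every step must have `p = 1`, since `p > 1` lowers
the order. The resulting infinite chain shows that `ψ` is a series in `φ`, which forces `ord φ = 1`,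
a resolved case. -/
theorem IsPrimPair.resolves {φ ψ : PowerSeries K} (h : IsPrimPair φ ψ) (hφ : φ ≠ 0) :
    Resolves φ ψ := by
  obtain ⟨n, hn⟩ : ∃ n : ℕ, φ.order.toNat = n := ⟨_, rfl⟩
  induction n using Nat.strong_induction_on generalizing φ ψ with
  | _ n ih =>
    by_contra hnot
    have hstep : ∀ ψ' : {ψ' : PowerSeries K // IsPrimPair φ ψ' ∧ ¬ Resolves φ ψ'},
        ∃ (q : ℕ) (m : K) (ψ'' : {ψ' : PowerSeries K // IsPrimPair φ ψ' ∧ ¬ Resolves φ ψ'}),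
          0 < q ∧ ψ'.1 = φ ^ q * (C m + ψ''.1) := by
      rintro ⟨ψ', hprim, hres⟩
      have h0 : ψ' ≠ 0 := by
        rintro rfl
        exact hres (.base _ _ hprim.order_eq_one_of_snd_eq_zero hprim.snd_zero)
      obtain ⟨p, q, ν, u, v, hp, hq, hν, hpq, hu, hv, e1, e2⟩ :=
        exists_leading_terms hprim.fst_zero hprim.snd_zero hφ h0
      have hμ : (constantCoeff u ^ q / constantCoeff v ^ p) ≠ 0 :=
        div_ne_zero (pow_ne_zero _ hu) (pow_ne_zero _ hv)
      -- For `p = 1` the choice `p' = 1`, `q' = 0` leaves the first coordinate unchanged, so that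
      -- the steps can be chained.
      obtain ⟨p', q', hd, hdp⟩ : ∃ p' q' : ℕ, IsHNData p q p' q'
          (constantCoeff u ^ q / constantCoeff v ^ p)
          (constantCoeff u ^ q / constantCoeff v ^ p)⁻¹ ∧ (p = 1 → p' = 1 ∧ q' = 0) := by
        by_cases hp1 : p = 1
        · exact ⟨1, 0, Or.inl ⟨by simp [hp1], rfl⟩, fun _ => ⟨rfl, rfl⟩⟩
        · obtain ⟨p', q', hd⟩ := exists_isHNData hp hq hpq
            (constantCoeff u ^ q / constantCoeff v ^ p)
          exact ⟨p', q', hd, fun h => absurd h hp1⟩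
      obtain ⟨χ, υ, hχ, hυ, e3, e4⟩ := exists_hn_preimage (ν := ν) hu hv hd
      rw [e3] at e1
      rw [e4] at e2
      have hχ0 : constantCoeff χ = 0 := by
        rw [← PowerSeries.one_le_order_iff_constCoeff_eq_zero, hχ]
        exact_mod_cast hν
      have hχne : χ ≠ 0 := by
        rintro rfl
        simp at hχ
      have hprim' : IsPrimPair χ υ := .of_hn hχ0 hυ (e1 ▸ e2 ▸ hprim)
      by_cases hp1 : p = 1
      · obtain ⟨rfl, rfl⟩ := hdp hp1
        rw [hp1, pow_zero, one_mul, pow_one] at e1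
        subst e1
        refine ⟨q, _, ⟨υ, hprim', fun hr => hres ?_⟩, hq, e2.trans (by ring)⟩
        have := Resolves.step p q 1 0 _ φ υ hp hq hd.isUnimodular (hd.ne_zero hμ) hr
        rwa [← e2, hp1, pow_zero, one_mul, pow_one] at this
      · refine absurd (Resolves.step p q p' q' _ χ υ hp hq hd.isUnimodular (hd.ne_zero hμ)
          (ih _ ?_ hprim' hχne rfl)) (e1 ▸ e2 ▸ hres)
        rw [← hn, e1, order_hn hυ (hd.ne_zero hμ), hχ, ← Nat.cast_mul, ENat.toNat_natCast,
          ENat.toNat_natCast]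
        nlinarith [show 2 ≤ p by omega]
    choose q m next hq hnext using hstep
    let S : ℕ → {ψ' : PowerSeries K // IsPrimPair φ ψ' ∧ ¬ Resolves φ ψ'} :=
      fun i => next^[i] ⟨ψ, h, hnot⟩
    have hS (i : ℕ) : (S i).1 = φ ^ q (S i) * (C (m (S i)) + (S (i + 1)).1) := by
      have : S (i + 1) = next (S i) := Function.iterate_succ_apply' _ _ _
      rw [this]
      exact hnext (S i)
    obtain ⟨s, hs⟩ := exists_chain (fun i => q (S i)) (fun i => hq _) (fun i => m (S i))
    have hφs := PowerSeries.HasSubst.of_constantCoeff_zero' h.fst_zero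
    -- Both sequences satisfy the same recursion, so each passage to `i + 1` releases a factor `φ`.
    have key (k : ℕ) : ∀ i, φ ^ k ∣ (S i).1 - PowerSeries.subst φ (s i) := by
      induction k with
      | zero => simp
      | succ k ihk =>
        intro i
        have hC : PowerSeries.subst φ (C (m (S i))) = C (m (S i)) := PowerSeries.subst_C _
        have : (S i).1 - PowerSeries.subst φ (s i) =
            φ ^ q (S i) * ((S (i + 1)).1 - PowerSeries.subst φ (s (i + 1))) := by
          rw [hS i, hs i, PowerSeries.subst_mul hφs, PowerSeries.subst_pow hφs,
            PowerSeries.subst_X hφs, PowerSeries.subst_add hφs, hC]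
          ring
        rw [this, pow_succ']
        exact mul_dvd_mul (dvd_pow_self _ (hq _).ne') (ihk _)
    have : ψ = PowerSeries.subst φ (s 0) := eq_of_forall_pow_dvd_sub h.fst_zero fun k => key k 0
    exact hnot (.base _ _ (h.order_eq_one_of_eq_subst this) h.snd_zero)

/-! ### Transforms of series which vanish on a pair -/

lemma exists_weight {F : MvPowerSeries (Fin 2) K} (hF : F ≠ 0) (p q : ℕ) :
    ∃ N, (∃ i j, bcoeff i j F ≠ 0 ∧ p * i + q * j = N) ∧
      ∀ i j, p * i + q * j < N → bcoeff i j F = 0 := by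
  classical
  have h : ∃ N, ∃ i j, bcoeff i j F ≠ 0 ∧ p * i + q * j = N := by
    by_contra! h
    exact hF (bcoeff_ext fun i j => by
      rw [map_zero]
      by_contra hij
      exact h _ i j hij rfl)
  refine ⟨Nat.find h, Nat.find_spec h, fun i j hij => ?_⟩
  by_contra hne
  exact Nat.find_min h hij ⟨i, j, hne, rfl⟩

lemma ne_zero_of_restr_ne_zero {F : MvPowerSeries (Fin 2) K} (h : restr F ≠ 0) : F ≠ 0 := by
  rintro rfl
  exact h (map_zero _)

lemma order_restr_eq_iff {F : MvPowerSeries (Fin 2) K} {n : ℕ} :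
    order (restr F) = n ↔ bcoeff 0 n F ≠ 0 ∧ ∀ j < n, bcoeff 0 j F = 0 := by
  simp only [PowerSeries.order_eq_nat, coeff_restr]

lemma evalAt_X_pow_mul {φ ψ : PowerSeries K} (hφ : constantCoeff φ = 0)
    (hψ : constantCoeff ψ = 0) (N : ℕ) (G : MvPowerSeries (Fin 2) K) :
    evalAt φ ψ (MvPowerSeries.X 0 ^ N * G) = φ ^ N * evalAt φ ψ G := by
  simp only [← evalHom_apply hφ hψ, map_mul, map_pow, evalHom_X_zero]

section

variable {p q p' q' : ℕ} (hp : 0 < p) (hq : 0 < q) (hdet : IsUnimodular p q p' q')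
  {m : K} (hm : m ≠ 0) {χ υ : PowerSeries K} (hχ0 : constantCoeff χ = 0)
  (hυ0 : constantCoeff υ = 0) (hχ : χ ≠ 0)

include hp hq hdet hm in
lemma exists_support_of_strict {F : MvPowerSeries (Fin 2) K} {N k : ℕ}
    (hN : ∃ i j, bcoeff i j F ≠ 0 ∧ p * i + q * j = N)
    (hk : X ^ k ∣ coeff N (rows (hnTransform p q p' q' m F))) :
    ∃ i j, bcoeff i j F ≠ 0 ∧ p * i + q * j = N ∧ p * k ≤ j := by
  obtain ⟨i, j, hne, hij⟩ := hN
  obtain ⟨i₀, j₀, -, j₁, h0, h1, -, -, h2⟩ :=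
    exists_support_of_X_pow_dvd hp hq hdet hm hk hij hne
  exact ⟨i₀, j₀, h0, h1, by omega⟩

include hp hq hdet hm in
-- A vanishing row would be divisible by `X ^ (N + 1)`, and the support would contain a point of
-- weight `N` with `j > N`.
lemma row_ne_zero {F : MvPowerSeries (Fin 2) K} {N : ℕ}
    (hN : ∃ i j, bcoeff i j F ≠ 0 ∧ p * i + q * j = N) :
    coeff N (rows (hnTransform p q p' q' m F)) ≠ 0 := by
  intro h
  obtain ⟨i, j, -, h1, h2⟩ := exists_support_of_strict (k := N + 1) hp hq hdet hm hN
    (h ▸ dvd_zero _)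
  nlinarith

include hp hq hdet hm hχ0 hυ0 hχ in
lemma exists_strict_of_evalAt_eq_zero {h : MvPowerSeries (Fin 2) K} (h0 : h ≠ 0)
    (hz : evalAt ((υ + C m) ^ q' * χ ^ p) ((υ + C m) ^ p' * χ ^ q) h = 0) :
    ∃ N G, (∃ i j, bcoeff i j h ≠ 0 ∧ p * i + q * j = N) ∧
      (∀ i j, p * i + q * j < N → bcoeff i j h = 0) ∧
      hnTransform p q p' q' m h = MvPowerSeries.X 0 ^ N * G ∧
      restr G = coeff N (rows (hnTransform p q p' q' m h)) ∧ restr G ≠ 0 ∧ evalAt χ υ G = 0 := by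
  obtain ⟨N, hN, hlt⟩ := exists_weight h0 p q
  obtain ⟨G, hG, hr⟩ := exists_hnTransform_eq hp hq (p' := p') (q' := q') m hlt
  refine ⟨N, G, hN, hlt, hG, hr, hr ▸ row_ne_zero hp hq hdet hm hN, ?_⟩
  rw [← evalAt_hnTransform p' q' m hp hq hχ0 hυ0, hG, evalAt_X_pow_mul hχ0 hυ0] at hz
  exact (mul_eq_zero.1 hz).resolve_left (pow_ne_zero _ hχ)

end

/-- A series in the kernel of the evaluation at `(φ, ψ)` has intersection number at least `ord φ`
with `x = 0`. -/
theorem Resolves.order_le {φ ψ : PowerSeries K} (hr : Resolves φ ψ)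
    {h : MvPowerSeries (Fin 2) K} (hz : evalAt φ ψ h = 0) (h0 : restr h ≠ 0) :
    order φ ≤ order (restr h) := by
  induction hr generalizing h with
  | base φ ψ hφ hψ =>
    rw [hφ]
    have hφ0 := PowerSeries.one_le_order_iff_constCoeff_eq_zero.1 hφ.ge
    refine one_le_order ?_
    rw [← PowerSeries.coeff_zero_eq_constantCoeff_apply, coeff_restr,
      ← constantCoeff_evalAt hφ0 hψ, hz, map_zero]
  | step p q p' q' m χ υ hp hq hdet hm hr ih =>
    obtain ⟨hχ0, hυ0, hχ, -⟩ := hr.zero_ne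
    obtain ⟨N, G, hN, hlt, hG, hrow, hne, hz'⟩ := exists_strict_of_evalAt_eq_zero hp hq hdet hm
      hχ0 hυ0 hχ (ne_zero_of_restr_ne_zero h0) hz
    have hle := ih hz' hne
    rw [order_hn hυ0 hm]
    have hχ1 := PowerSeries.coe_toNat_order hχ
    rw [← hχ1] at hle ⊢
    have hk : X ^ χ.order.toNat ∣ coeff N (rows (hnTransform p q p' q' m h)) := by
      rw [← hrow, PowerSeries.X_pow_dvd_iff]
      exact fun j hj => PowerSeries.coeff_of_lt_order _ (lt_of_lt_of_le (by exact_mod_cast hj) hle)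
    obtain ⟨i, j, -, h1, h2⟩ := exists_support_of_strict hp hq hdet hm hN hk
    rw [← PowerSeries.coe_toNat_order h0]
    have h3 := PowerSeries.coeff_order h0
    rw [coeff_restr] at h3
    -- The support contains the point of the `y`-axis at height `ord h(0, y)`, so `N` is at most `q`
    -- times this height; the face contains a point with `j ≥ p ord χ`, so `N ≥ q p ord χ`.
    have h4 : N ≤ p * 0 + q * (restr h).order.toNat := by
      by_contra h
      exact h3 (hlt _ _ (not_le.1 h))
    have h5 : p * χ.order.toNat ≤ (restr h).order.toNat := by
      refine Nat.le_of_mul_le_mul_left (le_trans ?_ h4 |>.trans (by simp)) hq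
      exact (Nat.mul_le_mul_left q h2).trans (by omega)
    exact_mod_cast h5

/-- `h` vanishes at `(φ, ψ)` and has the least possible intersection number with `x = 0`. -/
structure IsMinimalFor (h : MvPowerSeries (Fin 2) K) (φ ψ : PowerSeries K) : Prop where
  eval_eq_zero : evalAt φ ψ h = 0
  order_eq : order (restr h) = order φ

/-! ### Face polynomials -/

lemma isWeightedHomogeneous_X_pow (p q : ℕ) (s : Fin 2) (n : ℕ) :
    MvPowerSeries.IsWeightedHomogeneous ![p, q]
      (MvPowerSeries.X s ^ n : MvPowerSeries (Fin 2) K) (n * ![p, q] s) := by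
  classical
  intro d hd
  rw [MvPowerSeries.coeff_X_pow] at hd
  split_ifs at hd with h
  · rw [h, Finsupp.weight_single, smul_eq_mul]
  · exact absurd rfl hd

lemma isWeightedHomogeneous_C_mul {p q N : ℕ} {F : MvPowerSeries (Fin 2) K}
    (h : MvPowerSeries.IsWeightedHomogeneous ![p, q] F N) (a : K) :
    MvPowerSeries.IsWeightedHomogeneous ![p, q] (MvPowerSeries.C a * F) N := by
  intro d hd
  rw [MvPowerSeries.coeff_C_mul] at hd
  exact h (right_ne_zero_of_mul hd)

lemma isWeightedHomogeneous_rootFactor (p q : ℕ) (μ : K) :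
    MvPowerSeries.IsWeightedHomogeneous ![p, q] (rootFactor p q μ) (p * q) := by
  have h1 := @isWeightedHomogeneous_X_pow K _ p q 0 q
  have h2 := @isWeightedHomogeneous_C_mul K _ p q _ _ (@isWeightedHomogeneous_X_pow K _ p q 1 p) (-μ)
  simp only [Matrix.cons_val_zero, Matrix.cons_val_one] at h1 h2
  rw [mul_comm] at h1
  rw [rootFactor, sub_eq_add_neg, ← neg_mul, ← map_neg]
  intro d
  exact h1.add h2

lemma isWeightedHomogeneous_rootFactor_pow (p q : ℕ) (μ : K) (ν : ℕ) :
    MvPowerSeries.IsWeightedHomogeneous ![p, q] (rootFactor p q μ ^ ν) (p * q * ν) := by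
  induction ν with
  | zero =>
    have h := @isWeightedHomogeneous_X_pow K _ p q 0 0
    rw [zero_mul, pow_zero] at h
    rwa [mul_zero, pow_zero]
  | succ ν ih =>
    rw [pow_succ, mul_add, mul_one]
    exact ih.mul (isWeightedHomogeneous_rootFactor p q μ)

lemma slice_facePoly (p q p' q' N : ℕ) (F : MvPowerSeries (Fin 2) K) :
    slice p q p' q' N (facePoly F p q N) = slice p q p' q' N F := by
  refine Finset.sum_congr rfl fun a ha => ?_
  rw [bcoeff_facePoly, if_pos (Finset.mem_filter.1 ha).2]

lemma row_facePoly {p q p' q' : ℕ} (hp : 0 < p) (hq : 0 < q) (m : K) (N : ℕ)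
    (F : MvPowerSeries (Fin 2) K) :
    coeff N (rows (hnTransform p q p' q' m (facePoly F p q N))) =
      coeff N (rows (hnTransform p q p' q' m F)) := by
  rw [coeff_rows_hnTransform _ _ _ hp hq, coeff_rows_hnTransform _ _ _ hp hq, slice_facePoly]

lemma facePoly_X_pow_mul (p q M N : ℕ) (F : MvPowerSeries (Fin 2) K) :
    facePoly (MvPowerSeries.X 0 ^ M * F) p q (p * M + N) =
      MvPowerSeries.X 0 ^ M * facePoly F p q N := by
  refine bcoeff_ext fun i j => ?_
  rw [bcoeff_facePoly]
  rcases lt_or_ge i M with h | h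
  · rw [bcoeff_X_pow_mul_of_lt h, bcoeff_X_pow_mul_of_lt h, ite_self]
  · obtain ⟨i, rfl⟩ := Nat.exists_eq_add_of_le h
    rw [bcoeff_X_pow_mul, bcoeff_X_pow_mul, bcoeff_facePoly, mul_add]
    congr 1
    rw [add_assoc, add_right_inj]

lemma restr_rootFactor {p q : ℕ} (hq : 0 < q) (μ : K) :
    restr (rootFactor p q μ) = C (-μ) * X ^ p := by
  simp [rootFactor, hq.ne']

lemma rootFactor_ne_zero {p q : ℕ} (hq : 0 < q) {μ : K} (hμ : μ ≠ 0) : rootFactor p q μ ≠ 0 := by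
  refine ne_zero_of_restr_ne_zero ?_
  rw [restr_rootFactor hq]
  exact mul_ne_zero (by simpa using hμ) (pow_ne_zero _ PowerSeries.X_ne_zero)

lemma IsHNData.pow_eq {p q p' q' : ℕ} {μ m : K} (hμ : μ ≠ 0) (h : IsHNData p q p' q' μ m) :
    m ^ (q * q') = μ * m ^ (p * p') := by
  rcases h with ⟨h, rfl⟩ | ⟨h, rfl⟩
  · rw [h, pow_succ']
    field_simp
  · rw [h, pow_succ']

lemma constantCoeff_C_mul_X_pow (a : K) {n : ℕ} (hn : 0 < n) :
    constantCoeff (C a * X ^ n : PowerSeries K) = 0 := by simp [hn.ne']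

lemma evalHom_rootFactor {p q : ℕ} (p' q' : ℕ) (hp : 0 < p) (hq : 0 < q) (μ m : K) :
    evalHom (constantCoeff_C_mul_X_pow (m ^ q') hp) (constantCoeff_C_mul_X_pow (m ^ p') hq)
      (rootFactor p q μ) = C (m ^ (q * q') - μ * m ^ (p * p')) * X ^ (p * q) := by
  simp only [rootFactor, map_sub, map_mul, map_pow, evalHom_X_zero, evalHom_X_one, evalHom_C]
  ring

/-- `x ^ q - μ y ^ p` divides `x ^ M (x ^ q - μ₁ y ^ p) ^ ν` only if `ν > 0` and `μ = μ₁`. -/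
lemma rootFactor_dvd {p q : ℕ} (hp : 0 < p) (hq : 0 < q) (hpq : Nat.Coprime p q) {μ μ₁ c : K}
    (hμ : μ ≠ 0) (hc : c ≠ 0) {M ν : ℕ}
    (h : rootFactor p q μ ∣ MvPowerSeries.C c * MvPowerSeries.X 0 ^ M * rootFactor p q μ₁ ^ ν) :
    ν ≠ 0 ∧ μ = μ₁ := by
  -- Evaluate along the monomial curve `t ↦ (m ^ q' t ^ p, m ^ p' t ^ q)` with `m = μ⁻¹`: it kills
  -- `x ^ q - μ y ^ p`, but neither `x` nor the factor of a different root.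
  obtain ⟨p', q', hd⟩ := exists_isHNData hp hq hpq μ
  have e1 := evalHom_rootFactor p' q' hp hq μ μ⁻¹
  have e2 := evalHom_rootFactor p' q' hp hq μ₁ μ⁻¹
  have e3 := evalHom_X_zero (constantCoeff_C_mul_X_pow (μ⁻¹ ^ q') hp)
    (constantCoeff_C_mul_X_pow (μ⁻¹ ^ p') hq)
  have e4 := evalHom_C (constantCoeff_C_mul_X_pow (μ⁻¹ ^ q') hp)
    (constantCoeff_C_mul_X_pow (μ⁻¹ ^ p') hq) c
  generalize evalHom (constantCoeff_C_mul_X_pow (μ⁻¹ ^ q') hp)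
    (constantCoeff_C_mul_X_pow (μ⁻¹ ^ p') hq) = E at e1 e2 e3 e4
  have h' := map_dvd E h
  rw [map_mul, map_mul, map_pow, map_pow, e1, e2, e3, e4, hd.pow_eq hμ, sub_self, map_zero,
    zero_mul, zero_dvd_iff] at h'
  have hm := hd.ne_zero hμ
  have hC {a : K} (ha : a ≠ 0) : (C a : PowerSeries K) ≠ 0 := by simpa using ha
  have h1 := (mul_eq_zero.1 h').resolve_left (mul_ne_zero (hC hc) (pow_ne_zero _
    (mul_ne_zero (hC (pow_ne_zero _ hm)) (pow_ne_zero _ PowerSeries.X_ne_zero))))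
  obtain ⟨h2, h3⟩ := pow_eq_zero_iff'.1 h1
  have h4 := (mul_eq_zero.1 h2).resolve_right (pow_ne_zero _ PowerSeries.X_ne_zero)
  refine ⟨h3, ?_⟩
  have h5 : (μ - μ₁) * μ⁻¹ ^ (p * p') = 0 := by
    rw [sub_mul]
    exact (map_eq_zero_iff _ PowerSeries.C_injective).1 h4
  exact sub_eq_zero.1 ((mul_eq_zero.1 h5).resolve_right (pow_ne_zero _ hm))

/-! ### The Newton polygon of a minimal series -/

section Minimal

variable {p q p' q' ν : ℕ} (hp : 0 < p) (hq : 0 < q) {μ m : K} (hμ : μ ≠ 0)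
  (hd : IsHNData p q p' q' μ m) {χ υ : PowerSeries K} (hr : Resolves χ υ) (hν : order χ = ν)
  {h : MvPowerSeries (Fin 2) K}
  (hmin : IsMinimalFor h ((υ + C m) ^ q' * χ ^ p) ((υ + C m) ^ p' * χ ^ q))

include hp hq hμ hd in
lemma row_rootFactor_pow (c : K) (ν : ℕ) : ∃ u : PowerSeries K, constantCoeff u ≠ 0 ∧
    coeff (p * q * ν) (rows (hnTransform p q p' q' m
      (MvPowerSeries.C c * rootFactor p q μ ^ ν))) = C c * (X ^ ν * u) := by
  obtain ⟨u, hu, h⟩ := hd.hnTransform_rootFactor hp hq hμ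
  refine ⟨restr u ^ ν, ?_, ?_⟩
  · have := (hu.map (restr (K := K))).pow ν
    exact (PowerSeries.isUnit_iff_constantCoeff.1 this).ne_zero
  · have : hnTransform p q p' q' m (MvPowerSeries.C c * rootFactor p q μ ^ ν) =
        MvPowerSeries.X 0 ^ (p * q * ν) *
          (MvPowerSeries.C c * (MvPowerSeries.X 1 ^ ν * u ^ ν)) := by
      rw [← hnHom_apply p' q' m hp hq, map_mul, map_pow, hnHom_apply, hnHom_apply, h,
        ← hnHom_apply p' q' m hp hq, hnHom_C]
      ring
    rw [this]
    ext j
    rw [coeff_rows]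
    have h2 := bcoeff_X_pow_mul (p * q * ν) 0 j
      (MvPowerSeries.C c * (MvPowerSeries.X 1 ^ ν * u ^ ν))
    rw [add_zero] at h2
    rw [h2, ← coeff_restr]
    simp

include hp hq hμ hd hr hν hmin in
/-- The face polynomial of a minimal series is a constant times `(x ^ q - μ y ^ p) ^ ν`, and its
strict transform is minimal for the transformed pair. -/
theorem IsMinimalFor.face : (∀ i j, p * i + q * j < p * q * ν → bcoeff i j h = 0) ∧
    (∃ c, c ≠ 0 ∧ facePoly h p q (p * q * ν) = MvPowerSeries.C c * rootFactor p q μ ^ ν) ∧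
    ∃ G, hnTransform p q p' q' m h = MvPowerSeries.X 0 ^ (p * q * ν) * G ∧
      IsMinimalFor G χ υ := by
  obtain ⟨hχ0, hυ0, hχ, -⟩ := hr.zero_ne
  have hm := hd.ne_zero hμ
  have hdet := hd.isUnimodular
  have hord : order (restr h) = ((p * ν : ℕ) : ℕ∞) := by
    rw [hmin.order_eq, order_hn hυ0 hm, hν]
    norm_cast
  rw [order_restr_eq_iff] at hord
  have h0 : h ≠ 0 := by
    rintro rfl
    simp at hord
  obtain ⟨N, G, hN, hlt, hG, hrow, hne, hz'⟩ := exists_strict_of_evalAt_eq_zero hp hq hdet hm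
    hχ0 hυ0 hχ h0 hmin.eval_eq_zero
  have hle := hr.order_le hz' hne
  rw [hν] at hle
  have hk : X ^ ν ∣ coeff N (rows (hnTransform p q p' q' m h)) := by
    rw [← hrow, PowerSeries.X_pow_dvd_iff]
    exact fun j hj => PowerSeries.coeff_of_lt_order _ (lt_of_lt_of_le (by exact_mod_cast hj) hle)
  obtain ⟨i, j, -, h1, h2⟩ := exists_support_of_strict hp hq hdet hm hN hk
  -- The vertex `(0, pν)` bounds `N` from above, the face point with `j ≥ pν` from below.
  obtain rfl : N = p * q * ν := by
    have h3 : ¬ p * 0 + q * (p * ν) < N := fun h3 => hord.1 (hlt _ _ h3)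
    nlinarith [Nat.mul_le_mul_left q h2]
  have hμν : (-μ) ^ ν ≠ 0 := pow_ne_zero _ (neg_ne_zero.2 hμ)
  -- The constant `c` matches the coefficients of `y ^ (pν)`. If the face differed from `c (x ^ q -
  -- μ y ^ p) ^ ν`, the difference would again have a row divisible by `X ^ ν`, hence a term with `j
  -- ≥ pν`; on this line that is `y ^ (pν)`, whose coefficient was cancelled.
  obtain ⟨c, hc, hcμ⟩ : ∃ c, c ≠ 0 ∧ c * (-μ) ^ ν = bcoeff 0 (p * ν) h :=
    ⟨bcoeff 0 (p * ν) h / (-μ) ^ ν, div_ne_zero hord.1 hμν, div_mul_cancel₀ _ hμν⟩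
  have hface : facePoly h p q (p * q * ν) = MvPowerSeries.C c * rootFactor p q μ ^ ν := by
    by_contra hD
    rw [← sub_eq_zero] at hD
    obtain ⟨M, ⟨i₁, j₁, hij, hM⟩, -⟩ := exists_weight hD p q
    have hhom : ∀ i j, p * i + q * j ≠ p * q * ν →
        bcoeff i j (MvPowerSeries.C c * rootFactor p q μ ^ ν) = 0 := by
      intro i j hw
      by_contra hb
      refine hw ?_
      have := isWeightedHomogeneous_C_mul (isWeightedHomogeneous_rootFactor_pow p q μ ν) c hb
      rwa [weight_bexp] at this
    have hw : p * i₁ + q * j₁ = p * q * ν := by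
      by_contra hw
      apply hij
      rw [map_sub, hhom _ _ hw, bcoeff_facePoly, if_neg hw, sub_zero]
    have hk' : X ^ ν ∣ coeff (p * q * ν) (rows (hnTransform p q p' q' m
        (facePoly h p q (p * q * ν) - MvPowerSeries.C c * rootFactor p q μ ^ ν))) := by
      obtain ⟨u, -, hu⟩ := row_rootFactor_pow hp hq hμ hd c ν
      rw [← hnHom_apply p' q' m hp hq, map_sub, map_sub, hnHom_apply, hnHom_apply, map_sub,
        row_facePoly hp hq, hu]
      exact dvd_sub hk ⟨C c * u, by ring⟩
    obtain ⟨i₂, j₂, hne₂, hw₂, hj₂⟩ :=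
      exists_support_of_strict hp hq hdet hm ⟨i₁, j₁, hij, hw⟩ hk'
    have hj : j₂ = p * ν := by
      refine le_antisymm (Nat.le_of_mul_le_mul_left ?_ hq) hj₂
      calc q * j₂ ≤ p * q * ν := by omega
        _ = q * (p * ν) := by ring
    subst hj
    have hi : i₂ = 0 := by
      have : p * i₂ = 0 := by linarith [mul_comm p q, mul_assoc q p ν, mul_assoc p q ν,
        show p * q * ν = q * (p * ν) by ring]
      exact (Nat.mul_eq_zero.1 this).resolve_left hp.ne'
    subst hi
    apply hne₂
    rw [map_sub, bcoeff_facePoly, if_pos hw₂, ← hcμ, ← coeff_restr, map_mul, map_pow,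
      restr_rootFactor hq, restr_C, mul_pow, ← pow_mul, ← map_pow, ← mul_assoc, ← map_mul,
      PowerSeries.coeff_C_mul, PowerSeries.coeff_X_pow_self, mul_one, sub_self]
  refine ⟨hlt, ⟨c, hc, hface⟩, G, hG, hz', ?_⟩
  obtain ⟨u, hu0, hu⟩ := row_rootFactor_pow hp hq hμ hd c ν
  rw [hrow, ← row_facePoly hp hq, hface, hu, hν]
  refine order_X_pow_mul (u := C c * u) ?_ (by ring)
  simp [hc, hu0]

end Minimal

/-! ### Uniqueness of the edge and of the root. -/

section EdgeRoot

variable {p q ν M : ℕ} {μ c : K} {h : MvPowerSeries (Fin 2) K}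
  (hp : 0 < p) (hq : 0 < q) (hν : 0 < ν) (hpq : Nat.Coprime p q) (hμ : μ ≠ 0) (hc : c ≠ 0)
  (hlt : ∀ i j, p * i + q * j < p * q * ν → bcoeff i j h = 0)
  (hface : facePoly h p q (p * q * ν) = MvPowerSeries.C c * rootFactor p q μ ^ ν)

include hq hμ hc hface in
lemma bcoeff_vertex_ne_zero : bcoeff 0 (p * ν) h ≠ 0 := by
  have h1 := bcoeff_facePoly h p q (p * q * ν) 0 (p * ν)
  rw [if_pos (by ring), hface, ← coeff_restr, map_mul, map_pow,
      restr_rootFactor hq, restr_C, mul_pow, ← pow_mul, ← map_pow, ← mul_assoc, ← map_mul,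
      PowerSeries.coeff_C_mul, PowerSeries.coeff_X_pow_self, mul_one] at h1
  rw [← h1]
  exact mul_ne_zero hc (pow_ne_zero _ (neg_ne_zero.2 hμ))

include hp hc hface in
lemma bcoeff_vertex_ne_zero' : bcoeff (q * ν) 0 h ≠ 0 := by
  have h1 := bcoeff_facePoly h p q (p * q * ν) (q * ν) 0
  have h2 : PowerSeries.map constantCoeff (rows (MvPowerSeries.C c * rootFactor p q μ ^ ν)) =
      C c * X ^ (q * ν) := by
    simp [rootFactor, hp.ne', pow_mul]
  have h3 := congrArg (coeff (q * ν)) h2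
  rw [PowerSeries.coeff_map, ← PowerSeries.coeff_zero_eq_constantCoeff_apply, coeff_rows,
    PowerSeries.coeff_C_mul, PowerSeries.coeff_X_pow_self, mul_one] at h3
  rw [if_pos (by ring), hface, h3] at h1
  exact h1 ▸ hc

include hp hq hν hpq hμ hc hlt hface in
lemma isEdgeRoot_of_face :
    IsEdgeRoot (MvPowerSeries.X 0 ^ M * h) p q (p * M + p * q * ν) μ ν := by
  have hF : facePoly (MvPowerSeries.X 0 ^ M * h) p q (p * M + p * q * ν) =
      MvPowerSeries.C c * MvPowerSeries.X 0 ^ M * rootFactor p q μ ^ ν := by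
    rw [facePoly_X_pow_mul, hface]
    ring
  refine ⟨hp, hq, hpq, ?_, hμ, hν, hF ▸ dvd_mul_left _ _, ?_⟩
  · rw [weightedOrder_eq_iff]
    refine ⟨⟨M, p * ν, ?_, by ring⟩, fun i j hij => ?_⟩
    · have := bcoeff_X_pow_mul M 0 (p * ν) h
      rw [add_zero] at this
      rw [this]
      exact bcoeff_vertex_ne_zero hq hμ hc hface
    · rcases lt_or_ge i M with hi | hi
      · exact bcoeff_X_pow_mul_of_lt hi _ _
      · obtain ⟨i, rfl⟩ := Nat.exists_eq_add_of_le hi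
        rw [bcoeff_X_pow_mul]
        exact hlt _ _ (by linarith)
  · rw [hF, pow_succ', mul_dvd_mul_iff_right (pow_ne_zero _ (rootFactor_ne_zero hq hμ))]
    intro hdvd
    rw [← mul_one (_ * _), ← pow_zero (rootFactor p q μ)] at hdvd
    exact (rootFactor_dvd hp hq hpq hμ hc hdvd).1 rfl

lemma X_dvd_row_of_isEdgeRoot {F : MvPowerSeries (Fin 2) K} {p q p' q' N ν : ℕ} {μ m : K}
    (h : IsEdgeRoot F p q N μ ν) (hd : IsHNData p q p' q' μ m) :
    X ∣ coeff N (rows (hnTransform p q p' q' m F)) := by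
  obtain ⟨G, hG⟩ := (dvd_pow_self _ h.mult_pos.ne').trans h.dvd
  obtain ⟨u, -, hu⟩ := hd.hnTransform_rootFactor h.p_pos h.q_pos h.root_ne_zero
  rw [← row_facePoly h.p_pos h.q_pos, hG, ← hnHom_apply p' q' m h.p_pos h.q_pos, map_mul,
    hnHom_apply, hu]
  refine ⟨coeff N (rows (MvPowerSeries.X 0 ^ (p * q) * u *
    hnHom p' q' m h.p_pos h.q_pos G)), ?_⟩
  rw [← PowerSeries.coeff_C_mul, ← rows_X_one, ← map_mul]
  congr 2
  ring

include hp hq hν hpq hμ hc hlt hface in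
-- The vertices `(M, pν)` and `(M + qν, 0)` span the known edge, and the support lies in `i ≥ M`
-- above its line. Another edge has two support points at different heights; comparing their weights
-- with those of the vertices forces the same slope. The root is then found by divisibility.
theorem isOnlyEdgeRoot_of_face :
    IsOnlyEdgeRoot (MvPowerSeries.X 0 ^ M * h) p q (p * M + p * q * ν) μ ν := by
  have hroot := isEdgeRoot_of_face (M := M) hp hq hν hpq hμ hc hlt hface
  refine ⟨hroot, fun p₁ q₁ N₁ μ₁ ν₁ h₁ => ?_⟩
  obtain ⟨p', q', hd⟩ := exists_isHNData h₁.p_pos h₁.q_pos h₁.coprime μ₁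
  obtain ⟨⟨i, j, hij, hwt⟩, hlt₁⟩ := weightedOrder_eq_iff.1 h₁.order_eq
  obtain ⟨i₀, j₀, i₁, j₁, hn₀, hw₀, hn₁, hw₁, hle⟩ := exists_support_of_X_pow_dvd h₁.p_pos
    h₁.q_pos hd.isUnimodular (hd.ne_zero h₁.root_ne_zero) (k := 1)
    (by rw [pow_one]; exact X_dvd_row_of_isEdgeRoot h₁ hd) hwt hij
  have hsupp {a b : ℕ} (hab : bcoeff a b (MvPowerSeries.X 0 ^ M * h) ≠ 0) :
      ∃ a', a = M + a' ∧ p * q * ν ≤ p * a' + q * b := by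
    rcases lt_or_ge a M with ha | ha
    · exact absurd (bcoeff_X_pow_mul_of_lt ha _ _) hab
    · obtain ⟨a, rfl⟩ := Nat.exists_eq_add_of_le ha
      rw [bcoeff_X_pow_mul] at hab
      exact ⟨a, rfl, not_lt.1 fun hl => hab (hlt _ _ hl)⟩
  obtain ⟨a₀, rfl, hs₀⟩ := hsupp hn₀
  obtain ⟨a₁, rfl, hs₁⟩ := hsupp hn₁
  have hv : N₁ ≤ p₁ * (M + 0) + q₁ * (p * ν) := by
    refine not_lt.1 fun hl => ?_
    have := hlt₁ _ _ hl
    rw [bcoeff_X_pow_mul] at this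
    exact bcoeff_vertex_ne_zero hq hμ hc hface this
  have hv' : N₁ ≤ p₁ * (M + q * ν) + q₁ * 0 := by
    refine not_lt.1 fun hl => ?_
    have := hlt₁ _ _ hl
    rw [bcoeff_X_pow_mul] at this
    exact bcoeff_vertex_ne_zero' hp hc hface this
  have hp₁ := h₁.p_pos
  have hj₀ : 0 < j₀ := by omega
  have ha₁ : 0 < a₁ := by
    by_contra ha
    obtain rfl : a₁ = 0 := by omega
    have h2 : q₁ * j₁ < q₁ * j₀ := Nat.mul_lt_mul_of_pos_left (by omega) h₁.q_pos
    nlinarith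
  -- A flatter line violates the bound at the upper point, as `j₀ > 0`; a steeper one at the lower
  -- point, as `a₁ > 0`.
  have hslope : p₁ * q = q₁ * p := by
    rcases lt_trichotomy (p₁ * q) (q₁ * p) with hl | hl | hl
    · exfalso
      have h3 : p₁ * a₀ + q₁ * j₀ ≤ p₁ * (q * ν) := by linarith
      have h4 := Nat.mul_le_mul_left p h3
      have h5 := Nat.mul_le_mul_left p₁ hs₀
      nlinarith [Nat.mul_lt_mul_of_pos_right hl hj₀]
    · exact hl
    · exfalso
      have h3 : p₁ * a₁ + q₁ * j₁ ≤ q₁ * (p * ν) := by linarith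
      have h4 := Nat.mul_le_mul_left q h3
      have h5 := Nat.mul_le_mul_left q₁ hs₁
      nlinarith [Nat.mul_lt_mul_of_pos_right hl ha₁]
  have hpp : p₁ = p := by
    refine Nat.dvd_antisymm ?_ ?_
    · exact h₁.coprime.dvd_of_dvd_mul_left (Dvd.intro _ hslope)
    · exact hpq.dvd_of_dvd_mul_right (Dvd.intro_left _ hslope.symm)
  subst hpp
  have hqq : q₁ = q := Nat.eq_of_mul_eq_mul_left hp (by linarith)
  subst hqq
  refine ⟨rfl, rfl, ?_⟩
  obtain rfl : N₁ = p₁ * M + p₁ * q₁ * ν := by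
    have := h₁.order_eq.symm.trans hroot.order_eq
    exact_mod_cast this
  have hdvd := (dvd_pow_self _ h₁.mult_pos.ne').trans h₁.dvd
  rw [facePoly_X_pow_mul, hface, ← mul_assoc, mul_comm (MvPowerSeries.X 0 ^ M)] at hdvd
  exact (rootFactor_dvd hp hq hpq h₁.root_ne_zero hc hdvd).2

end EdgeRoot

/-! ### Existence of minimal series -/

lemma eq_C_add_X_mul_mk {A : Type*} [CommRing A] (a : ℕ → A) :
    mk a = C (a 0) + X * mk fun i => a (i + 1) := by
  ext i
  cases i with
  | zero => simp
  | succ i => simp [PowerSeries.coeff_succ_X_mul]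

/-- A series is the sum of a polynomial of degree less than `n` and a multiple of `φ`,
where `n = ord φ`. -/
lemma exists_eq_sum_add_mul {φ : PowerSeries K} {n : ℕ} (hφ : order φ = n) (g : PowerSeries K) :
    ∃ g', g = (∑ j ∈ Finset.range n, C (coeff j g) * X ^ j) + φ * g' := by
  have hne : φ ≠ 0 := by
    rintro rfl
    simp at hφ
  obtain ⟨u, hu, hφu⟩ := exists_eq_X_pow_mul_unit hne
  rw [hφ, ENat.toNat_natCast] at hφu
  have h : X ^ n ∣ g - ∑ j ∈ Finset.range n, C (coeff j g) * X ^ j := by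
    rw [PowerSeries.X_pow_dvd_iff]
    intro k hk
    rw [map_sub, map_sum, Finset.sum_eq_single k]
    · simp
    · intro j _ hj
      simp [PowerSeries.coeff_X_pow, hj.symm]
    · simp [hk]
  obtain ⟨g₁, hg₁⟩ := h
  refine ⟨u⁻¹ * g₁, ?_⟩
  rw [hφu]
  linear_combination hg₁ - X ^ n * g₁ * PowerSeries.mul_inv_cancel u hu

/-- `K[[t]]` is generated by `1, t, …, t ^ (n - 1)` over `K[[φ]]`, where `n = ord φ`. -/
lemma exists_eq_sum_subst {φ : PowerSeries K} (hφ0 : constantCoeff φ = 0) {n : ℕ}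
    (hφ : order φ = n) (g : PowerSeries K) :
    ∃ r : ℕ → PowerSeries K, g = ∑ j ∈ Finset.range n, PowerSeries.subst φ (r j) * X ^ j := by
  choose D hD using exists_eq_sum_add_mul hφ
  have hs := PowerSeries.HasSubst.of_constantCoeff_zero' hφ0
  -- Divide repeatedly by `φ`: the coefficients of `r g j` are the `j`-th coefficients of the
  -- successive quotients.
  let r (g : PowerSeries K) (j : ℕ) : PowerSeries K := mk fun i => coeff j (D^[i] g)
  have hr (g : PowerSeries K) (j : ℕ) : PowerSeries.subst φ (r g j) =
      C (coeff j g) + φ * PowerSeries.subst φ (r (D g) j) := by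
    have hC : PowerSeries.subst φ (C (coeff j g)) = C (coeff j g) := PowerSeries.subst_C _
    rw [show r g j = C (coeff j g) + X * r (D g) j from eq_C_add_X_mul_mk _,
      PowerSeries.subst_add hs, PowerSeries.subst_mul hs, PowerSeries.subst_X hs, hC]
  have key (k : ℕ) : ∀ g, φ ^ k ∣ g - ∑ j ∈ Finset.range n, PowerSeries.subst φ (r g j) * X ^ j := by
    induction k with
    | zero => simp
    | succ k ih =>
      intro g
      have : g - ∑ j ∈ Finset.range n, PowerSeries.subst φ (r g j) * X ^ j =
          φ * (D g - ∑ j ∈ Finset.range n, PowerSeries.subst φ (r (D g) j) * X ^ j) := by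
        simp only [hr g, add_mul, Finset.sum_add_distrib, mul_assoc, ← Finset.mul_sum]
        linear_combination hD g
      rw [this, pow_succ']
      exact mul_dvd_mul_left _ (ih _)
  exact ⟨r g, eq_of_forall_pow_dvd_sub hφ0 fun k => key k g⟩

/-- The `n + 1` rows of length `n`, padded by a zero column, form a square matrix of determinant
zero, which has a left kernel vector over a domain. -/
lemma exists_linear_dependence {A : Type*} [CommRing A] [IsDomain A] {n : ℕ}
    (r : ℕ → ℕ → A) : ∃ a : ℕ → A, (∃ i ≤ n, a i ≠ 0) ∧
      ∀ j < n, ∑ i ∈ Finset.range (n + 1), a i * r i j = 0 := by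
  let M : Matrix (Fin (n + 1)) (Fin (n + 1)) A :=
    fun i j => if (j : ℕ) < n then r i j else 0
  have hdet : M.det = 0 :=
    Matrix.det_eq_zero_of_column_eq_zero (Fin.last n) fun i => by simp [M]
  obtain ⟨v, hv, hvM⟩ := Matrix.exists_vecMul_eq_zero_iff.2 hdet
  refine ⟨fun i => if h : i < n + 1 then v ⟨i, h⟩ else 0, ?_, fun j hj => ?_⟩
  · obtain ⟨i, hi⟩ := Function.ne_iff.1 hv
    exact ⟨i, by omega, by simpa [i.is_le] using hi⟩
  · have := congrFun hvM ⟨j, by omega⟩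
    simp only [Matrix.vecMul, dotProduct, M, hj, if_true, Pi.zero_apply] at this
    rw [Finset.sum_range]
    refine Eq.trans (Finset.sum_congr rfl fun i _ => ?_) this
    beta_reduce
    rw [dif_pos i.isLt]

lemma bcoeff_toMvPowerSeries_mul (a : PowerSeries K) (k i j : ℕ) :
    bcoeff i j (PowerSeries.toMvPowerSeries (0 : Fin 2) a * MvPowerSeries.X 1 ^ k) =
      if j = k then coeff i a else 0 := by
  have h : rows (PowerSeries.toMvPowerSeries (0 : Fin 2) a) = PowerSeries.map C a := by
    ext i j
    rw [coeff_rows, PowerSeries.toMvPowerSeries_eq_subst, bcoeff, PowerSeries.coeff_subst_single,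
      PowerSeries.coeff_map, PowerSeries.coeff_C, bexp_zero]
    congr 1
    rw [eq_iff_iff]
    constructor
    · intro h
      simpa using DFunLike.congr_fun h 1
    · rintro rfl
      simp [bexp]
  rw [← coeff_rows, map_mul, map_pow, h, rows_X_one, ← map_pow, PowerSeries.coeff_mul_C,
    PowerSeries.coeff_map, PowerSeries.coeff_C_mul, PowerSeries.coeff_X_pow, mul_ite, mul_one,
    mul_zero]

/-- As `K[[t]]` is generated by `n = ord φ` elements over `K[[φ]]`, the powers `1, ψ, …, ψ ^ n` are
dependent. The relation is a polynomial in `y` of degree at most `n`; after removal of its power of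
`x` its order on `x = 0` is at most `n`, and at least `n` by `Resolves.order_le`. -/
theorem Resolves.exists_isMinimalFor {φ ψ : PowerSeries K} (hr : Resolves φ ψ) :
    ∃ h, IsMinimalFor h φ ψ := by
  obtain ⟨hφ0, hψ0, hφ, -⟩ := hr.zero_ne
  have hn := (PowerSeries.coe_toNat_order hφ).symm
  generalize φ.order.toNat = n at hn
  have hs := PowerSeries.HasSubst.of_constantCoeff_zero' hφ0
  choose r hrs using exists_eq_sum_subst hφ0 hn
  obtain ⟨a, ⟨k, hk, hak⟩, ha⟩ := exists_linear_dependence (n := n) fun i => r (ψ ^ i)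
  let h₀ : MvPowerSeries (Fin 2) K := ∑ i ∈ Finset.range (n + 1),
    PowerSeries.toMvPowerSeries (0 : Fin 2) (a i) * MvPowerSeries.X 1 ^ i
  have hb (i j : ℕ) : bcoeff i j h₀ = if j < n + 1 then coeff i (a j) else 0 := by
    simp [h₀, bcoeff_toMvPowerSeries_mul]
  have hne : h₀ ≠ 0 := by
    intro h0
    refine hak (PowerSeries.ext fun i => ?_)
    have := hb i k
    rw [h0, map_zero, if_pos (by omega)] at this
    rw [← this, map_zero]
  have hz : evalAt φ ψ h₀ = 0 := by
    rw [← evalHom_apply hφ0 hψ0, map_sum]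
    simp only [map_mul, map_pow, evalHom_X_one]
    simp only [evalHom_apply, evalAt_toMvPowerSeries_zero hφ0 hψ0]
    calc _ = ∑ i ∈ Finset.range (n + 1), ∑ j ∈ Finset.range n,
          PowerSeries.subst φ (a i * r (ψ ^ i) j) * X ^ j := by
          refine Finset.sum_congr rfl fun i _ => ?_
          conv_lhs => rw [hrs (ψ ^ i)]
          simp only [Finset.mul_sum, PowerSeries.subst_mul hs, mul_assoc]
      _ = ∑ j ∈ Finset.range n, PowerSeries.substAlgHom hs
            (∑ i ∈ Finset.range (n + 1), a i * r (ψ ^ i) j) * X ^ j := by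
          rw [Finset.sum_comm]
          simp only [map_sum, Finset.sum_mul, PowerSeries.coe_substAlgHom]
      _ = 0 := Finset.sum_eq_zero fun j hj => by
          rw [ha j (Finset.mem_range.1 hj), map_zero, zero_mul]
  obtain ⟨e, h, hh, h1⟩ := exists_eq_X_pow_mul hne
  rw [hh, evalAt_X_pow_mul hφ0 hψ0] at hz
  have hz' := (mul_eq_zero.1 hz).resolve_left (pow_ne_zero _ hφ)
  refine ⟨h, hz', le_antisymm ?_ (hr.order_le hz' h1)⟩
  obtain ⟨j, hj⟩ := PowerSeries.exists_coeff_ne_zero_iff_ne_zero.2 h1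
  rw [hn]
  refine (PowerSeries.order_le j hj).trans ?_
  rw [coeff_restr, ← bcoeff_X_pow_mul e, ← hh, hb] at hj
  have : j ≤ n := by
    by_contra hjn
    exact hj (if_neg (by omega))
  exact_mod_cast this

/-! ### Weierstrass division -/

lemma exists_weierstrass_step {H : PowerSeries (PowerSeries K)} {n : ℕ}
    (hH : order (constantCoeff H) = n) (F : PowerSeries (PowerSeries K)) :
    ∃ (l q : PowerSeries K) (F' : PowerSeries (PowerSeries K)), (∀ j, n ≤ j → coeff j l = 0) ∧
      F = C l + C q * H + X * F' := by
  obtain ⟨q, hq⟩ := exists_eq_sum_add_mul hH (constantCoeff F)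
  generalize hl : ∑ j ∈ Finset.range n, C (coeff j (constantCoeff F)) * X ^ j = l at hq
  have : X ∣ F - (C l + C q * H) := by
    rw [PowerSeries.X_dvd_iff]
    simp only [map_sub, map_add, map_mul, PowerSeries.constantCoeff_C]
    linear_combination hq
  obtain ⟨F', hF'⟩ := this
  refine ⟨l, q, F', fun j hj => ?_, by linear_combination hF'⟩
  rw [← hl, map_sum]
  refine Finset.sum_eq_zero fun i hi => ?_
  rw [PowerSeries.coeff_C_mul, PowerSeries.coeff_X_pow, if_neg, mul_zero]
  have := Finset.mem_range.1 hi
  omega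

/-- Division at `x = 0` leaves a multiple of `x`, to which the division is applied again; quotient
and remainder collect the successive results. -/
lemma exists_weierstrass_division {H : PowerSeries (PowerSeries K)} {n : ℕ}
    (hH : order (constantCoeff H) = n) (F : PowerSeries (PowerSeries K)) :
    ∃ Q R : PowerSeries (PowerSeries K), F = Q * H + R ∧
      ∀ i j, n ≤ j → coeff j (coeff i R) = 0 := by
  choose l q D hl hD using exists_weierstrass_step hH
  let Q (F : PowerSeries (PowerSeries K)) : PowerSeries (PowerSeries K) := mk fun i => q (D^[i] F)
  let R (F : PowerSeries (PowerSeries K)) : PowerSeries (PowerSeries K) := mk fun i => l (D^[i] F)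
  have hQ (F) : Q F = C (q F) + X * Q (D F) := eq_C_add_X_mul_mk _
  have hR (F) : R F = C (l F) + X * R (D F) := eq_C_add_X_mul_mk _
  have key (k : ℕ) : ∀ F, X ^ k ∣ F - (Q F * H + R F) := by
    induction k with
    | zero => simp
    | succ k ih =>
      intro F
      have : F - (Q F * H + R F) = X * (D F - (Q (D F) * H + R (D F))) := by
        rw [hQ F, hR F]
        linear_combination hD F
      rw [this, pow_succ']
      exact mul_dvd_mul_left _ (ih _)
  refine ⟨Q F, R F, ?_, fun i j hj => ?_⟩
  · rw [← sub_eq_zero]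
    ext1 i
    rw [map_zero]
    exact PowerSeries.X_pow_dvd_iff.1 (key (i + 1) F) i i.lt_succ_self
  · simp only [R, PowerSeries.coeff_mk]
    exact hl _ j hj

/-- A minimal series generates the kernel of the evaluation. -/
theorem IsMinimalFor.dvd {φ ψ : PowerSeries K} (hr : Resolves φ ψ) {h f : MvPowerSeries (Fin 2) K}
    (hmin : IsMinimalFor h φ ψ) (hf : evalAt φ ψ f = 0) : h ∣ f := by
  obtain ⟨hφ0, hψ0, hφ, -⟩ := hr.zero_ne
  have hn := (PowerSeries.coe_toNat_order hφ).symm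
  generalize φ.order.toNat = n at hn
  obtain ⟨Q, R, hQR, hR⟩ := exists_weierstrass_division (H := rows h) (n := n)
    (hmin.order_eq.trans hn) (rows f)
  have hfe : f = ofRows Q * h + ofRows R := rows_injective (by simpa using hQR)
  have hzR : evalAt φ ψ (ofRows R) = 0 := by
    have := hf
    rw [hfe, ← evalHom_apply hφ0 hψ0, map_add, map_mul, evalHom_apply, evalHom_apply,
      evalHom_apply, hmin.eval_eq_zero, mul_zero, zero_add] at this
    exact this
  by_cases h0 : ofRows R = 0
  · exact ⟨ofRows Q, by rw [hfe, h0, add_zero, mul_comm]⟩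
  -- A nonzero remainder, freed of its power of `x`, lies in the kernel and has order less than `n`
  -- on `x = 0`.
  · exfalso
    obtain ⟨e, G, hG, h1⟩ := exists_eq_X_pow_mul h0
    rw [hG, evalAt_X_pow_mul hφ0 hψ0] at hzR
    have hle := hr.order_le ((mul_eq_zero.1 hzR).resolve_left (pow_ne_zero _ hφ)) h1
    obtain ⟨j, hj⟩ := PowerSeries.exists_coeff_ne_zero_iff_ne_zero.2 h1
    have hle' := hle.trans (PowerSeries.order_le j hj)
    rw [hn] at hle'
    rw [coeff_restr, ← bcoeff_X_pow_mul e, ← hG, bcoeff_ofRows] at hj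
    exact hj (hR _ _ (by exact_mod_cast hle'))

/-- An irreducible series is minimal for each pair that is resolved and on which it vanishes. -/
theorem IsMinimalFor.of_irreducible {φ ψ : PowerSeries K} (hr : Resolves φ ψ)
    {f : MvPowerSeries (Fin 2) K} (hf : Irreducible f) (hz : evalAt φ ψ f = 0) :
    IsMinimalFor f φ ψ := by
  obtain ⟨hφ0, hψ0, hφ, -⟩ := hr.zero_ne
  obtain ⟨h, hmin⟩ := hr.exists_isMinimalFor
  obtain ⟨Q, rfl⟩ := hmin.dvd hr hz
  refine ⟨hz, ?_⟩
  rcases hf.isUnit_or_isUnit rfl with hu | hu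
  · exfalso
    have h1 := PowerSeries.order_zero_of_unit (hu.map (restr (K := K)))
    rw [hmin.order_eq] at h1
    exact PowerSeries.order_ne_zero_iff_constCoeff_eq_zero.2 hφ0 h1
  · rw [map_mul, PowerSeries.order_mul, PowerSeries.order_zero_of_unit (hu.map (restr (K := K))),
      add_zero, hmin.order_eq]

/-! ### Existence of primitive parametrizations -/

/-- Remove the power of `X`; the cofactor has positive degree and nonzero constant term. Algebraic
closedness enters the argument through this root. -/
lemma exists_root_ne_zero [IsAlgClosed K] {P : Polynomial K}
    (hP : P.natTrailingDegree < P.natDegree) : ∃ z, z ≠ 0 ∧ P.IsRoot z := by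
  have hP0 : P ≠ 0 := by
    rintro rfl
    simp at hP
  have hX : (Polynomial.X : Polynomial K) ^ P.natTrailingDegree ∣ P :=
    Polynomial.X_pow_dvd_iff.2 fun d hd => Polynomial.coeff_eq_zero_of_lt_natTrailingDegree hd
  obtain ⟨R, hR⟩ := hX
  have hR0 : R ≠ 0 := by
    rintro rfl
    exact hP0 (by simpa using hR)
  have h0 : R.coeff 0 ≠ 0 := by
    have h := Polynomial.coeff_X_pow_mul R P.natTrailingDegree 0
    rw [← hR, zero_add] at h
    rw [← h]
    exact Polynomial.trailingCoeff_nonzero_iff_nonzero.2 hP0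
  have hdeg : P.natDegree = P.natTrailingDegree + R.natDegree := by
    conv_lhs => rw [hR]
    rw [Polynomial.natDegree_mul (pow_ne_zero _ Polynomial.X_ne_zero) hR0,
      Polynomial.natDegree_X_pow]
  obtain ⟨z, hz⟩ := IsAlgClosed.exists_root R fun h => by
    rw [Polynomial.degree_eq_natDegree hR0] at h
    have : R.natDegree = 0 := by exact_mod_cast h
    omega
  refine ⟨z, ?_, ?_⟩
  · rintro rfl
    rw [Polynomial.IsRoot, ← Polynomial.coeff_zero_eq_eval_zero] at hz
    exact h0 hz
  · rw [hR]
    exact Polynomial.root_mul_left_of_isRoot _ hz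

/-- The first edge of a Newton polygon. -/
lemma exists_first_edge {F : MvPowerSeries (Fin 2) K} {n : ℕ}
    (hF : order (restr F) = n) (h : ∃ i j, j < n ∧ bcoeff i j F ≠ 0) :
    ∃ p q i₀ j₀, 0 < p ∧ 0 < q ∧ Nat.Coprime p q ∧ j₀ < n ∧ bcoeff i₀ j₀ F ≠ 0 ∧
      p * i₀ + q * j₀ = q * n ∧ ∀ i j, p * i + q * j < q * n → bcoeff i j F = 0 := by
  classical
  rw [order_restr_eq_iff] at hF
  -- The slope `i / (n - j)` seen from `(0, n)` is to be minimized; the factor `n!` makes all slopes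
  -- integers.
  have hex : ∃ N i j, j < n ∧ bcoeff i j F ≠ 0 ∧ i * (n.factorial / (n - j)) = N := by
    obtain ⟨i, j, hj, hij⟩ := h
    exact ⟨_, i, j, hj, hij, rfl⟩
  obtain ⟨i₀, j₀, hj₀, hne₀, hN⟩ := Nat.find_spec hex
  have hmin (i j : ℕ) (hj : j < n) (hij : bcoeff i j F ≠ 0) : i₀ * (n - j) ≤ i * (n - j₀) := by
    have hle : i₀ * (n.factorial / (n - j₀)) ≤ i * (n.factorial / (n - j)) := by
      rw [hN]
      exact Nat.find_min' hex ⟨i, j, hj, hij, rfl⟩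
    have h1 : n.factorial / (n - j) * (n - j) = n.factorial :=
      Nat.div_mul_cancel (Nat.dvd_factorial (by omega) (by omega))
    have h2 : n.factorial / (n - j₀) * (n - j₀) = n.factorial :=
      Nat.div_mul_cancel (Nat.dvd_factorial (by omega) (by omega))
    refine Nat.le_of_mul_le_mul_left ?_ n.factorial_pos
    calc n.factorial * (i₀ * (n - j))
        = i₀ * (n.factorial / (n - j₀)) * ((n - j) * (n - j₀)) := by
          linear_combination (i₀ * (n - j)) * h2.symm
      _ ≤ i * (n.factorial / (n - j)) * ((n - j) * (n - j₀)) := Nat.mul_le_mul_right _ hle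
      _ = n.factorial * (i * (n - j₀)) := by
          linear_combination (i * (n - j₀)) * h1
  have hi₀ : 0 < i₀ := by
    by_contra hi
    obtain rfl : i₀ = 0 := by omega
    exact hne₀ (hF.2 _ hj₀)
  obtain ⟨q, p, hqp, hq, hp⟩ := Nat.exists_coprime i₀ (n - j₀)
  have hd : 0 < i₀.gcd (n - j₀) := Nat.gcd_pos_of_pos_left _ hi₀
  generalize i₀.gcd (n - j₀) = d at hd hp hq
  have hq0 : 0 < q := Nat.pos_of_mul_pos_right (hq ▸ hi₀)
  have hp0 : 0 < p := Nat.pos_of_mul_pos_right (hp ▸ Nat.sub_pos_of_lt hj₀)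
  refine ⟨p, q, i₀, j₀, hp0, hq0, hqp.symm, hj₀, hne₀, ?_, fun i j hij => ?_⟩
  · have : n = p * d + j₀ := by omega
    rw [this, hq]
    ring
  · by_contra hne
    have hj : j < n := by
      by_contra hj
      have := Nat.mul_le_mul_left q (not_lt.1 hj)
      omega
    have h1 := hmin i j hj hne
    rw [hp, hq] at h1
    have h2 : q * (n - j) ≤ i * p := Nat.le_of_mul_le_mul_right (by linarith) hd
    obtain ⟨e, rfl⟩ := Nat.exists_eq_add_of_lt hj
    rw [show j + e + 1 - j = e + 1 by omega] at h2
    nlinarith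

/-- `F` vanishes on a pair with first component different from `0`. -/
def HasZero (F : MvPowerSeries (Fin 2) K) : Prop :=
  ∃ φ ψ : PowerSeries K, constantCoeff φ = 0 ∧ constantCoeff ψ = 0 ∧ φ ≠ 0 ∧ evalAt φ ψ F = 0

lemma hasZero_of_X_dvd {F : MvPowerSeries (Fin 2) K} (h : MvPowerSeries.X 1 ∣ F) :
    HasZero F := by
  obtain ⟨G, rfl⟩ := h
  have hX0 : constantCoeff (X : PowerSeries K) = 0 := by simp
  refine ⟨X, 0, hX0, map_zero _, PowerSeries.X_ne_zero, ?_⟩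
  rw [← evalHom_apply hX0 (map_zero _), map_mul, evalHom_X_one, zero_mul]

lemma HasZero.of_hn {p q p' q' N : ℕ} (hp : 0 < p) (hq : 0 < q) {m : K} (hm : m ≠ 0)
    {F G : MvPowerSeries (Fin 2) K}
    (hG : hnTransform p q p' q' m F = MvPowerSeries.X 0 ^ N * G) (h : HasZero G) : HasZero F := by
  obtain ⟨χ, υ, hχ0, hυ0, hχ, hz⟩ := h
  have h4 : υ + C m ≠ 0 := fun h => add_C_ne_zero hυ0 hm (by rw [h, map_zero])
  refine ⟨(υ + C m) ^ q' * χ ^ p, (υ + C m) ^ p' * χ ^ q, by simp [hχ0, hp.ne'],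
    by simp [hχ0, hq.ne'], mul_ne_zero (pow_ne_zero _ h4) (pow_ne_zero _ hχ), ?_⟩
  rw [← evalAt_hnTransform p' q' m hp hq hχ0 hυ0, hG, evalAt_X_pow_mul hχ0 hυ0, hz, mul_zero]

/-- Without a zero, `y` does not divide `F`, so there is a first edge. Its slice has at least two
terms, hence a nonzero root `m`; if the strict transform has order `k` there, the face has a point
with `j ≥ p k`, whence `p k ≤ n`. -/
lemma exists_smaller_or_same [IsAlgClosed K] {F : MvPowerSeries (Fin 2) K} {n : ℕ} (hn : 0 < n)
    (hF : order (restr F) = n) (hz : ¬ HasZero F) :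
    ∃ (p q p' q' N k : ℕ) (m : K) (G : MvPowerSeries (Fin 2) K), 0 < p ∧ 0 < q ∧ 0 < N ∧ 0 < k ∧
      m ≠ 0 ∧ (p = 1 → p' = 1 ∧ q' = 0) ∧ p * k ≤ n ∧
      hnTransform p q p' q' m F = MvPowerSeries.X 0 ^ N * G ∧ order (restr G) = k := by
  have hex : ∃ i j, j < n ∧ bcoeff i j F ≠ 0 := by
    by_contra! hcon
    refine hz (hasZero_of_X_dvd (MvPowerSeries.X_dvd_iff.2 fun d hd => ?_))
    rw [← bexp_eta d, hd]
    exact hcon _ _ hn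
  obtain ⟨p, q, i₀, j₀, hp, hq, hpq, hj₀, hne₀, hw₀, hlt⟩ := exists_first_edge hF hex
  rw [order_restr_eq_iff] at hF
  obtain ⟨p', q', hdet, hp1⟩ : ∃ p' q' : ℕ, IsUnimodular p q p' q' ∧ (p = 1 → p' = 1 ∧ q' = 0) := by
    by_cases hp1 : p = 1
    · exact ⟨1, 0, Or.inl (by simp [hp1]), fun _ => ⟨rfl, rfl⟩⟩
    · obtain ⟨p', q', hd⟩ := exists_isHNData hp hq hpq (1 : K)
      exact ⟨p', q', hd.isUnimodular, fun h => absurd h hp1⟩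
  have hw : p * 0 + q * n = q * n := by ring
  have h1 := coeff_slice hp hq hdet (F := F) hw
  have h2 := coeff_slice hp hq hdet (F := F) hw₀
  have hne : q' * 0 + p' * n ≠ q' * i₀ + p' * j₀ := fun h =>
    hj₀.ne' (eq_of_slice_exponent_eq hp hdet hw hw₀ h).2
  have hdeg : (slice p q p' q' (q * n) F).natTrailingDegree <
      (slice p q p' q' (q * n) F).natDegree := by
    have a1 := Polynomial.natTrailingDegree_le_of_ne_zero (h1.trans_ne hF.1)
    have a2 := Polynomial.natTrailingDegree_le_of_ne_zero (h2.trans_ne hne₀)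
    have a3 := Polynomial.le_natDegree_of_ne_zero (h1.trans_ne hF.1)
    have a4 := Polynomial.le_natDegree_of_ne_zero (h2.trans_ne hne₀)
    omega
  obtain ⟨m, hm, hroot⟩ := exists_root_ne_zero hdeg
  obtain ⟨G, hG, hrow⟩ := exists_hnTransform_eq hp hq (p' := p') (q' := q') m hlt
  have hrow0 : restr G ≠ 0 := hrow ▸ row_ne_zero hp hq hdet hm ⟨i₀, j₀, hne₀, hw₀⟩
  have hk := (PowerSeries.coe_toNat_order hrow0).symm
  refine ⟨p, q, p', q', q * n, _, m, G, hp, hq, Nat.mul_pos hq hn, ?_, hm, hp1, ?_, hG, hk⟩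
  · have hX : X ∣ restr G := by
      rw [hrow, coeff_rows_hnTransform p' q' m hp hq, ← pow_one X, X_pow_dvd_coe_comp_iff, pow_one]
      exact Polynomial.dvd_iff_isRoot.2 hroot
    have := one_le_order (PowerSeries.X_dvd_iff.1 hX)
    rw [hk] at this
    exact_mod_cast this
  · have hdvd : X ^ (restr G).order.toNat ∣
        coeff (q * n) (rows (hnTransform p q p' q' m F)) := by
      rw [← hrow]
      exact PowerSeries.X_pow_order_dvd
    obtain ⟨i, j, -, hw₁, hj⟩ := exists_support_of_strict hp hq hdet hm ⟨i₀, j₀, hne₀, hw₀⟩ hdvd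
    exact hj.trans (Nat.le_of_mul_le_mul_left (by omega) hq)

/-- Zeros of a strict transform give zeros of `F`, so induction settles a drop of the order. If it
never drops, all steps have `p = 1` and the limit of the chain is a zero: each step releases a
positive power of `X` from the value. -/
theorem hasZero_of_order_eq [IsAlgClosed K] {n : ℕ} (hn : 0 < n) {F : MvPowerSeries (Fin 2) K}
    (hF : order (restr F) = n) : HasZero F := by
  induction n using Nat.strong_induction_on generalizing F with
  | _ n ih =>
    by_contra hz
    have hstep : ∀ S : {S : MvPowerSeries (Fin 2) K // order (restr S) = n ∧ ¬ HasZero S},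
        ∃ (q N : ℕ) (m : K)
          (T : {S : MvPowerSeries (Fin 2) K // order (restr S) = n ∧ ¬ HasZero S}),
          0 < q ∧ 0 < N ∧ hnTransform 1 q 1 0 m S.1 = MvPowerSeries.X 0 ^ N * T.1 := by
      rintro ⟨S, hS, hSz⟩
      obtain ⟨p, q, p', q', N, k, m, G, hp, hq, hN, hk, hm, hp1, hle, hG, hGk⟩ :=
        exists_smaller_or_same hn hS hSz
      have hGz : ¬ HasZero G := fun h => hSz (.of_hn hp hq hm hG h)
      have hkn : n ≤ k := by
        by_contra hkn
        exact hGz (ih k (not_le.1 hkn) hk hGk)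
      obtain rfl : p = 1 := by nlinarith
      obtain ⟨rfl, rfl⟩ := hp1 rfl
      obtain rfl : k = n := by omega
      exact ⟨q, N, m, ⟨G, hGk, hGz⟩, hq, hN, hG⟩
    choose q N m next hq hN hnext using hstep
    let S : ℕ → {S : MvPowerSeries (Fin 2) K // order (restr S) = n ∧ ¬ HasZero S} :=
      fun i => next^[i] ⟨F, hF, hz⟩
    obtain ⟨s, hs⟩ := exists_chain (fun i => q (S i)) (fun i => hq _) (fun i => m (S i))
    have hs0 (i : ℕ) : constantCoeff (s i) = 0 := by
      rw [hs i]
      simp [(hq _).ne']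
    have hX0 : constantCoeff (X : PowerSeries K) = 0 := by simp
    have key (k : ℕ) : ∀ i, X ^ k ∣ evalAt X (s i) (S i).1 - 0 := by
      induction k with
      | zero => simp
      | succ k ihk =>
        intro i
        have h1 : S (i + 1) = next (S i) := Function.iterate_succ_apply' _ _ _
        have h2 := evalAt_hnTransform 1 0 (m (S i)) one_pos (hq (S i)) hX0 (hs0 (i + 1)) (S i).1
        have h3 : (s (i + 1) + C (m (S i))) ^ 1 * X ^ q (S i) = s i := by
          rw [hs i]
          ring
        rw [h3, pow_zero, one_mul, pow_one, hnext, ← h1, evalAt_X_pow_mul hX0 (hs0 _)] at h2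
        rw [← h2, sub_zero, pow_succ']
        exact mul_dvd_mul (dvd_pow_self _ (hN _).ne') (by simpa using ihk (i + 1))
    exact hz ⟨X, s 0, hX0, hs0 0, PowerSeries.X_ne_zero,
      eq_of_forall_pow_dvd_sub hX0 fun k => key k 0⟩

/-! ### Primitive parametrizations -/

lemma constantCoeff_subst_param {s : PowerSeries K} (hs : constantCoeff s = 0)
    (θ : PowerSeries K) : constantCoeff (PowerSeries.subst s θ) = constantCoeff θ := by
  have hs' := PowerSeries.HasSubst.of_constantCoeff_zero' hs
  obtain ⟨θ', h⟩ := PowerSeries.X_dvd_iff.2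
    (show constantCoeff (θ - C (constantCoeff θ)) = 0 by simp)
  have hC : PowerSeries.subst s (C (constantCoeff θ)) = C (constantCoeff θ) :=
    PowerSeries.subst_C _
  rw [sub_eq_iff_eq_add.1 h, PowerSeries.subst_add hs', PowerSeries.subst_mul hs',
    PowerSeries.subst_X hs', hC]
  simp [hs]

lemma order_subst_toNat {s : PowerSeries K} (hs : constantCoeff s = 0) (hs0 : s ≠ 0)
    (θ : PowerSeries K) :
    (order (PowerSeries.subst s θ)).toNat = (order θ).toNat * (order s).toNat ∧
      (PowerSeries.subst s θ = 0 → θ = 0) := by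
  have hs' := PowerSeries.HasSubst.of_constantCoeff_zero' hs
  by_cases hθ : θ = 0
  · rw [hθ, ← PowerSeries.coe_substAlgHom hs', map_zero]
    simp
  · obtain ⟨u, hu, h⟩ := exists_eq_X_pow_mul_unit hθ
    have h2 : PowerSeries.subst s θ = s ^ θ.order.toNat * PowerSeries.subst s u := by
      conv_lhs => rw [h]
      rw [PowerSeries.subst_mul hs', PowerSeries.subst_pow hs', PowerSeries.subst_X hs']
    have hu' : constantCoeff (PowerSeries.subst s u) ≠ 0 := by
      rwa [constantCoeff_subst_param hs]
    have h3 : IsUnit (PowerSeries.subst s u : PowerSeries K) :=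
      PowerSeries.isUnit_iff_constantCoeff.2 hu'.isUnit
    constructor
    · rw [h2, PowerSeries.order_mul, PowerSeries.order_zero_of_unit h3, add_zero,
        PowerSeries.order_pow, nsmul_eq_mul, ENat.toNat_mul, ENat.toNat_natCast]
    · intro h4
      rw [h2] at h4
      exact absurd h4 (mul_ne_zero (pow_ne_zero _ hs0) h3.ne_zero)

/-- Descent on the sum of the orders: an inner series of order at least `2` can be stripped, and it
divides both orders. A zero component counts as `0` through `toNat`. -/
lemma exists_isPrimPair {f : MvPowerSeries (Fin 2) K} {φ ψ : PowerSeries K}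
    (hφ0 : constantCoeff φ = 0) (hψ0 : constantCoeff ψ = 0) (hne : φ ≠ 0 ∨ ψ ≠ 0)
    (hz : evalAt φ ψ f = 0) :
    ∃ φ₁ ψ₁ : PowerSeries K, IsPrimPair φ₁ ψ₁ ∧ evalAt φ₁ ψ₁ f = 0 := by
  obtain ⟨n, hn⟩ : ∃ n, φ.order.toNat + ψ.order.toNat = n := ⟨_, rfl⟩
  induction n using Nat.strong_induction_on generalizing φ ψ with
  | _ n ih =>
    by_cases hprim : IsPrimPair φ ψ
    · exact ⟨φ, ψ, hprim, hz⟩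
    · obtain ⟨s, φ₁, ψ₁, hs, h1, h2, hs1⟩ : ∃ s φ₁ ψ₁ : PowerSeries K, constantCoeff s = 0 ∧
          φ = PowerSeries.subst s φ₁ ∧ ψ = PowerSeries.subst s ψ₁ ∧ order s ≠ 1 := by
        by_contra! hcon
        exact hprim ⟨hφ0, hψ0, hcon⟩
      have hφ₁ : constantCoeff φ₁ = 0 := by
        rw [← constantCoeff_subst_param hs, ← h1, hφ0]
      have hψ₁ : constantCoeff ψ₁ = 0 := by
        rw [← constantCoeff_subst_param hs, ← h2, hψ0]
      have hs' := PowerSeries.HasSubst.of_constantCoeff_zero' hs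
      have hs0 : s ≠ 0 := by
        rintro rfl
        rw [PowerSeries.subst_zero_of_constantCoeff_zero hφ₁] at h1
        rw [PowerSeries.subst_zero_of_constantCoeff_zero hψ₁] at h2
        exact hne.elim (fun h => h h1) fun h => h h2
      have hzero : PowerSeries.subst s (0 : PowerSeries K) = (0 : PowerSeries K) := by
        rw [← PowerSeries.coe_substAlgHom hs', map_zero]
      have hs2 : 2 ≤ s.order.toNat := by
        have h3 := one_le_order hs
        rw [← PowerSeries.coe_toNat_order hs0] at h3 hs1
        norm_cast at h3 hs1
        omega
      have o1 := (order_subst_toNat hs hs0 φ₁).1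
      have o2 := (order_subst_toNat hs hs0 ψ₁).1
      rw [← h1] at o1
      rw [← h2] at o2
      have hpos : 0 < φ.order.toNat + ψ.order.toNat := by
        have hpos' {θ : PowerSeries K} (h : constantCoeff θ = 0) (hθ : θ ≠ 0) :
            0 < θ.order.toNat := by
          have := one_le_order h
          rw [← PowerSeries.coe_toNat_order hθ] at this
          exact_mod_cast this
        rcases hne with h | h
        · exact Nat.add_pos_left (hpos' hφ0 h) _
        · exact Nat.add_pos_right _ (hpos' hψ0 h)
      refine ih _ ?_ hφ₁ hψ₁ ?_ ?_ rfl
      · rw [← hn, o1, o2, ← add_mul]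
        rw [o1, o2, ← add_mul] at hpos
        nlinarith [Nat.pos_of_mul_pos_right hpos]
      · refine hne.imp (fun h h' => h ?_) fun h h' => h ?_
        · rw [h1, h', hzero]
        · rw [h2, h', hzero]
      · refine (order_subst_toNat hs hs0 _).2 ?_
        rw [← subst_evalAt hφ₁ hψ₁ hs, ← h1, ← h2, hz]

lemma isPrimitiveParam_iff {f : MvPowerSeries (Fin 2) K} {φ ψ : PowerSeries K} :
    IsPrimitiveParam f φ ψ ↔ IsPrimPair φ ψ ∧ evalAt φ ψ f = 0 :=
  ⟨fun h => ⟨⟨h.fst_zero, h.snd_zero, h.primitive⟩, h.eval_eq_zero⟩,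
    fun h => ⟨h.1.fst_zero, h.1.snd_zero, h.2, h.1.primitive⟩⟩

theorem exists_isPrimitiveParam [IsAlgClosed K] {f : MvPowerSeries (Fin 2) K}
    (hf : Irreducible f) : ∃ φ ψ, IsPrimitiveParam f φ ψ := by
  simp only [isPrimitiveParam_iff]
  have hX0 : constantCoeff (X : PowerSeries K) = 0 := by simp
  by_cases h : restr f = 0
  · obtain ⟨G, rfl⟩ : MvPowerSeries.X 0 ∣ f := by
      rw [← pow_one (MvPowerSeries.X 0), X_pow_dvd_iff_rows]
      intro i hi
      rw [Nat.lt_one_iff.1 hi, ← restr_apply, h]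
    refine exists_isPrimPair (φ := 0) (ψ := X) (map_zero _) hX0 (Or.inr PowerSeries.X_ne_zero) ?_
    rw [← evalHom_apply (map_zero _) hX0, map_mul, evalHom_X_zero, zero_mul]
  · have hn := (PowerSeries.coe_toNat_order h).symm
    have h00 : constantCoeff (restr f) = 0 := by
      rw [← PowerSeries.coeff_zero_eq_constantCoeff_apply, coeff_restr]
      by_contra h0
      exact hf.not_isUnit (isUnit_iff_bcoeff.2 h0)
    obtain ⟨φ, ψ, hφ0, hψ0, hφ, hz⟩ := hasZero_of_order_eq (n := (restr f).order.toNat) (by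
      have := one_le_order h00
      rw [hn] at this
      exact_mod_cast this) hn
    exact exists_isPrimPair hφ0 hψ0 (Or.inl hφ) hz

/-! ### The semigroup of the exceptional divisor -/

/-- The submonoid `p E + b ℕ` of `ℕ`. -/
def stepMonoid (p b : ℕ) (E : AddSubmonoid ℕ) : AddSubmonoid ℕ where
  carrier := {n | ∃ e ∈ E, ∃ j, n = p * e + b * j}
  zero_mem' := ⟨0, E.zero_mem, 0, by simp⟩
  add_mem' := by
    rintro _ _ ⟨e, he, j, rfl⟩ ⟨e', he', j', rfl⟩
    exact ⟨e + e', E.add_mem he he', j + j', by ring⟩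

/-- Choose `j < p` with `b j ≡ n` modulo `p` and put `n = p e + b j`. If `e < c`, then `n ≤ p (c -
1) + b (p - 1) < b p`, because `b > c p`. -/
lemma mem_stepMonoid_of_le {p q c : ℕ} (hp : 0 < p) (hq : 0 < q) (hpq : Nat.Coprime p q)
    {E : AddSubmonoid ℕ} (hE : ∀ n, c ≤ n → n ∈ E) {n : ℕ} (hn : (q + c * p) * p ≤ n) :
    n ∈ stepMonoid p (q + c * p) E := by
  have hco : Nat.Coprime (q + c * p) p := by
    rw [Nat.coprime_add_mul_right_left]
    exact hpq.symm
  generalize hb : q + c * p = b at *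
  obtain ⟨j, hj, hjn⟩ : ∃ j < p, b * j % p = n % p := by
    obtain rfl | hp1 := (Nat.succ_le_of_lt hp).eq_or_lt
    · exact ⟨0, by simp, by simp [Nat.mod_one]⟩
    · obtain ⟨m, -, hm⟩ := Nat.exists_mul_mod_eq_one_of_coprime hco hp1
      refine ⟨n * m % p, Nat.mod_lt _ hp, ?_⟩
      rw [Nat.mul_mod, Nat.mod_mod, ← Nat.mul_mod, show b * (n * m) = n * (b * m) by ring,
        Nat.mul_mod, hm, mul_one, Nat.mod_mod]
  have hle : b * j ≤ n := (Nat.mul_le_mul_left b hj.le).trans hn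
  obtain ⟨e, he⟩ := (Nat.modEq_iff_dvd' hle).1 hjn
  refine ⟨e, hE e ?_, j, by omega⟩
  by_contra hec
  have h1 : e + 1 ≤ c := by omega
  have h2 : p * (e + 1) ≤ p * c := Nat.mul_le_mul_left p h1
  have h3 : b * (j + 1) ≤ b * p := Nat.mul_le_mul_left b hj
  have h4 : n = p * e + b * j := by omega
  nlinarith

/-- A subalgebra `A` of `K[[x, y]]` (the total transforms of the series in the original
coordinates), the semigroup `E` of the orders along `x = 0`, and a bound `c` of its conductor
which is the order of a key element. -/
structure IsStage (A : Subalgebra K (MvPowerSeries (Fin 2) K)) (E : AddSubmonoid ℕ) (c : ℕ) :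
    Prop where
  conductor : ∀ n, c ≤ n → n ∈ E
  exists_unit : ∀ e ∈ E, ∃ w, IsUnit w ∧ MvPowerSeries.X 0 ^ e * w ∈ A
  exists_key : ∃ V, MvPowerSeries.X 0 ^ c * V ∈ A ∧ bcoeff 0 0 V = 0 ∧ bcoeff 0 1 V ≠ 0
  leading : ∀ (N k : ℕ) (g : MvPowerSeries (Fin 2) K), MvPowerSeries.X 0 ^ N * g ∈ A →
    order (restr g) = k → ∃ e ∈ E, N = e + c * k

lemma isStage_top : IsStage (⊤ : Subalgebra K (MvPowerSeries (Fin 2) K)) ⊤ 0 where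
  conductor _ _ := trivial
  exists_unit _ _ := ⟨1, isUnit_one, trivial⟩
  exists_key := ⟨MvPowerSeries.X 1, trivial, by rw [← coeff_restr]; simp,
    by rw [← coeff_restr]; simp⟩
  leading N k _ _ _ := ⟨N, trivial, by simp⟩

lemma C_mem (A : Subalgebra K (MvPowerSeries (Fin 2) K)) (a : K) : MvPowerSeries.C a ∈ A := by
  rw [MvPowerSeries.c_eq_algebraMap]
  exact A.algebraMap_mem a

section Step

variable {A : Subalgebra K (MvPowerSeries (Fin 2) K)} {E : AddSubmonoid ℕ} {c : ℕ}

/-- All orders from `c` on occur in `A` with unit cofactors, so the pure powers of `x` in `V` can be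
removed one by one. -/
lemma IsStage.exists_key_of_order (hA : IsStage A E c) (L : ℕ) :
    ∃ V, MvPowerSeries.X 0 ^ c * V ∈ A ∧ bcoeff 0 1 V ≠ 0 ∧ ∀ i < L + 1, bcoeff i 0 V = 0 := by
  induction L with
  | zero =>
    obtain ⟨V, h1, h2, h3⟩ := hA.exists_key
    exact ⟨V, h1, h3, fun i hi => by rwa [Nat.lt_one_iff.1 hi]⟩
  | succ L ih =>
    obtain ⟨V, h1, h2, h3⟩ := ih
    obtain ⟨w, hw, hwA⟩ := hA.exists_unit (c + (L + 1)) (hA.conductor _ (by omega))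
    have hw0 := isUnit_iff_bcoeff.1 hw
    let θ := bcoeff (L + 1) 0 V / bcoeff 0 0 w
    have hCb (i j : ℕ) : bcoeff i j (MvPowerSeries.C θ * (MvPowerSeries.X 0 ^ (L + 1) * w)) =
        θ * bcoeff i j (MvPowerSeries.X 0 ^ (L + 1) * w) := by
      rw [bcoeff, MvPowerSeries.coeff_C_mul]
    refine ⟨V - MvPowerSeries.C θ * (MvPowerSeries.X 0 ^ (L + 1) * w), ?_, ?_, fun i hi => ?_⟩
    · have : MvPowerSeries.X 0 ^ c * (V - MvPowerSeries.C θ * (MvPowerSeries.X 0 ^ (L + 1) * w)) =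
          MvPowerSeries.X 0 ^ c * V -
            MvPowerSeries.C θ * (MvPowerSeries.X 0 ^ (c + (L + 1)) * w) := by ring
      rw [this]
      exact A.sub_mem h1 (A.mul_mem (C_mem A θ) hwA)
    · rwa [map_sub, hCb, bcoeff_X_pow_mul_of_lt L.succ_pos, mul_zero, sub_zero]
    · rw [map_sub, hCb]
      rcases (Nat.lt_succ_iff.1 hi).lt_or_eq with hi' | rfl
      · rw [h3 i hi', bcoeff_X_pow_mul_of_lt hi', mul_zero, sub_zero]
      · have := bcoeff_X_pow_mul (L + 1) 0 0 w
        rw [add_zero] at this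
        rw [this, div_mul_cancel₀ _ hw0, sub_self]

lemma eq_of_X_pow_mul_eq {N N' : ℕ} {F G : MvPowerSeries (Fin 2) K} (hF : restr F ≠ 0)
    (hG : restr G ≠ 0) (h : MvPowerSeries.X 0 ^ N * F = MvPowerSeries.X 0 ^ N' * G) :
    N = N' ∧ F = G := by
  have aux {N N' : ℕ} {F G : MvPowerSeries (Fin 2) K} (hF : restr F ≠ 0)
      (h : MvPowerSeries.X 0 ^ N * F = MvPowerSeries.X 0 ^ N' * G) : N' ≤ N := by
    by_contra hlt
    obtain ⟨d, rfl⟩ := Nat.exists_eq_add_of_lt (not_le.1 hlt)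
    rw [show N + d + 1 = N + (d + 1) by ring, pow_add, mul_assoc] at h
    apply hF
    rw [X_pow_mul_cancel h]
    simp
  obtain rfl := le_antisymm (aux hG h.symm) (aux hF h)
  exact ⟨rfl, X_pow_mul_cancel h⟩

lemma isUnit_of_order_restr_eq_zero {F : MvPowerSeries (Fin 2) K}
    (h : order (restr F) = (0 : ℕ)) : IsUnit F :=
  isUnit_iff_bcoeff.2 (order_restr_eq_iff.1 h).1

variable {p q p' q' : ℕ} (hp : 0 < p) (hq : 0 < q) (hpq : Nat.Coprime p q)
  (hdet : IsUnimodular p q p' q') {m : K} (hm : m ≠ 0)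

include hp hq in
-- Once the powers of `x` up to `x ^ q` are absent, `y` is the only possible monomial of weight at
-- most `q`. So the key element acquires order `q + c p` with a unit cofactor.
lemma exists_hnTransform_key {V : MvPowerSeries (Fin 2) K}
    (h2 : ∀ i < q + 1, bcoeff i 0 V = 0) :
    ∃ G, hnTransform p q p' q' m V = MvPowerSeries.X 0 ^ q * G ∧
      restr G = C (bcoeff 0 1 V) * (X + C m) ^ p' := by
  obtain ⟨G, hG, hr⟩ := exists_hnTransform_eq hp hq (p' := p') (q' := q') (N := q) (F := V) m
    fun i j hij => by
      have hj : j = 0 := by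
        by_contra hj
        have := Nat.le_mul_of_pos_right q (Nat.pos_of_ne_zero hj)
        omega
      subst hj
      have := Nat.le_mul_of_pos_left i hp
      exact h2 _ (by omega)
  refine ⟨G, hG, ?_⟩
  have hs : slice p q p' q' q V = Polynomial.monomial p' (bcoeff 0 1 V) := by
    rw [slice, Finset.sum_eq_single (0, 1)]
    · simp
    · rintro ⟨i, j⟩ ha hne
      have hij := (Finset.mem_filter.1 ha).2
      simp only at hij hne ⊢
      have hj : j = 0 := by
        by_contra hj
        obtain hj1 | hj1 : j = 1 ∨ 2 ≤ j := by omega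
        · subst hj1
          have : p * i = 0 := by omega
          exact hne (Prod.ext ((Nat.mul_eq_zero.1 this).resolve_left hp.ne') rfl)
        · have := Nat.mul_le_mul_left q hj1
          omega
      subst hj
      have := Nat.le_mul_of_pos_left i hp
      rw [h2 _ (by omega), map_zero]
    · intro h
      simp only [Finset.mem_filter, Finset.mem_product, Finset.mem_range] at h
      omega
  rw [hr, coeff_rows_hnTransform p' q' m hp hq, hs]
  simp

include hp hq in
lemma restr_hnTransform (w : MvPowerSeries (Fin 2) K) :
    restr (hnTransform p q p' q' m w) = C (bcoeff 0 0 w) := by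
  have hs : slice p q p' q' 0 w = Polynomial.C (bcoeff 0 0 w) := by
    rw [slice, Finset.sum_eq_single (0, 0)]
    · simp
    · rintro ⟨i, j⟩ ha hne
      have := (Finset.mem_filter.1 ha).1
      simp at this
      exact absurd (Prod.ext this.1 this.2) hne
    · simp
  rw [restr_apply, coeff_rows_hnTransform p' q' m hp hq, hs]
  simp

include hdet hm in
-- The exponents differ by one, so `θ` can be chosen to produce a simple zero at the new origin, as
-- a key element requires.
lemma exists_difference (α β : K) (hα : α ≠ 0) (hβ : β ≠ 0) : ∃ (θ : K) (a : PowerSeries K),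
    constantCoeff a ≠ 0 ∧
    C α * (X + C m) ^ (p * p') - C (θ * β) * (X + C m) ^ (q * q') = X * a := by
  have hu : constantCoeff (X + C m : PowerSeries K) ≠ 0 := by simpa using hm
  rcases hdet with h | h
  · refine ⟨α * m / β, C α * (X + C m) ^ (q * q'), ?_, ?_⟩
    · rw [map_mul, map_pow]
      exact mul_ne_zero (by simpa using hα) (pow_ne_zero _ hu)
    · rw [h, div_mul_cancel₀ _ hβ, map_mul]
      ring
  · refine ⟨α / m / β, C (-(α / m)) * (X + C m) ^ (p * p'), ?_, ?_⟩
    · rw [map_mul, map_pow]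
      refine mul_ne_zero ?_ (pow_ne_zero _ hu)
      simpa using ⟨hα, hm⟩
    · rw [h, div_mul_cancel₀ _ hβ, map_neg]
      have : (C α : PowerSeries K) = C (α / m) * C m := by rw [← map_mul, div_mul_cancel₀ _ hm]
      rw [this]
      ring

include hpq hdet hm in
/-- The semigroup of the exceptional divisor of a Hamburger-Noether transform. -/
theorem IsStage.step (hA : IsStage A E c) :
    IsStage (A.map (hnHom p' q' m hp hq)) (stepMonoid p (q + c * p) E) ((q + c * p) * p) := by
  have hu := isUnit_X_add_C hm
  have hmem {F : MvPowerSeries (Fin 2) K} (hF : F ∈ A) :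
      hnTransform p q p' q' m F ∈ A.map (hnHom p' q' m hp hq) :=
    ⟨F, hF, hnHom_apply p' q' m hp hq F⟩
  have htr (e : ℕ) (F : MvPowerSeries (Fin 2) K) :
      hnTransform p q p' q' m (MvPowerSeries.X 0 ^ e * F) = MvPowerSeries.X 0 ^ (p * e) *
        ((MvPowerSeries.X 1 + MvPowerSeries.C m) ^ (q' * e) * hnTransform p q p' q' m F) := by
    rw [← hnHom_apply p' q' m hp hq, map_mul, map_pow, hnHom_X_zero, hnHom_apply]
    ring
  obtain ⟨V, hV, hV1, hV0⟩ := hA.exists_key_of_order q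
  obtain ⟨G, hG, hrG⟩ := exists_hnTransform_key (p' := p') (q' := q') (m := m) hp hq hV0
  have hκ : hnTransform p q p' q' m (MvPowerSeries.X 0 ^ c * V) =
      MvPowerSeries.X 0 ^ (q + c * p) *
        ((MvPowerSeries.X 1 + MvPowerSeries.C m) ^ (q' * c) * G) := by
    rw [htr, hG]
    ring
  have hGu : IsUnit G := by
    rw [isUnit_iff_bcoeff, ← coeff_restr, hrG]
    simp [hV1, hm]
  refine ⟨fun n hn => mem_stepMonoid_of_le hp hq hpq hA.conductor hn, ?_, ?_, ?_⟩
  · rintro _ ⟨e, he, j, rfl⟩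
    obtain ⟨w, hw, hwA⟩ := hA.exists_unit e he
    refine ⟨(MvPowerSeries.X 1 + MvPowerSeries.C m) ^ (q' * e) * hnTransform p q p' q' m w *
      ((MvPowerSeries.X 1 + MvPowerSeries.C m) ^ (q' * c) * G) ^ j,
      ((hu.pow _).mul ?_).mul (((hu.pow _).mul hGu).pow _), ?_⟩
    · rw [← hnHom_apply p' q' m hp hq]
      exact hw.map _
    · have h1 := hmem hwA
      have h2 := hmem hV
      rw [htr] at h1
      rw [hκ] at h2
      have h3 := Subalgebra.mul_mem _ h1 (Subalgebra.pow_mem _ h2 j)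
      convert! h3 using 1
      ring
  -- The new key compares two elements of the same new order `b p`: the `p`-th power of the old key
  -- and an element of old order `b = q + c p`, which exists because `b ≥ c`.
  · obtain ⟨w, hw, hwA⟩ := hA.exists_unit (q + c * p)
      (hA.conductor _ (by nlinarith))
    obtain ⟨θ, a, ha, hθ⟩ := exists_difference hdet hm (bcoeff 0 1 V ^ p) (bcoeff 0 0 w)
      (pow_ne_zero _ hV1) (isUnit_iff_bcoeff.1 hw)
    have h1 := hmem hwA
    have h2 := hmem hV
    rw [htr] at h1
    rw [hκ] at h2
    have h3 := Subalgebra.sub_mem _ (Subalgebra.pow_mem _ h2 p)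
      (Subalgebra.mul_mem _ (C_mem _ θ) h1)
    let V' := ((MvPowerSeries.X 1 + MvPowerSeries.C m) ^ (q' * c) * G) ^ p -
      MvPowerSeries.C θ * ((MvPowerSeries.X 1 + MvPowerSeries.C m) ^ (q' * (q + c * p)) *
        hnTransform p q p' q' m w)
    have hrV : restr V' = X * ((X + C m) ^ (q' * c * p) * a) := by
      simp only [V', map_sub, map_mul, map_pow, map_add, restr_X_one, restr_C, hrG,
        restr_hnTransform hp hq]
      simp only [map_mul, map_pow] at hθ
      linear_combination (X + C m) ^ (q' * c * p) * hθ
    refine ⟨V', ?_, ?_, ?_⟩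
    · convert! h3 using 1
      simp only [V']
      ring
    · rw [← coeff_restr, hrV]
      simp
    · rw [← coeff_restr, hrV, show (1 : ℕ) = 0 + 1 from rfl, PowerSeries.coeff_succ_X_mul,
        PowerSeries.coeff_zero_eq_constantCoeff_apply, map_mul, map_pow]
      exact mul_ne_zero (pow_ne_zero _ (by simpa using hm)) ha
  · intro N k g hg hk
    obtain ⟨F, hF, hFg⟩ := hg
    change hnHom p' q' m hp hq F = _ at hFg
    rw [hnHom_apply] at hFg
    have hrg : restr g ≠ 0 := by
      intro h
      simp [h] at hk
    have hF0 : F ≠ 0 := by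
      rintro rfl
      rw [← hnHom_apply p' q' m hp hq, map_zero, ← mul_zero (MvPowerSeries.X 0 ^ N)] at hFg
      rw [← X_pow_mul_cancel hFg, map_zero] at hrg
      exact hrg rfl
    obtain ⟨N', hN', hlt⟩ := exists_weight hF0 p q
    obtain ⟨g', hg', hr⟩ := exists_hnTransform_eq hp hq (p' := p') (q' := q') m hlt
    obtain ⟨rfl, rfl⟩ := eq_of_X_pow_mul_eq (hr ▸ row_ne_zero hp hq hdet hm hN') hrg
      (hg'.symm.trans hFg)
    have hdvd : X ^ k ∣ coeff N' (rows (hnTransform p q p' q' m F)) := by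
      rw [← hr, PowerSeries.X_pow_dvd_iff]
      exact fun j hj => PowerSeries.coeff_of_lt_order _ (by rw [hk]; exact_mod_cast hj)
    obtain ⟨i₀, j₀, hne, hw, hj⟩ := exists_support_of_strict hp hq hdet hm hN' hdvd
    obtain ⟨N₀, g₀, hF₀, hrg₀⟩ := exists_eq_X_pow_mul hF0
    have hk₀ := (PowerSeries.coe_toNat_order hrg₀).symm
    generalize (restr g₀).order.toNat = k₀ at hk₀
    obtain ⟨e₀, he₀, hN₀⟩ := hA.leading N₀ k₀ g₀ (hF₀ ▸ hF) hk₀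
    have hi₀ : N₀ ≤ i₀ := by
      by_contra hlt'
      rw [hF₀] at hne
      exact hne (bcoeff_X_pow_mul_of_lt (not_le.1 hlt') _ _)
    have hvert : N' ≤ p * N₀ + q * k₀ := by
      by_contra hlt'
      have h := hlt _ _ (not_le.1 hlt')
      rw [hF₀] at h
      have h' := bcoeff_X_pow_mul N₀ 0 k₀ g₀
      rw [add_zero] at h'
      rw [h'] at h
      exact (order_restr_eq_iff.1 hk₀).1 h
    -- With `F = x ^ N₀ g₀` and `k₀ = ord g₀(0, y)`, a face point above height `k₀` is excluded. At
    -- height `k₀` it is the vertex and `IsStage.leading` applies. Below it, `i₀ ≥ N₀ ≥ c (j₀ + 1)`,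
    -- so `i₀ - c j₀` lies beyond the conductor bound.
    obtain ⟨e, he, hie⟩ : ∃ e ∈ E, i₀ = e + c * j₀ := by
      have hpi := Nat.mul_le_mul_left p hi₀
      rcases lt_trichotomy j₀ k₀ with h | h | h
      · have h5 : c * (j₀ + 1) ≤ c * k₀ := Nat.mul_le_mul_left c h
        have h6 : c * (j₀ + 1) = c * j₀ + c := by ring
        exact ⟨i₀ - c * j₀, hA.conductor _ (by omega), by omega⟩
      · subst h
        have : i₀ ≤ N₀ := Nat.le_of_mul_le_mul_left (by omega) hp
        exact ⟨e₀, he₀, by omega⟩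
      · have := Nat.mul_lt_mul_of_pos_left h hq
        omega
    obtain ⟨d, rfl⟩ := Nat.exists_eq_add_of_le hj
    refine ⟨p * e + (q + c * p) * d, ⟨e, he, d, rfl⟩, ?_⟩
    rw [← hw, hie]
    ring

/-- The semigroup of the values of the elements of `A`. -/
def valueSet (A : Subalgebra K (MvPowerSeries (Fin 2) K)) (φ ψ : PowerSeries K) : Set ℕ :=
  {n | ∃ G ∈ A, order (evalAt φ ψ G) = (n : ℕ∞)}

lemma valueSet_map {χ υ : PowerSeries K} (hχ0 : constantCoeff χ = 0) (hυ0 : constantCoeff υ = 0) :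
    valueSet (A.map (hnHom p' q' m hp hq)) χ υ =
      valueSet A ((υ + C m) ^ q' * χ ^ p) ((υ + C m) ^ p' * χ ^ q) := by
  ext n
  constructor
  · rintro ⟨_, ⟨G, hG, rfl⟩, h⟩
    refine ⟨G, hG, ?_⟩
    rw [← evalAt_hnTransform p' q' m hp hq hχ0 hυ0, ← hnHom_apply p' q' m hp hq]
    exact h
  · rintro ⟨G, hG, h⟩
    refine ⟨hnHom p' q' m hp hq G, ⟨G, hG, rfl⟩, ?_⟩
    rwa [hnHom_apply, evalAt_hnTransform p' q' m hp hq hχ0 hυ0]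

lemma order_evalAt_of_isUnit {φ ψ : PowerSeries K} (hφ0 : constantCoeff φ = 0)
    (hψ0 : constantCoeff ψ = 0) {w : MvPowerSeries (Fin 2) K} (hw : IsUnit w) :
    order (evalAt φ ψ w) = 0 := by
  rw [← evalHom_apply hφ0 hψ0]
  exact PowerSeries.order_zero_of_unit (hw.map _)

/-- Write an element of `A` as `x ^ N g`. If `g` is a unit, its value is `N`, which lies in `E`.
Otherwise `N ≥ c`, and every finite value is beyond the conductor bound. -/
theorem IsStage.valueSet_eq (hA : IsStage A E c) {φ ψ : PowerSeries K} (hφ : order φ = 1)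
    (hψ0 : constantCoeff ψ = 0) : valueSet A φ ψ = E := by
  have hφ0 := PowerSeries.one_le_order_iff_constCoeff_eq_zero.1 hφ.ge
  have hX (N : ℕ) (g : MvPowerSeries (Fin 2) K) :
      order (evalAt φ ψ (MvPowerSeries.X 0 ^ N * g)) = N + order (evalAt φ ψ g) := by
    rw [evalAt_X_pow_mul hφ0 hψ0, PowerSeries.order_mul, PowerSeries.order_pow, hφ, nsmul_eq_mul,
      mul_one]
  ext n
  constructor
  · rintro ⟨G, hG, hn⟩
    have hG0 : G ≠ 0 := by
      rintro rfl
      rw [← evalHom_apply hφ0 hψ0, map_zero] at hn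
      simp at hn
    obtain ⟨N, g, rfl, hg⟩ := exists_eq_X_pow_mul hG0
    have hk := (PowerSeries.coe_toNat_order hg).symm
    generalize (restr g).order.toNat = k at hk
    obtain ⟨e, he, hN⟩ := hA.leading N k g hG hk
    rw [hX] at hn
    rcases Nat.eq_zero_or_pos k with rfl | hk0
    · rw [order_evalAt_of_isUnit hφ0 hψ0 (isUnit_of_order_restr_eq_zero hk), add_zero] at hn
      have : N = n := by exact_mod_cast hn
      rw [← this, hN, mul_zero, add_zero]
      exact he
    · refine hA.conductor n ?_
      have h1 : (N : ℕ∞) ≤ n := hn ▸ le_self_add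
      have h2 : N ≤ n := by exact_mod_cast h1
      have := Nat.le_mul_of_pos_right c hk0
      omega
  · intro hn
    obtain ⟨w, hw, hwA⟩ := hA.exists_unit n hn
    exact ⟨_, hwA, by rw [hX, order_evalAt_of_isUnit hφ0 hψ0 hw, add_zero]⟩

end Step

/-! ### The stages of the algorithm -/

/-- `F` is, up to a power of `x`, a minimal equation of the branch parametrized by `(φ, ψ)`. -/
structure IsBranchAt (F : MvPowerSeries (Fin 2) K) (c n : ℕ) (φ ψ : PowerSeries K) : Prop where
  prim : IsPrimPair φ ψ
  order_eq : order φ = n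
  exists_minimal : ∃ h, IsMinimalFor h φ ψ ∧ F = MvPowerSeries.X 0 ^ (c * n) * h

lemma IsUnimodular.coprime {p q p' q' : ℕ} (h : IsUnimodular p q p' q') : Nat.Coprime p q := by
  refine Nat.coprime_of_dvd fun k hk hp hq => hk.one_lt.ne' (Nat.dvd_one.1 ?_)
  rcases h with h | h
  · exact (Nat.dvd_add_right (hq.mul_right q')).1 (h ▸ hp.mul_right p')
  · exact (Nat.dvd_add_right (hp.mul_right p')).1 (h ▸ hq.mul_right q')

lemma IsUnimodular.exists_isHNData {p q p' q' : ℕ} (h : IsUnimodular p q p' q') {m : K}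
    (hm : m ≠ 0) : ∃ μ, μ ≠ 0 ∧ IsHNData p q p' q' μ m :=
  h.elim (fun h => ⟨m⁻¹, inv_ne_zero hm, Or.inl ⟨h, (inv_inv m).symm⟩⟩)
    fun h => ⟨m, hm, Or.inr ⟨h, rfl⟩⟩

lemma ne_zero_of_order_eq {φ : PowerSeries K} {n : ℕ} (h : order φ = n) : φ ≠ 0 := by
  rintro rfl
  simp at h

lemma IsBranchAt.pos {F : MvPowerSeries (Fin 2) K} {c n : ℕ} {φ ψ : PowerSeries K}
    (h : IsBranchAt F c n φ ψ) : 0 < n := by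
  have := one_le_order h.prim.fst_zero
  rw [h.order_eq] at this
  exact_mod_cast this

/-- The factor `x ^ (c n)` and the face of the minimal series together have weight `p c n + p q ν =
p (q + c p) ν`. This is the multiplicity of the vertex and the power of `X` in the new total
transform. -/
lemma IsBranchAt.of_hn {F : MvPowerSeries (Fin 2) K} {c n p q p' q' : ℕ} {μ m : K}
    {χ υ : PowerSeries K} (hp : 0 < p) (hq : 0 < q) (hμ : μ ≠ 0) (hd : IsHNData p q p' q' μ m)
    (hχ0 : constantCoeff χ = 0) (hχ : χ ≠ 0) (hυ0 : constantCoeff υ = 0)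
    (h : IsBranchAt F c n ((υ + C m) ^ q' * χ ^ p) ((υ + C m) ^ p' * χ ^ q)) :
    ∃ ν, n = p * ν ∧ IsOnlyEdgeRoot F p q (p * ((q + c * p) * ν)) μ ν ∧
      IsBranchAt (hnTransform p q p' q' m F) ((q + c * p) * p) ν χ υ := by
  obtain ⟨hprim, hn, g, hmin, rfl⟩ := h
  have hm := hd.ne_zero hμ
  have hprim' := hprim.of_hn hχ0 hυ0
  have hχν := (PowerSeries.coe_toNat_order hχ).symm
  generalize χ.order.toNat = ν at hχν
  have hν : 0 < ν := by
    have := one_le_order hχ0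
    rw [hχν] at this
    exact_mod_cast this
  have hnν : n = p * ν := by
    rw [order_hn hυ0 hm, hχν] at hn
    exact_mod_cast hn.symm
  obtain ⟨hlt, ⟨a, ha, hface⟩, G, hG, hGmin⟩ :=
    hmin.face hp hq hμ hd (hprim'.resolves hχ) hχν
  refine ⟨ν, hnν, ?_, hprim', hχν,
    (MvPowerSeries.X 1 + MvPowerSeries.C m) ^ (q' * (c * n)) * G, ⟨?_, ?_⟩, ?_⟩
  · have := isOnlyEdgeRoot_of_face (M := c * n) hp hq hν hd.isUnimodular.coprime hμ ha hlt hface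
    rwa [hnν, show p * (c * (p * ν)) + p * q * ν = p * ((q + c * p) * ν) by ring, ← hnν] at this
  · rw [evalAt_mul hχ0 hυ0, hGmin.eval_eq_zero, mul_zero]
  · have : IsUnit (restr ((MvPowerSeries.X 1 + MvPowerSeries.C m : MvPowerSeries (Fin 2) K) ^
        (q' * (c * n)))) := ((isUnit_X_add_C hm).pow _).map _
    rw [map_mul, PowerSeries.order_mul, PowerSeries.order_zero_of_unit this, zero_add,
      hGmin.order_eq]
  · rw [← hnHom_apply p' q' m hp hq, map_mul, map_pow, hnHom_X_zero, hnHom_apply, hG, hnν]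
    ring

/-- The edge and root depend only on the leading terms of the pair; the new pair exists for every
admissible choice of `p'`, `q'`, `m`, since the algorithm leaves this choice open. -/
lemma IsBranchAt.exists_edge {F : MvPowerSeries (Fin 2) K} {c n : ℕ} {φ ψ : PowerSeries K}
    (h : IsBranchAt F c n φ ψ) (hψ : ψ ≠ 0) :
    ∃ p q μ ν, n = p * ν ∧ IsOnlyEdgeRoot F p q (p * ((q + c * p) * ν)) μ ν ∧
      ∀ p' q' m, IsHNData p q p' q' μ m → ∃ χ υ, φ = (υ + C m) ^ q' * χ ^ p ∧
        ψ = (υ + C m) ^ p' * χ ^ q ∧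
        IsBranchAt (hnTransform p q p' q' m F) ((q + c * p) * p) ν χ υ := by
  obtain ⟨p, q, ν, u, v, hp, hq, hν, hpq, hu, hv, hφu, hψv⟩ :=
    exists_leading_terms h.prim.fst_zero h.prim.snd_zero (ne_zero_of_order_eq h.order_eq) hψ
  have hμ : constantCoeff u ^ q / constantCoeff v ^ p ≠ 0 :=
    div_ne_zero (pow_ne_zero _ hu) (pow_ne_zero _ hv)
  have aux {p' q' : ℕ} {m : K}
      (hd : IsHNData p q p' q' (constantCoeff u ^ q / constantCoeff v ^ p) m) :
      n = p * ν ∧ IsOnlyEdgeRoot F p q (p * ((q + c * p) * ν))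
        (constantCoeff u ^ q / constantCoeff v ^ p) ν ∧ ∃ χ υ, φ = (υ + C m) ^ q' * χ ^ p ∧
        ψ = (υ + C m) ^ p' * χ ^ q ∧
        IsBranchAt (hnTransform p q p' q' m F) ((q + c * p) * p) ν χ υ := by
    obtain ⟨χ, υ, hχ, hυ, h1, h2⟩ := exists_hn_preimage (ν := ν) hu hv hd
    rw [← hφu] at h1
    rw [← hψv] at h2
    have h' := h
    rw [h1, h2] at h'
    have hχ0 : constantCoeff χ = 0 := by
      rw [← PowerSeries.one_le_order_iff_constCoeff_eq_zero, hχ]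
      exact_mod_cast hν
    obtain ⟨ν', hn, he, hb⟩ := h'.of_hn hp hq hμ hd hχ0 (ne_zero_of_order_eq hχ) hυ
    obtain rfl : ν = ν' := by exact_mod_cast hχ.symm.trans hb.order_eq
    exact ⟨hn, he, χ, υ, h1, h2, hb⟩
  obtain ⟨p', q', hd⟩ := exists_isHNData hp hq hpq (constantCoeff u ^ q / constantCoeff v ^ p)
  exact ⟨p, q, _, ν, (aux hd).1, (aux hd).2.1, fun p' q' m hd => (aux hd).2.2⟩

lemma IsEdgeRoot.unique {F : MvPowerSeries (Fin 2) K} {p q N ν N₁ ν₁ : ℕ} {μ : K}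
    (h : IsEdgeRoot F p q N μ ν) (h₁ : IsEdgeRoot F p q N₁ μ ν₁) : N = N₁ ∧ ν = ν₁ := by
  have hN : N = N₁ := by exact_mod_cast h.order_eq.symm.trans h₁.order_eq
  subst hN
  refine ⟨rfl, le_antisymm ?_ ?_⟩ <;> by_contra hlt
  · exact h₁.not_dvd ((pow_dvd_pow _ (not_le.1 hlt)).trans h.dvd)
  · exact h.not_dvd ((pow_dvd_pow _ (not_le.1 hlt)).trans h₁.dvd)

/-- The data of a stage of the algorithm, read off from the branch. -/
theorem IsBranchAt.step {F : MvPowerSeries (Fin 2) K} {c n : ℕ} {φ ψ : PowerSeries K}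
    (h : IsBranchAt F c n φ ψ) (hψ : ψ ≠ 0) {p q N ν : ℕ} {μ : K}
    (he : IsOnlyEdgeRoot F p q N μ ν) : n = p * ν ∧ N = p * ((q + c * p) * ν) ∧
      ∀ p' q' m, IsHNData p q p' q' μ m → ∃ χ υ, φ = (υ + C m) ^ q' * χ ^ p ∧
        ψ = (υ + C m) ^ p' * χ ^ q ∧
        IsBranchAt (hnTransform p q p' q' m F) ((q + c * p) * p) ν χ υ := by
  obtain ⟨p₁, q₁, μ₁, ν₁, hn, he₁, hb⟩ := h.exists_edge hψ
  obtain ⟨rfl, rfl, rfl⟩ := he.only _ _ _ _ _ he₁.isEdgeRoot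
  obtain ⟨rfl, rfl⟩ := he.isEdgeRoot.unique he₁.isEdgeRoot
  exact ⟨hn, rfl, hb⟩

lemma IsBranchAt.snd_ne_zero {F : MvPowerSeries (Fin 2) K} {c n : ℕ} {φ ψ : PowerSeries K}
    (h : IsBranchAt F c n φ ψ) (hn : 1 < n) : ψ ≠ 0 := by
  rintro rfl
  have h1 := h.order_eq.symm.trans h.prim.order_eq_one_of_snd_eq_zero
  have h2 : n = 1 := by exact_mod_cast h1
  omega

/-- The algorithm stops. -/
theorem IsBranchAt.exists_isGlued {F : MvPowerSeries (Fin 2) K} {c n : ℕ} {φ ψ : PowerSeries K}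
    (h : IsBranchAt F c n φ ψ) (hψ : ψ ≠ 0) : ∃ T, IsGlued F c T := by
  induction h.prim.resolves (ne_zero_of_order_eq h.order_eq) generalizing F c n with
  | base φ ψ hφ _ =>
    obtain ⟨p, q, μ, ν, hn, he, -⟩ := h.exists_edge hψ
    have hn1 : n = 1 := by exact_mod_cast h.order_eq.symm.trans hφ
    obtain rfl := Nat.eq_one_of_mul_eq_one_left (hn.symm.trans hn1)
    exact ⟨_, .last F c p q _ μ he⟩
  | step p q p' q' m χ υ hp hq hdet hm hr ih =>
    obtain ⟨μ, hμ, hd⟩ := hdet.exists_isHNData hm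
    obtain ⟨hχ0, hυ0, hχ, -⟩ := hr.zero_ne
    obtain ⟨ν, -, he, hb⟩ := h.of_hn hp hq hμ hd hχ0 hχ hυ0
    rcases (Nat.succ_le_of_lt hb.pos).eq_or_lt with rfl | hν
    · exact ⟨_, .last F c p q _ μ he⟩
    · obtain ⟨T, hT⟩ := ih hb (hb.snd_ne_zero hν)
      exact ⟨_, .step F c p q _ μ ν he hν p' q' m hd T hT⟩

/-! ### The minimal tree -/

/-- The vertices that are not erased. -/
def core (T : LinTree) : LinTree :=
  T.filter fun w => decide (w.a ≠ none ∧ w.a ≠ some 1 ∧ w.b ≠ 1)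

lemma core_append (L R : LinTree) : core (L ++ R) = core L ++ core R := List.filter_append ..

lemma core_cons_of_pos {w : Vertex} (h : w.a ≠ none ∧ w.a ≠ some 1 ∧ w.b ≠ 1) (T : LinTree) :
    core (w :: T) = w :: core T := List.filter_cons_of_pos (by simpa using h)

lemma core_cons_of_neg {w : Vertex} (h : ¬ (w.a ≠ none ∧ w.a ≠ some 1 ∧ w.b ≠ 1)) (T : LinTree) :
    core (w :: T) = core T := List.filter_cons_of_neg (by simpa using h)

/-- Each operation acts on one vertex that fails the test of `core` and leaves it failing or removes
it. -/
lemma core_eq_of_erase {T T₁ : LinTree} (h : Erase T T₁) : core T₁ = core T := by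
  cases h with
  | deadEnd L R N b =>
    rw [core_append, core_append, core_cons_of_neg (by simp), core_cons_of_neg (by simp)]
  | leftEnd R N a => rw [core_cons_of_neg (by simp), core_cons_of_neg (by simp)]
  | vertex L R N b => rw [core_append, core_append, core_cons_of_neg (w := ⟨N, b, none⟩) (by simp)]

/-- The decorations above the edges between two vertices are different from `1`. -/
def IsAdmissible (T : LinTree) : Prop := ∀ w ∈ T.tail, w.b ≠ 1

lemma IsAdmissible.erase {T T₁ : LinTree} (hT : IsAdmissible T) (h : Erase T T₁) :
    IsAdmissible T₁ := by
  cases h with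
  | deadEnd L R N b =>
    cases L with
    | nil => exact hT
    | cons w L =>
      intro v hv
      simp only [List.cons_append, List.tail_cons, List.mem_append, List.mem_cons] at hv
      rcases hv with hv | rfl | hv
      · exact hT v (by simp [hv])
      · exact hT ⟨N, b, some 1⟩ (by simp)
      · exact hT v (by simp [hv])
  | leftEnd R N a => exact hT
  | vertex L R N b =>
    intro v hv
    cases L with
    | nil => exact hT v (List.mem_of_mem_tail hv)
    | cons w L =>
      simp only [List.cons_append, List.tail_cons, List.mem_append] at hv
      exact hT v (by rcases hv with hv | hv <;> simp [hv])

lemma IsAdmissible.reflTransGen {T T₁ : LinTree} (hT : IsAdmissible T)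
    (h : Relation.ReflTransGen Erase T T₁) : IsAdmissible T₁ ∧ core T₁ = core T := by
  induction h with
  | refl => exact ⟨hT, rfl⟩
  | tail _ h ih => exact ⟨ih.1.erase h, (core_eq_of_erase h).trans ih.2⟩

/-- A vertex outside `core` always admits an operation: a left decoration `1` can occur only at the
first vertex, where `leftEnd` or `vertex` applies. -/
lemma IsAdmissible.core_eq_self {T : LinTree} (hT : IsAdmissible T) (h : ∀ T₁, ¬ Erase T T₁) :
    core T = T := by
  refine List.filter_eq_self.2 fun w hw => decide_eq_true ?_
  obtain ⟨L, R, rfl⟩ := List.append_of_mem hw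
  obtain ⟨N, b, a⟩ := w
  refine ⟨?_, ?_, ?_⟩
  · rintro rfl
    exact h _ (.vertex L R N b)
  · rintro rfl
    exact h _ (.deadEnd L R N b)
  · rintro rfl
    cases L with
    | nil =>
      cases a with
      | none => exact h _ (.vertex [] R N 1)
      | some a => exact h _ (.leftEnd R N a)
    | cons v L => exact hT ⟨N, 1, a⟩ (by simp) rfl

/-- The numbers of vertices and of dead ends below them. -/
def size (T : LinTree) : ℕ := (T.map fun w => 1 + w.a.elim 0 fun _ => 1).sum

lemma size_lt_of_erase {T T₁ : LinTree} (h : Erase T T₁) : size T₁ < size T := by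
  cases h <;> simp [size]

lemma exists_normal_form (T : LinTree) :
    ∃ T₁, Relation.ReflTransGen Erase T T₁ ∧ ∀ T₂, ¬ Erase T₁ T₂ := by
  induction hn : size T using Nat.strong_induction_on generalizing T with
  | _ n ih =>
    by_cases h : ∃ T₁, Erase T T₁
    · obtain ⟨T₁, h₁⟩ := h
      obtain ⟨T₂, h₂, h₃⟩ := ih _ (hn ▸ size_lt_of_erase h₁) T₁ rfl
      exact ⟨T₂, .head h₁ h₂, h₃⟩
    · exact ⟨T, .refl, not_exists.1 h⟩

/-! ### The semigroup of a tree -/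

/-- The values `N / a` at the dead ends below the vertices of `T`. -/
def deadEndValues (T : LinTree) : Set ℕ := {v | v ∈ T.filterMap fun u => u.a.map fun a => u.N / a}

lemma deadEndValues_nil : deadEndValues [] = ∅ := by simp [deadEndValues]

lemma deadEndValues_cons (N b a : ℕ) (T : LinTree) :
    deadEndValues (⟨N, b, some a⟩ :: T) = insert (N / a) (deadEndValues T) := by
  ext v
  simp [deadEndValues]

/-- The set of the multiples `n e`, `e ∈ E`. -/
def multiples (n : ℕ) (E : AddSubmonoid ℕ) : Set ℕ := {v | ∃ e ∈ E, v = n * e}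

/-- One stage unrolled: the new generator `b ν` is the value `N / a` at the dead end of the vertex.
-/
lemma closure_multiples_stepMonoid (p b ν : ℕ) (E : AddSubmonoid ℕ) (S : Set ℕ) :
    AddSubmonoid.closure (multiples ν (stepMonoid p b E) ∪ S) =
      AddSubmonoid.closure (multiples (p * ν) E ∪ insert (b * ν) S) := by
  refine le_antisymm (AddSubmonoid.closure_le.2 ?_) (AddSubmonoid.closure_le.2 ?_)
  · rintro _ (⟨_, ⟨e, he, j, rfl⟩, rfl⟩ | hv)
    · have h1 : p * ν * e ∈ AddSubmonoid.closure (multiples (p * ν) E ∪ insert (b * ν) S) :=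
        AddSubmonoid.subset_closure (Or.inl ⟨e, he, rfl⟩)
      have h2 : b * ν ∈ AddSubmonoid.closure (multiples (p * ν) E ∪ insert (b * ν) S) :=
        AddSubmonoid.subset_closure (Or.inr (Set.mem_insert _ _))
      have h3 := add_mem h1 (nsmul_mem h2 j)
      rwa [smul_eq_mul, show p * ν * e + j * (b * ν) = ν * (p * e + b * j) by ring] at h3
    · exact AddSubmonoid.subset_closure (Or.inr (Set.mem_insert_of_mem _ hv))
  · rintro _ (⟨e, he, rfl⟩ | rfl | hv)
    · exact AddSubmonoid.subset_closure (Or.inl ⟨p * e, ⟨e, he, 0, by ring⟩, by ring⟩)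
    · exact AddSubmonoid.subset_closure (Or.inl ⟨b, ⟨0, E.zero_mem, 1, by ring⟩, by ring⟩)
    · exact AddSubmonoid.subset_closure (Or.inr hv)

/-- The reason why a vertex with dead end decoration `1` may be erased. -/
lemma stepMonoid_one {b : ℕ} {E : AddSubmonoid ℕ} (hb : b ∈ E) : stepMonoid 1 b E = E := by
  ext v
  constructor
  · rintro ⟨e, he, j, rfl⟩
    rw [one_mul, mul_comm, ← smul_eq_mul]
    exact add_mem he (nsmul_mem hb j)
  · exact fun hv => ⟨v, hv, 0, by ring⟩

lemma stepMonoid_top {p b : ℕ} (h : p = 1 ∨ b = 1) : stepMonoid p b ⊤ = ⊤ := by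
  rw [eq_top_iff]
  rintro v -
  rcases h with rfl | rfl
  · exact ⟨v, trivial, 0, by ring⟩
  · exact ⟨0, trivial, v, by ring⟩

/-- `S` is generated by `n E` and the values at the remaining dead ends of the tree `T`, in which
`n` is the value at the left end. -/
structure Generates (T : LinTree) (n : ℕ) (E : AddSubmonoid ℕ) (S : Set ℕ) : Prop where
  closure_eq : (AddSubmonoid.closure (multiples n E ∪ deadEndValues (core T)) : Set ℕ) = S
  eq_one : core T = [] → n = 1
  head_eq : ∀ w R, core T = w :: R → w.N / w.b = n

lemma Generates.nil {E : AddSubmonoid ℕ} {S : Set ℕ} (h : S = E) : Generates [] 1 E S where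
  closure_eq := by
    have : multiples 1 E = E := by
      ext v
      simp [multiples]
    rw [show core [] = [] from rfl, deadEndValues_nil, Set.union_empty, this,
      AddSubmonoid.closure_eq, h]
  eq_one _ := rfl
  head_eq w R h := by cases h

/-- For `p = 1` the vertex drops out of the core and neither the semigroup nor the left value
changes. For `p > 1` it contributes `N / p = b ν`, and its left value is `N / b = p ν`. -/
lemma Generates.cons {T : LinTree} {p b ν : ℕ} {E : AddSubmonoid ℕ} {S : Set ℕ} (hp : 0 < p)
    (hb : 0 < b) (hb1 : b ≠ 1) (hpb : p = 1 → b ∈ E) (h : Generates T ν (stepMonoid p b E) S) :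
    Generates (⟨p * (b * ν), b, some p⟩ :: T) (p * ν) E S := by
  obtain rfl | hp1 := eq_or_ne p 1
  · have hc : core (⟨1 * (b * ν), b, some 1⟩ :: T) = core T := core_cons_of_neg (by simp) T
    rw [stepMonoid_one (hpb rfl)] at h
    exact ⟨by rw [hc, one_mul]; exact h.closure_eq, by rw [hc, one_mul]; exact h.eq_one,
      by rw [hc, one_mul]; exact h.head_eq⟩
  · have hc : core (⟨p * (b * ν), b, some p⟩ :: T) = ⟨p * (b * ν), b, some p⟩ :: core T :=
      core_cons_of_pos (by simp [hp1, hb1]) T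
    refine ⟨?_, by simp [hc], fun w R hw => ?_⟩
    · rw [hc, deadEndValues_cons, Nat.mul_div_cancel_left _ hp, ← closure_multiples_stepMonoid]
      exact h.closure_eq
    · rw [hc, List.cons.injEq] at hw
      rw [← hw.1, show p * (b * ν) = b * (p * ν) by ring, Nat.mul_div_cancel_left _ hb]

lemma Generates.closure_treeSequence {T : LinTree} {n : ℕ} {S : Set ℕ} (h : Generates T n ⊤ S) :
    (AddSubmonoid.closure {v : ℕ | v ∈ treeSequence (core T)} : Set ℕ) = S := by
  rw [← h.closure_eq]
  have hs : {v : ℕ | v ∈ treeSequence (core T)} = insert n (deadEndValues (core T)) := by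
    cases hc : core T with
    | nil =>
      rw [h.eq_one hc]
      ext v
      simp [treeSequence, deadEndValues]
    | cons w R =>
      rw [← h.head_eq w R hc]
      ext v
      simp only [treeSequence, deadEndValues, List.mem_cons, Set.mem_insert_iff, Set.mem_ofPred_eq]
  rw [hs]
  congr 1
  refine le_antisymm (AddSubmonoid.closure_mono ?_) (AddSubmonoid.closure_le.2 ?_)
  · exact Set.insert_subset (Or.inl ⟨1, trivial, by ring⟩) Set.subset_union_right
  · rintro _ (⟨e, -, rfl⟩ | hv)
    · rw [SetLike.mem_coe, mul_comm, ← smul_eq_mul]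
      exact nsmul_mem (AddSubmonoid.subset_closure (Set.mem_insert _ _)) e
    · exact AddSubmonoid.subset_closure (Set.mem_insert_of_mem _ hv)

/-! ### The semigroup of the Newton tree -/

lemma valueSet_eq_of_step {A : Subalgebra K (MvPowerSeries (Fin 2) K)} {p q p' q' c ν : ℕ}
    {m : K} {F : MvPowerSeries (Fin 2) K} {φ ψ : PowerSeries K} (hp : 0 < p) (hq : 0 < q)
    (hb : ∃ χ υ, φ = (υ + C m) ^ q' * χ ^ p ∧ ψ = (υ + C m) ^ p' * χ ^ q ∧
      IsBranchAt F c ν χ υ) :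
    ∃ χ υ, IsBranchAt F c ν χ υ ∧ valueSet A φ ψ = valueSet (A.map (hnHom p' q' m hp hq)) χ υ := by
  obtain ⟨χ, υ, rfl, rfl, hb⟩ := hb
  exact ⟨χ, υ, hb, (valueSet_map hp hq hb.prim.fst_zero hb.prim.snd_zero).symm⟩

/-- The first vertex is kept apart because it may have left decoration `1`, which `Generates.cons`
excludes; all later ones are absorbed into `Generates`. -/
theorem IsGlued.exists_generates {F : MvPowerSeries (Fin 2) K} {c : ℕ} {T : LinTree}
    (hT : IsGlued F c T) {n : ℕ} {φ ψ : PowerSeries K} (h : IsBranchAt F c n φ ψ) (hψ : ψ ≠ 0)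
    {A : Subalgebra K (MvPowerSeries (Fin 2) K)} {E : AddSubmonoid ℕ} (hA : IsStage A E c) :
    ∃ p q ν T', 0 < p ∧ 0 < q ∧ n = p * ν ∧
      T = ⟨p * ((q + c * p) * ν), q + c * p, some p⟩ :: T' ∧
      Generates T' ν (stepMonoid p (q + c * p) E) (valueSet A φ ψ) ∧ ∀ w ∈ T', w.b ≠ 1 := by
  induction hT generalizing n φ ψ A E with
  | last F c p q N μ he =>
    obtain ⟨hn, hN, hb⟩ := h.step hψ he
    have hp := he.isEdgeRoot.p_pos
    have hq := he.isEdgeRoot.q_pos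
    obtain ⟨p', q', hd⟩ := exists_isHNData hp hq he.isEdgeRoot.coprime μ
    obtain ⟨χ, υ, hb, hv⟩ := valueSet_eq_of_step (A := A) hp hq (hb p' q' _ hd)
    have hA' := hA.step hp hq he.isEdgeRoot.coprime hd.isUnimodular
      (hd.ne_zero he.isEdgeRoot.root_ne_zero)
    refine ⟨p, q, 1, [], hp, hq, hn, by rw [hN], .nil ?_, by simp⟩
    rw [hv]
    exact hA'.valueSet_eq (by exact_mod_cast hb.order_eq) hb.prim.snd_zero
  | step F c p q N μ ν he hν p' q' m hd T hT ih =>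
    obtain ⟨hn, hN, hb⟩ := h.step hψ he
    have hp := he.isEdgeRoot.p_pos
    have hq := he.isEdgeRoot.q_pos
    obtain ⟨χ, υ, hb, hv⟩ := valueSet_eq_of_step (A := A) hp hq (hb p' q' _ hd)
    have hA' := hA.step hp hq he.isEdgeRoot.coprime hd.isUnimodular
      (hd.ne_zero he.isEdgeRoot.root_ne_zero)
    obtain ⟨p₁, q₁, ν₁, T₁, hp₁, hq₁, rfl, rfl, hg, hw⟩ := ih hb (hb.snd_ne_zero hν) hA'
    have hc : 0 < (q + c * p) * p * p₁ :=
      Nat.mul_pos (Nat.mul_pos (Nat.add_pos_left hq _) hp) hp₁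
    -- After the first vertex the product `c` is positive, so left decorations are at least `2`;
    -- they also exceed the conductor bound, as the case `p₁ = 1` requires.
    have hb1 : q₁ + (q + c * p) * p * p₁ ≠ 1 := by omega
    refine ⟨p, q, p₁ * ν₁, _, hp, hq, hn, by rw [hN], ?_, ?_⟩
    · rw [hv]
      refine hg.cons hp₁ (by omega) hb1 fun h1 => hA'.conductor _ ?_
      rw [h1, mul_one]
      exact Nat.le_add_left _ _
    · intro w hw'
      rcases List.mem_cons.1 hw' with rfl | hw'
      · exact hb1
      · exact hw w hw'

theorem IsGlued.closure_treeSequence {F : MvPowerSeries (Fin 2) K} {T : LinTree}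
    (hT : IsGlued F 0 T) {n : ℕ} {φ ψ : PowerSeries K} (h : IsBranchAt F 0 n φ ψ) (hψ : ψ ≠ 0) :
    (AddSubmonoid.closure {v : ℕ | v ∈ treeSequence (core T)} : Set ℕ) =
      valueSet (⊤ : Subalgebra K _) φ ψ ∧ IsAdmissible T := by
  obtain ⟨p, q, ν, T', hp, hq, rfl, rfl, hg, hw⟩ := hT.exists_generates h hψ isStage_top
  refine ⟨?_, hw⟩
  rw [zero_mul, add_zero] at hg ⊢
  -- At the first vertex `E = ℕ`, and a decoration `1` on either dead end gives `p ℕ + q ℕ = ℕ`.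
  by_cases hpq : p = 1 ∨ q = 1
  · rw [core_cons_of_neg (by simp; tauto)]
    rw [stepMonoid_top hpq] at hg
    exact hg.closure_treeSequence
  · exact (hg.cons hp hq (fun h => hpq (Or.inr h)) fun _ => AddSubmonoid.mem_top _).closure_treeSequence

/-! ### Branches on which a coordinate vanishes -/

/-- An edge would contain two support points at different heights; the one with larger `j` is
heavier than the monomial `x`, respectively `y`, which occurs in the series. -/
lemma not_isEdgeRoot_of_isUnit {u : MvPowerSeries (Fin 2) K} (hu : IsUnit u) (s : Fin 2)
    {p q N ν : ℕ} {μ : K} : ¬ IsEdgeRoot (MvPowerSeries.X s * u) p q N μ ν := by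
  intro h
  obtain ⟨p', q', hd⟩ := exists_isHNData h.p_pos h.q_pos h.coprime μ
  obtain ⟨⟨i, j, hij, hwt⟩, hlt⟩ := weightedOrder_eq_iff.1 h.order_eq
  obtain ⟨i₀, j₀, i₁, j₁, hn₀, hw₀, hn₁, -, hle⟩ := exists_support_of_X_pow_dvd h.p_pos
    h.q_pos hd.isUnimodular (hd.ne_zero h.root_ne_zero) (k := 1)
    (by rw [pow_one]; exact X_dvd_row_of_isEdgeRoot h hd) hwt hij
  have hp := h.p_pos
  have hu0 := isUnit_iff_bcoeff.1 hu
  have hsupp {d : Fin 2 →₀ ℕ} (hd : MvPowerSeries.coeff d (MvPowerSeries.X s * u) ≠ 0) :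
      0 < d s :=
    Nat.pos_of_ne_zero fun h0 => hd (MvPowerSeries.X_dvd_iff.1 (dvd_mul_right _ _) d h0)
  revert s
  refine Fin.forall_fin_two.2 ⟨fun h hlt _ hn₀ hn₁ hsupp => ?_,
    fun h hlt _ hn₀ hn₁ hsupp => ?_⟩
  · have h1 : 0 < i₀ := by simpa using hsupp hn₀
    have h2 : N ≤ p * 1 + q * 0 := by
      by_contra hN
      have h3 := hlt 1 0 (not_le.1 hN)
      rw [← pow_one (MvPowerSeries.X 0)] at h3
      exact hu0 ((bcoeff_X_pow_mul 1 0 0 u).symm.trans h3)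
    have h4 := Nat.le_mul_of_pos_right p h1
    have h5 := Nat.mul_pos h.q_pos (show 0 < j₀ by omega)
    omega
  · have h1 : 0 < j₁ := by simpa using hsupp hn₁
    have h2 : N ≤ p * 0 + q * 1 := by
      by_contra hN
      have h3 := hlt 0 1 (not_le.1 hN)
      rw [← coeff_restr, map_mul, restr_X_one, show (1 : ℕ) = 0 + 1 from rfl,
        PowerSeries.coeff_succ_X_mul, coeff_restr] at h3
      exact hu0 h3
    have h4 := Nat.mul_le_mul_left q (show 2 ≤ j₀ by omega)
    have h5 := h.q_pos
    omega

lemma restr_toMvPowerSeries_one (g : PowerSeries K) :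
    restr (PowerSeries.toMvPowerSeries (1 : Fin 2) g) = g := by
  ext j
  rw [coeff_restr, PowerSeries.toMvPowerSeries_eq_subst, bcoeff, PowerSeries.coeff_subst_single,
    bexp_one, if_pos (by simp [bexp])]

lemma X_zero_dvd_iff {F : MvPowerSeries (Fin 2) K} : MvPowerSeries.X 0 ∣ F ↔ restr F = 0 := by
  rw [← pow_one (MvPowerSeries.X 0), X_pow_dvd_iff_rows, restr_apply]
  simp

lemma evalAt_zero_fst {ψ : PowerSeries K} (hψ : constantCoeff ψ = 0)
    (F : MvPowerSeries (Fin 2) K) : evalAt 0 ψ F = PowerSeries.subst ψ (restr F) := by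
  obtain ⟨G, hG⟩ : MvPowerSeries.X 0 ∣ F - PowerSeries.toMvPowerSeries (1 : Fin 2) (restr F) := by
    rw [X_zero_dvd_iff, map_sub, restr_toMvPowerSeries_one, sub_self]
  rw [← evalAt_toMvPowerSeries_one (map_zero _) hψ, ← sub_eq_zero,
    ← evalHom_apply (map_zero _) hψ, ← evalHom_apply (map_zero _) hψ, ← map_sub, hG, map_mul,
    evalHom_X_zero, zero_mul]

lemma exists_eq_X_mul_isUnit {f : MvPowerSeries (Fin 2) K} (hf : Irreducible f)
    {φ ψ : PowerSeries K} (h : IsPrimPair φ ψ) (hz : evalAt φ ψ f = 0) (h0 : φ = 0 ∨ ψ = 0) :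
    ∃ s u, IsUnit u ∧ f = MvPowerSeries.X s * u := by
  suffices ∃ s, MvPowerSeries.X s ∣ f by
    obtain ⟨s, u, hu⟩ := this
    refine ⟨s, u, (hf.isUnit_or_isUnit hu).resolve_left fun hs => ?_, hu⟩
    simpa using hs.map MvPowerSeries.constantCoeff
  rcases h0 with rfl | rfl
  · refine ⟨0, X_zero_dvd_iff.2 ?_⟩
    rw [evalAt_zero_fst h.snd_zero] at hz
    exact (order_subst_toNat h.snd_zero
      (ne_zero_of_order_eq (n := 1) h.order_eq_one_of_fst_eq_zero) _).2 hz
  · have h1 : order φ = (1 : ℕ) := h.order_eq_one_of_snd_eq_zero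
    -- Since `ord φ = 1`, the series `y` is minimal for `(φ, 0)` and divides everything that
    -- vanishes there.
    refine ⟨1, IsMinimalFor.dvd (h.resolves (ne_zero_of_order_eq h1)) ⟨?_, ?_⟩ hz⟩
    · rw [← evalHom_apply h.fst_zero h.snd_zero, evalHom_X_one]
    · rw [restr_X_one, PowerSeries.order_X, h1, Nat.cast_one]

lemma valueSet_top_of_eq_zero {φ ψ : PowerSeries K} (h : IsPrimPair φ ψ) (h0 : φ = 0 ∨ ψ = 0) :
    valueSet (⊤ : Subalgebra K (MvPowerSeries (Fin 2) K)) φ ψ = Set.univ := by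
  have aux {a : PowerSeries K} (h : order a = 1) (n : ℕ) : order (a ^ n) = n := by
    rw [PowerSeries.order_pow, h, nsmul_eq_mul, mul_one]
  refine Set.eq_univ_of_forall fun n => ?_
  rcases h0 with rfl | rfl
  · refine ⟨MvPowerSeries.X 1 ^ n, trivial, ?_⟩
    rw [← evalHom_apply h.fst_zero h.snd_zero, map_pow, evalHom_X_one,
      aux h.order_eq_one_of_fst_eq_zero]
  · refine ⟨MvPowerSeries.X 0 ^ n, trivial, ?_⟩
    rw [← evalHom_apply h.fst_zero h.snd_zero, map_pow, evalHom_X_zero,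
      aux h.order_eq_one_of_snd_eq_zero]

/-- A finite value already excludes divisibility by `f`. Uniqueness of the parametrization is not
needed, because the tree yields the same set for each one. -/
lemma valueSemigroup_eq {f : MvPowerSeries (Fin 2) K} {S : Set ℕ}
    (hne : ∃ φ ψ, IsPrimitiveParam f φ ψ)
    (h : ∀ φ ψ, IsPrimitiveParam f φ ψ → valueSet (⊤ : Subalgebra K _) φ ψ = S) :
    valueSemigroup f = S := by
  ext n
  constructor
  · rintro ⟨φ, ψ, hp, g, -, hg⟩
    exact h φ ψ hp ▸ ⟨g, trivial, hg⟩
  · intro hn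
    obtain ⟨φ, ψ, hp⟩ := hne
    rw [← h φ ψ hp] at hn
    obtain ⟨g, -, hg⟩ := hn
    refine ⟨φ, ψ, hp, g, ?_, hg⟩
    rintro ⟨k, rfl⟩
    rw [evalAt_mul hp.fst_zero hp.snd_zero, hp.eval_eq_zero, zero_mul] at hg
    simp at hg

lemma IsPrimitiveParam.isBranchAt {f : MvPowerSeries (Fin 2) K} (hf : Irreducible f)
    {φ ψ : PowerSeries K} (h : IsPrimitiveParam f φ ψ) (hφ : φ ≠ 0) :
    IsBranchAt f 0 φ.order.toNat φ ψ := by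
  obtain ⟨hp, hz⟩ := isPrimitiveParam_iff.1 h
  exact ⟨hp, (PowerSeries.coe_toNat_order hφ).symm, f,
    .of_irreducible (hp.resolves hφ) hf hz, by simp⟩

/-- The Newton tree of an irreducible series. -/
theorem IsNewtonTree.closure_treeSequence [IsAlgClosed K] {f : MvPowerSeries (Fin 2) K}
    (hf : Irreducible f) {T : LinTree} (hT : IsNewtonTree f T) :
    (AddSubmonoid.closure {v : ℕ | v ∈ treeSequence (core T)} : Set ℕ) = valueSemigroup f ∧
      IsAdmissible T := by
  have main (φ ψ : PowerSeries K) (h : IsPrimitiveParam f φ ψ) :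
      (AddSubmonoid.closure {v : ℕ | v ∈ treeSequence (core T)} : Set ℕ) =
        valueSet (⊤ : Subalgebra K _) φ ψ ∧ IsAdmissible T := by
    obtain ⟨hp, hz⟩ := isPrimitiveParam_iff.1 h
    by_cases h0 : φ = 0 ∨ ψ = 0
    · obtain ⟨s, u, hu, rfl⟩ := exists_eq_X_mul_isUnit hf hp hz h0
      have hT : T = [] := by
        rcases hT with hT | hT
        · exact hT.2
        · cases hT with
          | last _ _ _ _ _ _ h => exact (not_isEdgeRoot_of_isUnit hu s h.isEdgeRoot).elim
          | step _ _ _ _ _ _ _ h => exact (not_isEdgeRoot_of_isUnit hu s h.isEdgeRoot).elim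
      subst hT
      refine ⟨?_, by simp [IsAdmissible]⟩
      rw [valueSet_top_of_eq_zero hp h0]
      refine Set.eq_univ_of_forall fun n => ?_
      have h1 : 1 ∈ AddSubmonoid.closure {v : ℕ | v ∈ treeSequence (core [])} :=
        AddSubmonoid.subset_closure (by simp [core, treeSequence])
      simpa using nsmul_mem h1 n
    · obtain ⟨hφ, hψ⟩ := not_or.1 h0
      have hb := h.isBranchAt hf hφ
      rcases hT with ⟨hT, -⟩ | hT
      · obtain ⟨p, q, μ, ν, -, he, -⟩ := hb.exists_edge hψ
        exact (hT _ _ _ _ _ he.isEdgeRoot).elim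
      · exact hT.closure_treeSequence hb hψ
  obtain ⟨φ, ψ, h⟩ := exists_isPrimitiveParam hf
  exact ⟨(valueSemigroup_eq ⟨φ, ψ, h⟩ fun φ ψ h => (main φ ψ h).1.symm).symm, (main φ ψ h).2⟩

theorem exists_isNewtonTree [IsAlgClosed K] {f : MvPowerSeries (Fin 2) K} (hf : Irreducible f) :
    ∃ T, IsNewtonTree f T := by
  obtain ⟨φ, ψ, h⟩ := exists_isPrimitiveParam hf
  by_cases h0 : φ = 0 ∨ ψ = 0
  · obtain ⟨hp, hz⟩ := isPrimitiveParam_iff.1 h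
    obtain ⟨s, u, hu, rfl⟩ := exists_eq_X_mul_isUnit hf hp hz h0
    exact ⟨[], Or.inl ⟨fun _ _ _ _ _ => not_isEdgeRoot_of_isUnit hu s, rfl⟩⟩
  · obtain ⟨hφ, hψ⟩ := not_or.1 h0
    obtain ⟨T, hT⟩ := (h.isBranchAt hf hφ).exists_isGlued hψ
    exact ⟨T, Or.inr hT⟩

end NewtonTree

end

/-! ### The minimal tree and the value semigroup. -/

theorem mainTheorem7 {K : Type*} [Field K] [IsAlgClosed K]
    (f : MvPowerSeries (Fin 2) K) (hf : Irreducible f) :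
    (∃ T : NewtonTree.LinTree, NewtonTree.IsMinimalTree f T) ∧
    ∀ T : NewtonTree.LinTree, NewtonTree.IsMinimalTree f T →
      (AddSubmonoid.closure {v : ℕ | v ∈ NewtonTree.treeSequence T} : Set ℕ) =
        NewtonTree.valueSemigroup f := by
  constructor
  · obtain ⟨T₀, h₀⟩ := NewtonTree.exists_isNewtonTree hf
    obtain ⟨T, hT⟩ := NewtonTree.exists_normal_form T₀
    exact ⟨T, T₀, h₀, hT⟩
  · rintro T ⟨T₀, h₀, hT, hmin⟩
    obtain ⟨hcl, hadm⟩ := h₀.closure_treeSequence hf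
    obtain ⟨h₁, h₂⟩ := hadm.reflTransGen hT
    rw [← hcl, ← h₂, h₁.core_eq_self hmin]
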